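/- Let $n\ge 2$, and let the cities be labeled $1,\dots,n$. A Hamiltonian tour of the complete digraph $K_n=(V,E)$ is given by its successor map $\tau$. A city $i$ is a *peak* if $\tau^{-1}(i)<i$ and $\tau(i)<i$. It is a *step-back peak in ascending order* if $\tau^{-1}(i)<i$, $\tau(i)=i-1$, $\tau^{2}(i)>i$, and a *step-back peak in descending order* if $\tau^{-2}(i)>i$, $\tau^{-1}(i)=i-1$, $\tau(i)<i$. A *pyramidal tour with step-backs* is a Hamiltonian tour in which $n$ is the only peak that is not a step-back peak. Let $\mathbf v(x)\in\{0,1\}^{E}$ be the characteristic vector of the arc set of a tour $x$, and let $$\operatorname{PSB}(n)=\operatorname{conv}\{\mathbf v(x)\mid x \text{ is a pyramidal tour with step-backs in } K_n\}.$$ Two distinct vertices of $\operatorname{PSB}(n)$ are *adjacent* if the segment between them is a face (an edge) of $\operatorname{PSB}(n)$. The *pyramidal encoding* of a pyramidal tour with step-backs is the word of length $n-2$ with one symbol for each city $2\le i\le n-1$, which tells whether $i$ is a step-back peak in ascending order, a step-back peak in descending order, or, otherwise, whether $i$ is visited on the way from $1$ to $n$ or on the way from $n$ back to $1$. **Theorem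 2.** Whether two vertices $\mathbf v(x)$ and $\mathbf v(y)$ of $\operatorname{PSB}(n)$ are adjacent can be decided in $O(n)$ time. That is, there are a constant $C$ and two random access machine programs (with assignment of constants, addition, truncated subtraction, indirect loads and stores, and comparisons, each costing one step), all independent of $n$, such that for every $n\ge 2$ and all pyramidal tours with step-backs $x$ and $y$ in $K_n$ the following holds. The first program, given $n$ and the pyramidal encodings of $x$ and $y$, and the second program, given $n$ and the successor maps of $x$ and $y$ as arrays, halt after at most $Cn$ steps, never write a number larger than $Cn$, and output $1$ if $\mathbf v(x)$ and $\mathbf v(y)$ are adjacent and $0$ otherwise. -/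

import Mathlib

/-! ### Pyramidal tours with step-backs

The cities are the elements of `Fin n`; the element `i` is the city with label `i + 1`, so that
the first city is `0` and the last city is `n - 1`. A tour is given by its successor map. -/

namespace PyramidalTour

/-- `τ` is (the successor map of) a Hamiltonian tour: a single cycle through all the cities. -/
def IsHamiltonianTour {n : ℕ} (τ : Equiv.Perm (Fin n)) : Prop :=
  τ.IsCycleOn Set.univ

/-- The city `i` is a peak: its predecessor and its successor have smaller labels. -/
def IsPeak {n : ℕ} (τ : Equiv.Perm (Fin n)) (i : Fin n) : Prop :=
  τ.symm i < i ∧ τ i < i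

/-- The city `i` is a step-back peak in ascending order:
`τ⁻¹(i) < i`, `τ(i) = i - 1`, `τ²(i) > i`. -/
def IsAscStepBackPeak {n : ℕ} (τ : Equiv.Perm (Fin n)) (i : Fin n) : Prop :=
  τ.symm i < i ∧ (τ i : ℕ) + 1 = i ∧ i < τ (τ i)

/-- The city `i` is a step-back peak in descending order:
`τ⁻²(i) > i`, `τ⁻¹(i) = i - 1`, `τ(i) < i`. -/
def IsDescStepBackPeak {n : ℕ} (τ : Equiv.Perm (Fin n)) (i : Fin n) : Prop :=
  i < τ.symm (τ.symm i) ∧ (τ.symm i : ℕ) + 1 = i ∧ τ i < i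

/-- A proper peak is a peak that is not a step-back peak. -/
def IsProperPeak {n : ℕ} (τ : Equiv.Perm (Fin n)) (i : Fin n) : Prop :=
  IsPeak τ i ∧ ¬ (IsAscStepBackPeak τ i ∨ IsDescStepBackPeak τ i)

/-- `τ` is a pyramidal tour with step-backs: a Hamiltonian tour whose only proper peak is the
last city. -/
def IsPyramidalSB {n : ℕ} (τ : Equiv.Perm (Fin n)) : Prop :=
  IsHamiltonianTour τ ∧ ∀ i : Fin n, IsProperPeak τ i ↔ (i : ℕ) + 1 = n

/-! ### The polytope and its 1-skeleton -/

/-- The arcs of the complete digraph on `n` cities. -/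
abbrev Arc (n : ℕ) : Type := {e : Fin n × Fin n // e.1 ≠ e.2}

/-- The characteristic vector of a tour. -/
noncomputable def charVec {n : ℕ} (τ : Equiv.Perm (Fin n)) : Arc n → ℝ :=
  fun e => if τ e.1.1 = e.1.2 then 1 else 0

/-- `PSB(n)`, the polytope of pyramidal tours with step-backs. -/
def PSB (n : ℕ) : Set (Arc n → ℝ) :=
  convexHull ℝ {v | ∃ τ : Equiv.Perm (Fin n), IsPyramidalSB τ ∧ charVec τ = v}

/-- The 1-skeleton of a polytope `P`: the vertices are the extreme points of `P`, and two distinct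
vertices are adjacent if the segment between them is a face (a convex extreme subset) of `P`. -/
def oneSkeleton {E : Type*} [AddCommGroup E] [Module ℝ E] (P : Set E) :
    SimpleGraph (P.extremePoints ℝ) where
  Adj v w := v ≠ w ∧ IsExtreme ℝ P (segment ℝ (v : E) (w : E))
  symm := ⟨fun v w h => ⟨h.1.symm, by rw [segment_symm]; exact h.2⟩⟩
  loopless := ⟨fun _ h => h.1 rfl⟩

/-! ### The pyramidal encoding -/

/-- The city `i` is visited on the way from the first city to the last city, the last city itself
excluded. -/
def IsAscending {n : ℕ} (τ : Equiv.Perm (Fin n)) (i : Fin n) : Prop :=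
  ∃ (s : Fin n) (k : ℕ), (s : ℕ) = 0 ∧ (τ ^ k) s = i ∧ ∀ m ≤ k, ((τ ^ m) s : ℕ) + 1 ≠ n

open Classical in
/-- The coordinate of the pyramidal encoding at the city `i`. The four symbols are coded by
numbers: `0` and `1` for a city visited in descending and in ascending order, `2` and `3` for a
step-back peak in descending and in ascending order. (The first coordinate of a step-back is
marked by the step-back peak that follows it.) -/
noncomputable def encoding {n : ℕ} (τ : Equiv.Perm (Fin n)) (i : Fin n) : ℕ :=
  if IsAscStepBackPeak τ i then 3
  else if IsDescStepBackPeak τ i then 2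
  else if IsAscending τ i then 1
  else 0

/-! ### Random access machines with a step count -/

/-- Programs of a random access machine with registers `R_0, R_1, …` and arrays
`A_0, A_1, …` of natural numbers. A program mentions finitely many registers and arrays. -/
inductive Prog : Type where
  /-- `R_r := k` -/
  | const (r k : ℕ) : Prog
  /-- `R_r := R_a + R_b` -/
  | add (r a b : ℕ) : Prog
  /-- `R_r := R_a - R_b`, truncated at `0` -/
  | sub (r a b : ℕ) : Prog
  /-- `R_r := A_a[R_i]` -/
  | load (r a i : ℕ) : Prog
  /-- `A_a[R_i] := R_r` -/
  | store (a i r : ℕ) : Prog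
  /-- do nothing -/
  | skip : Prog
  /-- first `p`, then `q` -/
  | seq (p q : Prog) : Prog
  /-- `if R_a ≤ R_b then p else q` -/
  | ifLe (a b : ℕ) (p q : Prog) : Prog
  /-- `while R_a < R_b do p` -/
  | whileLt (a b : ℕ) (p : Prog) : Prog

/-- The memory of the machine. -/
structure Mem : Type where
  /-- the contents of the registers -/
  reg : ℕ → ℕ
  /-- the contents of the arrays -/
  arr : ℕ → ℕ → ℕ

/-- The memory after `R_r := k`. -/
def Mem.setReg (s : Mem) (r k : ℕ) : Mem :=
  { s with reg := Function.update s.reg r k }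

/-- The memory after `A_a[i] := k`. -/
def Mem.setArr (s : Mem) (a i k : ℕ) : Mem :=
  { s with arr := Function.update s.arr a (Function.update (s.arr a) i k) }

/-- `Exec W p s t s'`: started in the memory `s`, the program `p` halts after exactly `t` steps in
the memory `s'`, and it writes no number larger than `W` (the word size). Every elementary
instruction and every evaluation of a test is one step. -/
inductive Exec (W : ℕ) : Prog → Mem → ℕ → Mem → Prop where
  | const (r k : ℕ) (s : Mem) (h : k ≤ W) :
      Exec W (.const r k) s 1 (s.setReg r k)
  | add (r a b : ℕ) (s : Mem) (h : s.reg a + s.reg b ≤ W) :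
      Exec W (.add r a b) s 1 (s.setReg r (s.reg a + s.reg b))
  | sub (r a b : ℕ) (s : Mem) (h : s.reg a - s.reg b ≤ W) :
      Exec W (.sub r a b) s 1 (s.setReg r (s.reg a - s.reg b))
  | load (r a i : ℕ) (s : Mem) (h : s.arr a (s.reg i) ≤ W) :
      Exec W (.load r a i) s 1 (s.setReg r (s.arr a (s.reg i)))
  | store (a i r : ℕ) (s : Mem) (h : s.reg r ≤ W) :
      Exec W (.store a i r) s 1 (s.setArr a (s.reg i) (s.reg r))
  | skip (s : Mem) :
      Exec W .skip s 1 s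
  | seq {p q : Prog} {s s' s'' : Mem} {t t' : ℕ} (hp : Exec W p s t s')
      (hq : Exec W q s' t' s'') :
      Exec W (.seq p q) s (t + t') s''
  | ifTrue {a b : ℕ} {p q : Prog} {s s' : Mem} {t : ℕ} (h : s.reg a ≤ s.reg b)
      (hp : Exec W p s t s') :
      Exec W (.ifLe a b p q) s (t + 1) s'
  | ifFalse {a b : ℕ} {p q : Prog} {s s' : Mem} {t : ℕ} (h : ¬ s.reg a ≤ s.reg b)
      (hq : Exec W q s t s') :
      Exec W (.ifLe a b p q) s (t + 1) s'
  | whileTrue {a b : ℕ} {p : Prog} {s s' s'' : Mem} {t t' : ℕ} (h : s.reg a < s.reg b)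
      (hp : Exec W p s t s') (hw : Exec W (.whileLt a b p) s' t' s'') :
      Exec W (.whileLt a b p) s (t + t' + 1) s''
  | whileFalse {a b : ℕ} {p : Prog} {s : Mem} (h : ¬ s.reg a < s.reg b) :
      Exec W (.whileLt a b p) s 1 s

/-- The program `p`, started in the memory `s`, decides within `T` steps, on words of size `W`,
whether `A` holds: it halts with `1` in the register `R_0` if `A` holds, and with `0` if not. -/
def Decides (W T : ℕ) (p : Prog) (s : Mem) (A : Prop) : Prop :=
  ∃ t s', t ≤ T ∧ Exec W p s t s' ∧ (A ∧ s'.reg 0 = 1 ∨ ¬ A ∧ s'.reg 0 = 0)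

/-- The initial memory: `R_0 = n`, the arrays `A_0` and `A_1` hold `u` and `w`, and everything
else is `0`. -/
def inputMem (n : ℕ) (u w : ℕ → ℕ) : Mem where
  reg r := if r = 0 then n else 0
  arr a := if a = 0 then u else if a = 1 then w else 0

/-- The tour as an array: the entry at `i < n` is the successor of the city `i`. -/
def tourArray {n : ℕ} (τ : Equiv.Perm (Fin n)) : ℕ → ℕ :=
  fun i => if h : i < n then (τ ⟨i, h⟩ : ℕ) else 0

/-- The pyramidal encoding as an array: it has an entry for every city but the first and the
last one. -/
noncomputable def encodingArray {n : ℕ} (τ : Equiv.Perm (Fin n)) : ℕ → ℕ :=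
  fun i => if h : 0 < i ∧ i + 1 < n then encoding τ ⟨i, by omega⟩ else 0

end PyramidalTour

/-! Adjacency is reduced to connectedness of a graph of bounded degree on the cities where `x` and
`y` differ, and this graph is searched in linear time.

Tours. The local description `IsPSB` keeps only that every peak but the last city is a step-back
peak; a permutation without fixed points and with this property is automatically a single cycle.
Peaks and valleys are equal in number, so every valley but the first city is the bottom of a
step-back (`valley`), and two upward arcs across one level force a valley there (`two_up`). An
ascending step-back peak at `j + 1` is governed by three features, each of a single arc: `g (j + 1)
< j`, `f (j + 1) = j` and `j + 1 < f j`. Any two of them imply the third (`step_back_third`).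

Criterion. Cities are joined if their arcs of `x` and `y` enter a common city, or if they carry
features that both separate `x` from `y` and take part in one peak condition. Unions of components
are the `Saturated` sets. Exchanging the arcs of `x` for those of `y` on a saturated set, or on its
complement, gives two tours again (`isPSB_mix`); if both parts contain cities where `x` and `y`
differ, these tours have the same midpoint as `x` and `y`, so the vertices are not adjacent.
Conversely, consider a convex combination of tours that lies in the segment. Its tours use only arcs
of `x` and `y`. The indicator of a feature is linear, so an implication between features that is an
equivalence at `x` and `y` and holds in the combined tours is an equivalence in all of them
(`IsSupport.tight`). This makes joined cities follow the same one of `x` and `y`; the hard case,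
where one tour has all three features and the other none, needs the case analysis `no_pattern`.
Hence each combined tour follows `x` on a saturated set (`IsSupport.saturated`), and it is `x` or
`y` if there is one component. The outcome is `adj_iff_of_component`.

Algorithm. Each city has at most twelve neighbours, found by a bounded number of array accesses. A
search from one city of difference marks its component, and a last pass looks for unmarked
differences. An encoding is first decoded by inserting the cities in increasing order into two
growing paths (`Frontier`). The programs are loops over compiled loop-free statements; their
expressions contain no addition, so the word bound is preserved without bookkeeping. -/

namespace PyramidalTour

/-! ### Structured programs -/

/-- All the numbers in the memory are at most `W`. -/
def Mem.Bounded (W : ℕ) (s : Mem) : Prop :=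
  (∀ r, s.reg r ≤ W) ∧ ∀ a i, s.arr a i ≤ W

theorem Mem.Bounded.setReg {W : ℕ} {s : Mem} (hs : s.Bounded W) (r : ℕ) {k : ℕ} (hk : k ≤ W) :
    (s.setReg r k).Bounded W := by
  refine ⟨fun q => ?_, hs.2⟩
  by_cases h : q = r
  · simp [Mem.setReg, h, hk]
  · simp [Mem.setReg, h, hs.1 q]

theorem Mem.Bounded.setArr {W : ℕ} {s : Mem} (hs : s.Bounded W) (a i : ℕ) {k : ℕ} (hk : k ≤ W) :
    (s.setArr a i k).Bounded W := by
  refine ⟨hs.1, fun b j => ?_⟩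
  by_cases h : b = a
  · subst h
    by_cases h' : j = i
    · simp [Mem.setArr, h', hk]
    · simp [Mem.setArr, h', hs.2 b j]
  · simp [Mem.setArr, h, hs.2 b j]

theorem Exec.bounded {W t : ℕ} {p : Prog} {s s' : Mem} (h : Exec W p s t s') :
    s.Bounded W → s'.Bounded W := by
  induction h with
  | const r k s h => exact fun hs => hs.setReg r h
  | add r a b s h => exact fun hs => hs.setReg r h
  | sub r a b s h => exact fun hs => hs.setReg r h
  | load r a i s h => exact fun hs => hs.setReg r h
  | store a i r s h => exact fun hs => hs.setArr a _ h
  | skip s => exact id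
  | seq _ _ ih₁ ih₂ => exact fun hs => ih₂ (ih₁ hs)
  | ifTrue _ _ ih => exact ih
  | ifFalse _ _ ih => exact ih
  | whileTrue _ _ _ ih₁ ih₂ => exact fun hs => ih₂ (ih₁ hs)
  | whileFalse _ => exact id

/-- Expressions over the memory. -/
inductive Expr : Type where
  | reg (r : ℕ) : Expr
  | const (k : ℕ) : Expr
  | sub (a b : Expr) : Expr
  | load (a : ℕ) (e : Expr) : Expr
  | ifLe (a b c d : Expr) : Expr

namespace Expr

/-- The value of an expression. -/
def eval (s : Mem) : Expr → ℕ
  | reg r => s.reg r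
  | const k => k
  | sub a b => a.eval s - b.eval s
  | load a e => s.arr a (e.eval s)
  | ifLe a b c d => if a.eval s ≤ b.eval s then c.eval s else d.eval s

/-- The expression mentions only registers below `20` and constants up to `3`. -/
def wf : Expr → Bool
  | reg r => decide (r < 20)
  | const k => decide (k ≤ 3)
  | sub a b => a.wf && b.wf
  | load _ e => e.wf
  | ifLe a b c d => a.wf && b.wf && c.wf && d.wf

/-- The program that evaluates an expression into the register `r`, using only registers from `r`
on as scratch space. -/
def compile : Expr → ℕ → Prog
  | reg q, r => .seq (.const r 0) (.add r q r)
  | const k, r => .const r k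
  | sub a b, r => .seq (a.compile r) (.seq (b.compile (r + 1)) (.sub r r (r + 1)))
  | load a e, r => .seq (e.compile r) (.load r a r)
  | ifLe a b c d, r =>
    .seq (a.compile r) (.seq (b.compile (r + 1)) (.ifLe r (r + 1) (c.compile r) (d.compile r)))

/-- A bound for the number of steps of the evaluation. -/
def cost : Expr → ℕ
  | reg _ => 2
  | const _ => 1
  | sub a b => a.cost + b.cost + 1
  | load _ e => e.cost + 1
  | ifLe a b c d => a.cost + b.cost + c.cost + d.cost + 1

end Expr

/-- Two memories agree up to the scratch registers, which are those from `20` on. -/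
def Mem.Agree (s s' : Mem) : Prop :=
  (∀ r < 20, s.reg r = s'.reg r) ∧ s.arr = s'.arr

theorem Mem.Agree.refl (s : Mem) : s.Agree s := ⟨fun _ _ => rfl, rfl⟩

/-- The induction starts from a memory `s₀` that may differ from `s` in the scratch registers,
because the second operand is evaluated after the first one has changed them. Only copies, small
constants and truncated differences are written, so boundedness of the memory gives the word bound.
-/
theorem Expr.exec_compile {W : ℕ} (hW : 3 ≤ W) (e : Expr) (he : e.wf) {s : Mem} :
    ∀ {s₀ : Mem} {r : ℕ}, 20 ≤ r → s₀.Agree s → s₀.Bounded W →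
      ∃ t s', t ≤ e.cost ∧ Exec W (e.compile r) s₀ t s' ∧ s'.reg r = e.eval s ∧
        (∀ q < r, s'.reg q = s₀.reg q) ∧ s'.arr = s₀.arr := by
  induction e with
  | reg q =>
    intro s₀ r hr hs hb
    have hq : q < 20 := by simpa [wf] using he
    -- A register is copied by adding it to a zeroed scratch register.
    refine ⟨1 + 1, _, le_rfl, .seq (.const r 0 s₀ (Nat.zero_le _)) (.add r q r _ ?_), ?_, ?_, ?_⟩
    · have : q ≠ r := by omega
      simpa [Mem.setReg, this] using hb.1 q
    · have : q ≠ r := by omega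
      simpa [Mem.setReg, this, eval] using hs.1 q hq
    · intro q' hq'
      have : q' ≠ r := by omega
      simp [Mem.setReg, this]
    · rfl
  | const k =>
    intro s₀ r hr hs hb
    have hk : k ≤ 3 := by simpa [wf] using he
    refine ⟨1, _, le_rfl, .const r k s₀ (hk.trans hW), ?_, ?_, rfl⟩
    · simp [Mem.setReg, eval]
    · intro q' hq'
      have : q' ≠ r := by omega
      simp [Mem.setReg, this]
  | sub a b iha ihb =>
    intro s₀ r hr hs hb
    simp only [wf, Bool.and_eq_true] at he
    obtain ⟨t₁, s₁, ht₁, h₁, hr₁, hq₁, ha₁⟩ := iha he.1 hr hs hb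
    obtain ⟨t₂, s₂, ht₂, h₂, hr₂, hq₂, ha₂⟩ := ihb he.2 (r := r + 1) (by omega)
      (s₀ := s₁) ⟨fun q hq => by rw [hq₁ q (by omega), hs.1 q hq], ha₁.trans hs.2⟩
      (h₁.bounded hb)
    have hb₂ := h₂.bounded (h₁.bounded hb)
    refine ⟨t₁ + (t₂ + 1), _, ?_, .seq h₁ (.seq h₂ (.sub r r (r + 1) s₂ ?_)), ?_, ?_, ?_⟩
    · simp only [cost]; omega
    · exact (Nat.sub_le _ _).trans (hb₂.1 r)
    · simp [Mem.setReg, eval, hr₂, hq₂ r (by omega), hr₁]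
    · intro q hq
      have : q ≠ r := by omega
      simp [Mem.setReg, this, hq₂ q (by omega), hq₁ q hq]
    · exact ha₂.trans ha₁
  | load a e ih =>
    intro s₀ r hr hs hb
    simp only [wf] at he
    obtain ⟨t₁, s₁, ht₁, h₁, hr₁, hq₁, ha₁⟩ := ih he hr hs hb
    refine ⟨t₁ + 1, _, ?_, .seq h₁ (.load r a r s₁ ((h₁.bounded hb).2 _ _)), ?_, ?_, ha₁⟩
    · simp only [cost]; omega
    · simp [Mem.setReg, eval, hr₁, ha₁, hs.2]
    · intro q hq
      have : q ≠ r := by omega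
      simp [Mem.setReg, this, hq₁ q hq]
  | ifLe a b c d iha ihb ihc ihd =>
    intro s₀ r hr hs hb
    simp only [wf, Bool.and_eq_true] at he
    obtain ⟨t₁, s₁, ht₁, h₁, hr₁, hq₁, ha₁⟩ := iha he.1.1.1 hr hs hb
    obtain ⟨t₂, s₂, ht₂, h₂, hr₂, hq₂, ha₂⟩ := ihb he.1.1.2 (r := r + 1) (by omega)
      (s₀ := s₁) ⟨fun q hq => by rw [hq₁ q (by omega), hs.1 q hq], ha₁.trans hs.2⟩
      (h₁.bounded hb)
    have hb₂ := h₂.bounded (h₁.bounded hb)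
    have hs₂ : s₂.Agree s :=
      ⟨fun q hq => by rw [hq₂ q (by omega), hq₁ q (by omega), hs.1 q hq],
        (ha₂.trans ha₁).trans hs.2⟩
    have hra : s₂.reg r = a.eval s := by rw [hq₂ r (by omega), hr₁]
    by_cases hab : a.eval s ≤ b.eval s
    · obtain ⟨t₃, s₃, ht₃, h₃, hr₃, hq₃, ha₃⟩ := ihc he.1.2 hr hs₂ hb₂
      refine ⟨t₁ + (t₂ + (t₃ + 1)), s₃, ?_, .seq h₁ (.seq h₂ (.ifTrue ?_ h₃)), ?_, ?_, ?_⟩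
      · simp only [cost]; omega
      · rw [hra, hr₂]; exact hab
      · simp [eval, hab, hr₃]
      · intro q hq
        rw [hq₃ q hq, hq₂ q (by omega), hq₁ q hq]
      · exact ha₃.trans (ha₂.trans ha₁)
    · obtain ⟨t₃, s₃, ht₃, h₃, hr₃, hq₃, ha₃⟩ := ihd he.2 hr hs₂ hb₂
      refine ⟨t₁ + (t₂ + (t₃ + 1)), s₃, ?_, .seq h₁ (.seq h₂ (.ifFalse ?_ h₃)), ?_, ?_, ?_⟩
      · simp only [cost]; omega
      · rw [hra, hr₂]; exact hab
      · simp [eval, hab, hr₃]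
      · intro q hq
        rw [hq₃ q hq, hq₂ q (by omega), hq₁ q hq]
      · exact ha₃.trans (ha₂.trans ha₁)

/-- Loop-free statements. -/
inductive Stmt : Type where
  | skip : Stmt
  | set (r : ℕ) (e : Expr) : Stmt
  | store (a : ℕ) (i e : Expr) : Stmt
  | seq (p q : Stmt) : Stmt
  | ifLe (a b : Expr) (p q : Stmt) : Stmt

namespace Stmt

/-- The effect of a statement on the memory. -/
def den : Stmt → Mem → Mem
  | skip, s => s
  | set r e, s => s.setReg r (e.eval s)
  | store a i e, s => s.setArr a (i.eval s) (e.eval s)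
  | seq p q, s => q.den (p.den s)
  | ifLe a b p q, s => if a.eval s ≤ b.eval s then p.den s else q.den s

/-- The statement uses only registers below `20` and constants up to `3`. -/
def wf : Stmt → Bool
  | skip => true
  | set r e => decide (r < 20) && e.wf
  | store _ i e => i.wf && e.wf
  | seq p q => p.wf && q.wf
  | ifLe a b p q => a.wf && b.wf && p.wf && q.wf

/-- The program of a statement. -/
def compile : Stmt → Prog
  | skip => .skip
  | set r e => .seq (e.compile 20) (.seq (.const 21 0) (.add r 20 21))
  | store a i e => .seq (i.compile 20) (.seq (e.compile 21) (.store a 20 21))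
  | seq p q => .seq p.compile q.compile
  | ifLe a b p q =>
    .seq (a.compile 20) (.seq (b.compile 21) (.ifLe 20 21 p.compile q.compile))

/-- A bound for the number of steps of a statement. -/
def cost : Stmt → ℕ
  | skip => 1
  | set _ e => e.cost + 2
  | store _ i e => i.cost + e.cost + 1
  | seq p q => p.cost + q.cost
  | ifLe a b p q => a.cost + b.cost + p.cost + q.cost + 1

end Stmt

/-- Started in a memory that agrees with `s`, the program `p` halts within `T` steps in a memory
that agrees with `s'`. -/
def Runs (W T : ℕ) (p : Prog) (s s' : Mem) : Prop :=
  ∀ s₀ : Mem, s₀.Agree s → s₀.Bounded W →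
    ∃ t s₁, t ≤ T ∧ Exec W p s₀ t s₁ ∧ s₁.Agree s'

theorem Runs.mono {W T T' : ℕ} {p : Prog} {s s' : Mem} (h : Runs W T p s s') (hT : T ≤ T') :
    Runs W T' p s s' := fun s₀ hs hb => by
  obtain ⟨t, s₁, ht, h₁, h₂⟩ := h s₀ hs hb
  exact ⟨t, s₁, ht.trans hT, h₁, h₂⟩

theorem Runs.seq {W T T' : ℕ} {p q : Prog} {s s' s'' : Mem} (hp : Runs W T p s s')
    (hq : Runs W T' q s' s'') : Runs W (T + T') (.seq p q) s s'' := fun s₀ hs hb => by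
  obtain ⟨t, s₁, ht, h₁, h₂⟩ := hp s₀ hs hb
  obtain ⟨t', s₂, ht', h₁', h₂'⟩ := hq s₁ h₂ (h₁.bounded hb)
  exact ⟨t + t', s₂, add_le_add ht ht', .seq h₁ h₁', h₂'⟩

theorem Mem.Agree.setReg {s s' s₁ : Mem} (h : s.Agree s') {r k : ℕ}
    (hk : s₁.reg r = k) (hr : ∀ q < 20, q ≠ r → s₁.reg q = s.reg q) (ha : s₁.arr = s.arr) :
    s₁.Agree (s'.setReg r k) := by
  refine ⟨fun q hq => ?_, ha.trans h.2⟩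
  by_cases hqr : q = r
  · simp [Mem.setReg, hqr, hk]
  · simp [Mem.setReg, hqr, hr q hq hqr, h.1 q hq]

theorem Stmt.runs {W : ℕ} (hW : 3 ≤ W) (p : Stmt) (hp : p.wf) (s : Mem) :
    Runs W p.cost p.compile s (p.den s) := by
  induction p generalizing s with
  | skip => exact fun s₀ hs _ => ⟨1, s₀, le_rfl, .skip s₀, hs⟩
  | set r e =>
    intro s₀ hs hb
    simp only [wf, Bool.and_eq_true, decide_eq_true_eq] at hp
    obtain ⟨t₁, s₁, ht₁, h₁, hr₁, hq₁, ha₁⟩ := e.exec_compile hW hp.2 le_rfl hs hb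
    have hb₁ := h₁.bounded hb
    refine ⟨t₁ + (1 + 1), _, ?_, .seq h₁ (.seq (.const 21 0 s₁ (Nat.zero_le _))
        (.add r 20 21 _ ?_)),
      hs.setReg ?_ ?_ ?_⟩
    · simp only [cost]; omega
    · simpa [Mem.setReg] using hb₁.1 20
    · simp [Mem.setReg, hr₁]
    · intro q hq hqr
      have : q ≠ 21 := by omega
      simp [Mem.setReg, hqr, this, hq₁ q hq]
    · exact ha₁
  | store a i e =>
    intro s₀ hs hb
    simp only [wf, Bool.and_eq_true] at hp
    obtain ⟨t₁, s₁, ht₁, h₁, hr₁, hq₁, ha₁⟩ := i.exec_compile hW hp.1 le_rfl hs hb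
    obtain ⟨t₂, s₂, ht₂, h₂, hr₂, hq₂, ha₂⟩ := e.exec_compile hW hp.2 (r := 21) (by omega)
      (s₀ := s₁) ⟨fun q hq => by rw [hq₁ q hq, hs.1 q hq], ha₁.trans hs.2⟩ (h₁.bounded hb)
    have hb₂ := h₂.bounded (h₁.bounded hb)
    refine ⟨t₁ + (t₂ + 1), _, ?_, .seq h₁ (.seq h₂ (.store a 20 21 s₂ (hb₂.1 21))), ?_, ?_⟩
    · simp only [cost]; omega
    · intro q hq
      simp [Mem.setArr, den, hq₂ q (by omega), hq₁ q hq, hs.1 q hq]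
    · simp [Mem.setArr, den, hr₂, hq₂ 20 (by omega), hr₁, ha₂, ha₁, hs.2]
  | seq p q ihp ihq =>
    simp only [wf, Bool.and_eq_true] at hp
    exact (ihp hp.1 s).seq (ihq hp.2 _)
  | ifLe a b p q ihp ihq =>
    intro s₀ hs hb
    simp only [wf, Bool.and_eq_true] at hp
    obtain ⟨t₁, s₁, ht₁, h₁, hr₁, hq₁, ha₁⟩ := a.exec_compile hW hp.1.1.1 le_rfl hs hb
    obtain ⟨t₂, s₂, ht₂, h₂, hr₂, hq₂, ha₂⟩ := b.exec_compile hW hp.1.1.2 (r := 21) (by omega)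
      (s₀ := s₁) ⟨fun q hq => by rw [hq₁ q hq, hs.1 q hq], ha₁.trans hs.2⟩ (h₁.bounded hb)
    have hb₂ := h₂.bounded (h₁.bounded hb)
    have hs₂ : s₂.Agree s :=
      ⟨fun q hq => by rw [hq₂ q (by omega), hq₁ q (by omega), hs.1 q hq],
        (ha₂.trans ha₁).trans hs.2⟩
    have hra : s₂.reg 20 = a.eval s := by rw [hq₂ 20 (by omega), hr₁]
    by_cases hab : a.eval s ≤ b.eval s
    · obtain ⟨t₃, s₃, ht₃, h₃, h₃'⟩ := ihp hp.1.2 s s₂ hs₂ hb₂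
      refine ⟨t₁ + (t₂ + (t₃ + 1)), s₃, ?_, .seq h₁ (.seq h₂ (.ifTrue ?_ h₃)), ?_⟩
      · simp only [cost]; omega
      · rw [hra, hr₂]; exact hab
      · simpa [den, hab] using h₃'
    · obtain ⟨t₃, s₃, ht₃, h₃, h₃'⟩ := ihq hp.2 s s₂ hs₂ hb₂
      refine ⟨t₁ + (t₂ + (t₃ + 1)), s₃, ?_, .seq h₁ (.seq h₂ (.ifFalse ?_ h₃)), ?_⟩
      · simp only [cost]; omega
      · rw [hra, hr₂]; exact hab
      · simpa [den, hab] using h₃'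

/-- Each of the `m` passes pays for a test and the body; the last `+ 1` is the failing test. -/
theorem Runs.while {W T m : ℕ} {a b : ℕ} (ha : a < 20) (hb : b < 20) {p : Prog} {s : ℕ → Mem}
    (hp : ∀ k < m, (s k).reg a < (s k).reg b ∧ Runs W T p (s k) (s (k + 1)))
    (hm : ¬ (s m).reg a < (s m).reg b) :
    Runs W (m * (T + 1) + 1) (.whileLt a b p) (s 0) (s m) := by
  induction m generalizing s with
  | zero =>
    intro s₀ hs _
    refine ⟨1, s₀, by omega, .whileFalse ?_, hs⟩
    rwa [hs.1 a ha, hs.1 b hb]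
  | succ m ih =>
    intro s₀ hs hbd
    obtain ⟨h0, h1⟩ := hp 0 (Nat.succ_pos _)
    obtain ⟨t, s₁, ht, h₁, h₂⟩ := h1 s₀ hs hbd
    obtain ⟨t', s₂, ht', h₁', h₂'⟩ := ih (s := fun k => s (k + 1))
      (fun k hk => hp (k + 1) (by omega)) hm s₁ h₂ (h₁.bounded hbd)
    refine ⟨t + t' + 1, s₂, ?_, .whileTrue ?_ h₁ h₁', h₂'⟩
    · calc t + t' + 1 ≤ T + (m * (T + 1) + 1) + 1 := by omega
        _ = (m + 1) * (T + 1) + 1 := by ring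
    · rwa [hs.1 a ha, hs.1 b hb]

/-- The loop that repeats a statement while one register is below another. -/
def loop (a b : ℕ) (p : Stmt) : Prog := .whileLt a b p.compile

/-- A loop with an invariant that is indexed by the number of passes. -/
theorem exists_runs_loop {W m a b : ℕ} (hW : 3 ≤ W) (ha : a < 20) (hb : b < 20) {p : Stmt}
    (hp : p.wf) {I : ℕ → Mem → Prop} {s : Mem} (h0 : I 0 s)
    (hI : ∀ k s, k < m → I k s → s.reg a < s.reg b ∧ I (k + 1) (p.den s))
    (hm : ∀ s, I m s → ¬ s.reg a < s.reg b) :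
    ∃ s', I m s' ∧ Runs W (m * (p.cost + 1) + 1) (loop a b p) s s' := by
  have key : ∀ k ≤ m, I k (p.den^[k] s) := by
    intro k
    induction k with
    | zero => exact fun _ => h0
    | succ k ih =>
      intro hk
      rw [Function.iterate_succ_apply']
      exact (hI k _ (by omega) (ih (by omega))).2
  refine ⟨p.den^[m] s, key m le_rfl, ?_⟩
  refine Runs.while ha hb (s := fun k => p.den^[k] s) (fun k hk => ?_) (hm _ (key m le_rfl))
  refine ⟨(hI k _ hk (key k hk.le)).1, ?_⟩
  simp only [Function.iterate_succ_apply']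
  exact p.runs hW hp _

/-- A loop whose number of passes is not known in advance, with a bound for it. -/
theorem exists_runs_loop_of_measure {W m a b : ℕ} (hW : 3 ≤ W) (ha : a < 20) (hb : b < 20)
    {p : Stmt} (hp : p.wf) {I : Mem → Prop} {μ : Mem → ℕ} {s : Mem} (h0 : I s) (hm : μ s ≤ m)
    (hI : ∀ s, I s → s.reg a < s.reg b → I (p.den s) ∧ μ (p.den s) < μ s) :
    ∃ s', I s' ∧ ¬ s'.reg a < s'.reg b ∧ Runs W (m * (p.cost + 1) + 1) (loop a b p) s s' := by
  induction m generalizing s with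
  | zero =>
    by_cases h : s.reg a < s.reg b
    · have := (hI s h0 h).2
      omega
    · exact ⟨s, h0, h, by
        simpa [loop] using Runs.while (m := 0) (T := p.cost) ha hb (s := fun _ => s) (by simp) h⟩
  | succ m ih =>
    by_cases h : s.reg a < s.reg b
    · obtain ⟨h1, h2⟩ := hI s h0 h
      obtain ⟨s', hs', hs'', hr⟩ := ih h1 (by omega)
      refine ⟨s', hs', hs'', fun s₀ hs hbd => ?_⟩
      obtain ⟨t, s₁, ht, h₁, h₂⟩ := p.runs hW hp s s₀ hs hbd
      obtain ⟨t', s₂, ht', h₁', h₂'⟩ := hr s₁ h₂ (h₁.bounded hbd)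
      refine ⟨t + t' + 1, s₂, ?_, .whileTrue ?_ h₁ h₁', h₂'⟩
      · calc t + t' + 1 ≤ p.cost + (m * (p.cost + 1) + 1) + 1 := by omega
          _ = (m + 1) * (p.cost + 1) + 1 := by ring
      · rwa [hs.1 a ha, hs.1 b hb]
    · refine ⟨s, h0, h, Runs.mono (T := 0 * (p.cost + 1) + 1) ?_ (by simp)⟩
      exact Runs.while (m := 0) (T := p.cost) ha hb (s := fun _ => s) (by simp) h

/-! ### Conditions -/

/-- Conditions over the memory. -/
inductive Cond : Type where
  | lt (a b : Expr) : Cond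
  | eq (a b : Expr) : Cond
  | and (p q : Cond) : Cond
  | or (p q : Cond) : Cond
  | xor (p q : Cond) : Cond

namespace Cond

/-- The condition holds in the memory. -/
def Holds (s : Mem) : Cond → Prop
  | lt a b => a.eval s < b.eval s
  | eq a b => a.eval s = b.eval s
  | and p q => p.Holds s ∧ q.Holds s
  | or p q => p.Holds s ∨ q.Holds s
  | xor p q => ¬ (p.Holds s ↔ q.Holds s)

/-- The expression with the value of `t` if the condition holds, and of `f` if it does not. -/
def ite : Cond → Expr → Expr → Expr
  | lt a b, t, f => .ifLe b a f t
  | eq a b, t, f => .ifLe a b (.ifLe b a t f) f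
  | and p q, t, f => p.ite (q.ite t f) f
  | or p q, t, f => p.ite t (q.ite t f)
  | xor p q, t, f => p.ite (q.ite f t) (q.ite t f)

open Classical in
theorem eval_ite (s : Mem) (c : Cond) (t f : Expr) :
    (c.ite t f).eval s = if c.Holds s then t.eval s else f.eval s := by
  induction c generalizing t f with
  | lt a b =>
    by_cases h : b.eval s ≤ a.eval s
    · simp [ite, Expr.eval, Holds, h, not_lt.2 h]
    · simp [ite, Expr.eval, Holds, h, not_le.1 h]
  | eq a b =>
    rcases lt_trichotomy (a.eval s) (b.eval s) with h | h | h
    · simp [ite, Expr.eval, Holds, h.le, h.ne, h]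
    · simp [ite, Expr.eval, Holds, h]
    · simp [ite, Expr.eval, Holds, h.ne', h]
  | and p q ihp ihq =>
    by_cases hp : p.Holds s <;> by_cases hq : q.Holds s <;> simp [ite, Holds, ihp, ihq, hp, hq]
  | or p q ihp ihq =>
    by_cases hp : p.Holds s <;> by_cases hq : q.Holds s <;> simp [ite, Holds, ihp, ihq, hp, hq]
  | xor p q ihp ihq =>
    by_cases hp : p.Holds s <;> by_cases hq : q.Holds s <;> simp [ite, Holds, ihp, ihq, hp, hq]

end Cond

end PyramidalTour

namespace PyramidalTour

/-! ### Pyramidal tours with step-backs as pairs of functions -/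

/-- `f` and `g` are the successor and the predecessor map of a pyramidal tour with step-backs
through the cities `0, …, n - 1`. -/
structure IsPSB (n : ℕ) (f g : ℕ → ℕ) : Prop where
  two_le : 2 ≤ n
  f_lt : ∀ i < n, f i < n
  g_lt : ∀ i < n, g i < n
  gf : ∀ i < n, g (f i) = i
  fg : ∀ i < n, f (g i) = i
  f_ne : ∀ i < n, f i ≠ i
  peak : ∀ j, j + 2 < n → g (j + 1) ≤ j → f (j + 1) ≤ j →
    (f (j + 1) = j ∧ j + 1 < f j) ∨ (g (j + 1) = j ∧ j + 1 < g j)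

namespace IsPSB

variable {n : ℕ} {f g : ℕ → ℕ}

theorem g_ne (h : IsPSB n f g) : ∀ i < n, g i ≠ i := fun i hi he =>
  h.f_ne i hi (by simpa [he] using h.fg i hi)

theorem swap (h : IsPSB n f g) : IsPSB n g f where
  two_le := h.two_le
  f_lt := h.g_lt
  g_lt := h.f_lt
  gf := h.fg
  fg := h.gf
  f_ne := h.g_ne
  peak j hj h1 h2 := (h.peak j hj h2 h1).symm

theorem f_eq_iff (h : IsPSB n f g) {i j : ℕ} (hi : i < n) (hj : j < n) : f i = j ↔ g j = i :=
  ⟨fun e => e ▸ h.gf i hi, fun e => e ▸ h.fg j hj⟩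

theorem f_inj (h : IsPSB n f g) {i j : ℕ} (hi : i < n) (hj : j < n) (e : f i = f j) : i = j := by
  rw [← h.gf i hi, e, h.gf j hj]

/-- The map `f` carries the cities left upwards bijectively onto the cities entered from below.
Removing from both sets the cities that are entered from below and left upwards leaves the valleys
and the peaks. -/
theorem card_valley_eq_card_peak (h : IsPSB n f g) :
    ((Finset.range n).filter fun i => i < f i ∧ i < g i).card =
      ((Finset.range n).filter fun i => f i < i ∧ g i < i).card := by
  have hA : ((Finset.range n).filter fun i => i < f i).card =
      ((Finset.range n).filter fun i => g i < i).card := by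
    refine Finset.card_nbij' f g ?_ ?_ ?_ ?_
    · intro i hi
      simp only [Finset.coe_filter, Finset.mem_range, Set.mem_ofPred_eq] at hi ⊢
      exact ⟨h.f_lt i hi.1, by rw [h.gf i hi.1]; exact hi.2⟩
    · intro i hi
      simp only [Finset.coe_filter, Finset.mem_range, Set.mem_ofPred_eq] at hi ⊢
      exact ⟨h.g_lt i hi.1, by rw [h.fg i hi.1]; exact hi.2⟩
    · intro i hi
      simp only [Finset.coe_filter, Finset.mem_range, Set.mem_ofPred_eq] at hi
      exact h.gf i hi.1
    · intro i hi
      simp only [Finset.coe_filter, Finset.mem_range, Set.mem_ofPred_eq] at hi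
      exact h.fg i hi.1
  have h1 := Finset.card_filter_add_card_filter_not
    (s := (Finset.range n).filter fun i => i < f i) (fun i => i < g i)
  have h2 := Finset.card_filter_add_card_filter_not
    (s := (Finset.range n).filter fun i => g i < i) (fun i => f i < i)
  rw [Finset.filter_filter, Finset.filter_filter] at h1 h2
  have h3 : ((Finset.range n).filter fun i => i < f i ∧ ¬ i < g i) =
      ((Finset.range n).filter fun i => g i < i ∧ ¬ f i < i) := by
    refine Finset.filter_congr fun i hi => ?_
    have := h.f_ne i (Finset.mem_range.1 hi)
    have := h.g_ne i (Finset.mem_range.1 hi)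
    omega
  have h4 : ((Finset.range n).filter fun i => g i < i ∧ f i < i) =
      ((Finset.range n).filter fun i => f i < i ∧ g i < i) :=
    Finset.filter_congr fun i _ => and_comm
  rw [h3] at h1
  rw [h4] at h2
  omega

/-- A city other than the first one that lies between two greater neighbours is the first
coordinate of a step-back. -/
theorem valley (h : IsPSB n f g) {i : ℕ} (hi : i < n) (h0 : i ≠ 0) (hf : i < f i)
    (hg : i < g i) :
    i + 2 < n ∧ ((f (i + 1) = i ∧ i + 1 < f i ∧ g (i + 1) < i) ∨
      (f i = i + 1 ∧ g (i + 1) = i ∧ i + 1 < g i ∧ f (i + 1) < i)) := by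
  have hn := h.two_le
  set V := (Finset.range n).filter fun i => i < f i ∧ i < g i with hV
  set P := (Finset.range n).filter fun i => f i < i ∧ g i < i with hP
  have hc : V.card = P.card := h.card_valley_eq_card_peak
  have hnP : n - 1 ∈ P := by
    have h1 := h.f_lt (n - 1) (by omega)
    have h2 := h.f_ne (n - 1) (by omega)
    have h3 := h.g_lt (n - 1) (by omega)
    have h4 := h.g_ne (n - 1) (by omega)
    simp only [hP, Finset.mem_filter, Finset.mem_range]
    omega
  have h0V : 0 ∈ V := by
    have h2 := h.f_ne 0 (by omega)
    have h4 := h.g_ne 0 (by omega)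
    simp only [hV, Finset.mem_filter, Finset.mem_range]
    omega
  -- Every peak but the last city is a step-back peak, so the city just below it is a valley.
  have key : ∀ m ∈ P.erase (n - 1), m - 1 ∈ V.erase 0 ∧ m ≠ 0 := by
    intro m hm
    simp only [hP, Finset.mem_erase, Finset.mem_filter, Finset.mem_range] at hm
    obtain ⟨j, rfl⟩ : ∃ j, m = j + 1 := ⟨m - 1, by omega⟩
    have hgf := h.gf j (by omega)
    have hfg := h.fg j (by omega)
    have hgf' := h.gf (j + 1) (by omega)
    have hfg' := h.fg (j + 1) (by omega)
    simp only [hV, Finset.mem_erase, Finset.mem_filter, Finset.mem_range, Nat.add_sub_cancel]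
    rcases h.peak j (by omega) (by omega) (by omega) with ⟨h1, h2⟩ | ⟨h1, h2⟩
    · rw [h1] at hgf'
      refine ⟨⟨?_, by omega, by omega, by omega⟩, by omega⟩
      rintro rfl
      have : g (0 + 1) = 0 := by omega
      rw [this] at hfg'
      omega
    · rw [h1] at hfg'
      refine ⟨⟨?_, by omega, by omega, by omega⟩, by omega⟩
      rintro rfl
      have : f (0 + 1) = 0 := by omega
      rw [this] at hgf'
      omega
  -- An injection between sets of equal size is onto, so every valley but the first city lies
  -- directly below a peak.
  have himg : (P.erase (n - 1)).image (fun m => m - 1) = V.erase 0 := by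
    refine Finset.eq_of_subset_of_card_le ?_ ?_
    · intro j hj
      obtain ⟨m, hm, rfl⟩ := Finset.mem_image.1 hj
      exact (key m hm).1
    · rw [Finset.card_image_of_injOn, Finset.card_erase_of_mem hnP, Finset.card_erase_of_mem h0V,
        hc]
      intro a ha b hb hab
      have := (key a ha).2
      have := (key b hb).2
      simp only at hab
      omega
  have hiV : i ∈ V.erase 0 := by
    simp only [hV, Finset.mem_erase, Finset.mem_filter, Finset.mem_range]
    exact ⟨h0, hi, hf, hg⟩
  rw [← himg] at hiV
  obtain ⟨m, hm, hmi⟩ := Finset.mem_image.1 hiV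
  have hm0 := (key m hm).2
  obtain rfl : m = i + 1 := by omega
  simp only [hP, Finset.mem_erase, Finset.mem_filter, Finset.mem_range] at hm
  refine ⟨by omega, ?_⟩
  have hgf := h.gf i hi
  have hfg := h.fg i hi
  have hfg' := h.fg (i + 1) (by omega)
  have hgf' := h.gf (i + 1) (by omega)
  rcases h.peak i (by omega) (by omega) (by omega) with ⟨h1, h2⟩ | ⟨h1, h2⟩
  · refine Or.inl ⟨h1, h2, ?_⟩
    have : g (i + 1) ≠ i := fun e => by
      rw [e] at hfg'
      omega
    omega
  · rw [h1] at hfg'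
    refine Or.inr ⟨hfg', h1, h2, ?_⟩
    have : f (i + 1) ≠ i := fun e => by
      rw [e] at hgf'
      omega
    omega

end IsPSB

/-! ### Crossings of the tour with a horizontal level -/

/-- The cities below `k` form a part of the tour that is entered and left once on the way up, at
the end of which stands `a`, and once on the way down, at the beginning of which stands `d`. -/
structure Frontier (f g : ℕ → ℕ) (k a d : ℕ) : Prop where
  a_lt : a < k
  d_lt : d < k
  up : ∀ j < k, k ≤ f j ↔ j = a
  down : ∀ j < k, k ≤ g j ↔ j = d

namespace Frontier

variable {n k a d : ℕ} {f g : ℕ → ℕ}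

theorem swap (F : Frontier f g k a d) : Frontier g f k d a := ⟨F.d_lt, F.a_lt, F.down, F.up⟩

theorem one (h : IsPSB n f g) : Frontier f g 1 0 0 := by
  have h1 := h.f_ne 0 (by have := h.two_le; omega)
  have h2 := h.g_ne 0 (by have := h.two_le; omega)
  refine ⟨one_pos, one_pos, fun j hj => ?_, fun j hj => ?_⟩ <;> obtain rfl : j = 0 := by omega
  · simp; omega
  · simp; omega

theorem g_eq (h : IsPSB n f g) (F : Frontier f g k a d) {i : ℕ} (hk : k ≤ i) (hi : i < n)
    (hg : g i < k) : g i = a :=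
  (F.up _ hg).1 (by rw [h.fg i hi]; exact hk)

theorem f_eq (h : IsPSB n f g) (F : Frontier f g k a d) {i : ℕ} (hk : k ≤ i) (hi : i < n)
    (hf : f i < k) : f i = d := F.swap.g_eq h.swap hk hi hf

/-- Entered from below, the city `k` must be entered from `a`; left upwards, it takes the place of
`a`. -/
theorem asc (h : IsPSB n f g) (F : Frontier f g k a d) (hk : k < n) (hg : g k < k) (hf : k < f k) :
    Frontier f g (k + 1) k d := by
  have ha := F.g_eq h le_rfl hk hg
  have hfa : f a = k := ha ▸ h.fg k hk
  refine ⟨by omega, by have := F.d_lt; omega, fun j hj => ?_, fun j hj => ?_⟩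
  · rcases Nat.lt_succ_iff_lt_or_eq.1 hj with hj | rfl
    · refine ⟨fun hjf => ?_, fun e => by omega⟩
      obtain rfl := (F.up j hj).1 (by omega)
      omega
    · simpa using hf
  · rcases Nat.lt_succ_iff_lt_or_eq.1 hj with hj | rfl
    · rw [← F.down j hj]
      refine ⟨fun e => by omega, fun e => ?_⟩
      have : g j ≠ k := fun e' => by
        have := h.fg j (by omega)
        rw [e'] at this
        omega
      omega
    · have := F.d_lt
      omega

theorem desc (h : IsPSB n f g) (F : Frontier f g k a d) (hk : k < n) (hf : f k < k)
    (hg : k < g k) : Frontier f g (k + 1) a k := (F.swap.asc h.swap hk hf hg).swap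

/-- Both cities of the step-back are inserted at once: just above `k` the arcs out of `a` and out of
`k` both lead upwards, so there is no frontier at `k + 1`. -/
theorem ascStep (h : IsPSB n f g) (F : Frontier f g k a d) (hk : k + 1 < n) (hf : f (k + 1) = k)
    (hf' : k + 1 < f k) (hg : g (k + 1) < k) : Frontier f g (k + 2) k d := by
  have ha := F.g_eq h (Nat.le_succ k) hk hg
  have hfa : f a = k + 1 := ha ▸ h.fg _ hk
  have hgk : g k = k + 1 := (h.f_eq_iff hk (by omega)).1 hf
  refine ⟨by omega, by have := F.d_lt; omega, fun j hj => ?_, fun j hj => ?_⟩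
  · rcases Nat.lt_or_ge j k with hj' | hj'
    · refine ⟨fun hjf => ?_, fun e => by omega⟩
      obtain rfl := (F.up j hj').1 (by omega)
      omega
    · obtain rfl | rfl : j = k ∨ j = k + 1 := by omega
      · omega
      · omega
  · rcases Nat.lt_or_ge j k with hj' | hj'
    · rw [← F.down j hj']
      refine ⟨fun e => by omega, fun e => ?_⟩
      have h1 : g j ≠ k := fun e' => by
        have := h.fg j (by omega)
        rw [e'] at this
        omega
      have h2 : g j ≠ k + 1 := fun e' => by
        have := h.fg j (by omega)
        rw [e'] at this
        omega
      omega
    · have := F.d_lt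
      obtain rfl | rfl : j = k ∨ j = k + 1 := by omega
      · omega
      · omega

theorem descStep (h : IsPSB n f g) (F : Frontier f g k a d) (hk : k + 1 < n) (hg : g (k + 1) = k)
    (hg' : k + 1 < g k) (hf : f (k + 1) < k) : Frontier f g (k + 2) a k :=
  (F.swap.ascStep h.swap hk hg hg' hf).swap

/-- At a step-back peak `k`, the city `k - 1` is joined across the frontier to a city above `k`.
That makes it `a` or `d`, whose crossing arc is already used up by `k`. -/
theorem not_peak (h : IsPSB n f g) (F : Frontier f g k a d) (hk : k + 1 < n) (hf : f k < k)
    (hg : g k < k) : False := by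
  have ha := F.g_eq h le_rfl (by omega) hg
  have hd := F.f_eq h le_rfl (by omega) hf
  have h1 := h.fg k (by omega)
  have h2 := h.gf k (by omega)
  obtain ⟨j, rfl⟩ : ∃ j, k = j + 1 := ⟨k - 1, by omega⟩
  rcases h.peak j (by omega) (by omega) (by omega) with ⟨h3, h4⟩ | ⟨h3, h4⟩
  · have := (F.up j (by omega)).1 h4.le
    rw [ha, ← this] at h1
    omega
  · have := (F.down j (by omega)).1 h4.le
    rw [hd, ← this] at h2
    omega

end Frontier

namespace IsPSB

variable {n : ℕ} {f g : ℕ → ℕ}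

/-- The second alternative is the state between the two cities of a step-back. -/
theorem exists_frontier (h : IsPSB n f g) {k : ℕ} (hk : k + 1 < n) :
    (∃ a d, Frontier f g (k + 1) a d) ∨
      (k ≠ 0 ∧ k < f k ∧ k < g k ∧ ∃ a d, Frontier f g k a d) := by
  induction k with
  | zero => exact Or.inl ⟨0, 0, Frontier.one h⟩
  | succ k ih =>
    rcases ih (by omega) with ⟨a, d, F⟩ | ⟨h0, hf, hg, a, d, F⟩
    · have h1 := h.f_ne (k + 1) (by omega)
      have h2 := h.g_ne (k + 1) (by omega)
      rcases Nat.lt_or_gt_of_ne h1 with h1 | h1 <;> rcases Nat.lt_or_gt_of_ne h2 with h2 | h2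
      · exact (F.not_peak h hk h1 h2).elim
      · exact Or.inl ⟨_, _, F.desc h (by omega) h1 h2⟩
      · exact Or.inl ⟨_, _, F.asc h (by omega) h2 h1⟩
      · exact Or.inr ⟨by omega, h1, h2, a, d, F⟩
    · obtain ⟨_, ⟨h1, h2, h3⟩ | ⟨_, h1, h2, h3⟩⟩ := h.valley (by omega) h0 hf hg
      · exact Or.inl ⟨_, _, F.ascStep h (by omega) h1 h2 h3⟩
      · exact Or.inl ⟨_, _, F.descStep h (by omega) h1 h2 h3⟩

/-- Two arcs lead upwards across the line between `k` and `k + 1` only if `k` is the first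
coordinate of a step-back. -/
theorem two_up (h : IsPSB n f g) {a b k : ℕ} (hk : k + 1 < n) (ha : a ≤ k) (hb : b ≤ k)
    (hab : a ≠ b) (hfa : k < f a) (hfb : k < f b) : k ≠ 0 ∧ k < f k ∧ k < g k := by
  rcases h.exists_frontier hk with ⟨a', d, F⟩ | ⟨h0, hf, hg, -⟩
  · have h1 := (F.up a (by omega)).1 hfa
    have h2 := (F.up b (by omega)).1 hfb
    omega
  · exact ⟨h0, hf, hg⟩

/-- `two_up`, for the arcs that lead downwards. -/
theorem two_down (h : IsPSB n f g) {a b k : ℕ} (hk : k + 1 < n) (ha : a ≤ k) (hb : b ≤ k)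
    (hab : a ≠ b) (hga : k < g a) (hgb : k < g b) : k ≠ 0 ∧ k < f k ∧ k < g k := by
  obtain ⟨h1, h2, h3⟩ := h.swap.two_up hk ha hb hab hga hgb
  exact ⟨h1, h3, h2⟩

end IsPSB

end PyramidalTour

/-! ### Excluded mixtures when one tour has a step-back peak and the other has none of its features
-/

namespace PyramidalTour

namespace IsPSB

variable {n : ℕ} {x gx y gy z gz : ℕ → ℕ}

theorem g_mix (hx : IsPSB n x gx) (hy : IsPSB n y gy) (hz : IsPSB n z gz)
    (hm : ∀ i < n, z i = x i ∨ z i = y i) {i : ℕ} (hi : i < n) : gz i = gx i ∨ gz i = gy i := by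
  have h1 := hm _ (hz.g_lt i hi)
  rw [hz.fg i hi] at h1
  rcases h1 with h1 | h1
  · exact Or.inl ((hx.f_eq_iff (hz.g_lt i hi) hi).1 h1.symm).symm
  · exact Or.inr ((hy.f_eq_iff (hz.g_lt i hi) hi).1 h1.symm).symm

/-- If `x` has a step-back peak in ascending order at `j + 1` and `y` differs from it in all the
three defining features, then at least one of two mixed patterns does not occur in the tours
composed of arcs of `x` and `y`. -/
theorem no_pattern (hx : IsPSB n x gx) (hy : IsPSB n y gy) {j : ℕ} (hj0 : j ≠ 0) (hj : j + 2 < n)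
    (x1 : gx (j + 1) < j) (x2 : x (j + 1) = j) (x3 : j + 1 < x j) (y1 : ¬ gy (j + 1) < j)
    (y2 : y (j + 1) ≠ j) (y3 : ¬ j + 1 < y j) :
    (∀ z gz, IsPSB n z gz → (∀ i < n, z i = x i ∨ z i = y i) →
      ¬ (gz (j + 1) < j ∧ z (j + 1) ≠ j ∧ ¬ j + 1 < z j)) ∨
    (∀ z gz, IsPSB n z gz → (∀ i < n, z i = x i ∨ z i = y i) →
      ¬ (¬ gz (j + 1) < j ∧ z (j + 1) ≠ j ∧ j + 1 < z j)) := by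
  have gxj : gx j = j + 1 := (hx.f_eq_iff (by omega) (by omega)).1 x2
  -- A tour of the first pattern would have to use this arc into `j + 1`, although it enters `j + 1`
  -- from below `j`.
  by_cases hA : y j = j + 1
  · refine Or.inl fun z gz hz hm ⟨h1, h2, h3⟩ => ?_
    have := hm j (by omega)
    have := hz.f_eq_iff (i := j) (j := j + 1) (by omega) (by omega)
    omega
  have hyj := hy.f_ne j (by omega)
  have hgy : j + 1 < gy (j + 1) := by
    have := hy.f_eq_iff (i := j) (j := j + 1) (by omega) (by omega)
    have := hy.g_ne (j + 1) (by omega)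
    omega
  have hyj1 := hy.f_ne (j + 1) (by omega)
  -- If `y` leaves `j + 1` downwards, the first pattern gives a peak with both neighbours below `j`.
  -- Otherwise `j + 1` is a valley of `y`, and the failing pattern depends on the step-back of `y`
  -- above it.
  rcases Nat.lt_or_gt_of_ne hyj1 with hB | hC
  · refine Or.inl fun z gz hz hm ⟨h1, h2, h3⟩ => ?_
    have := hm (j + 1) (by omega)
    have := hz.peak j hj (by omega) (by omega)
    omega
  obtain ⟨hn, ⟨c1, c2, c3⟩ | ⟨c1, c2, c3, c4⟩⟩ := hy.valley (by omega) (by omega) hC hgy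
  · change y (j + 2) = j + 1 at c1
    change gy (j + 2) < _ at c3
    have gyj : gy (j + 1) = j + 2 := (hy.f_eq_iff (by omega) (by omega)).1 c1
    -- If `x j = j + 2`, the first pattern sends arcs up from both `j + 1` and `j + 2`, but `j + 2`
    -- is entered from below. Otherwise the second pattern copies the step-back of `y` at `j + 2`;
    -- then two arcs lead up across the level above `j` and force a valley at `j` that has no
    -- step-back.
    by_cases hmx : x j = j + 2
    · refine Or.inl fun z gz hz hm ⟨h1, h2, h3⟩ => ?_
      have gxj2 : gx (j + 2) = j := (hx.f_eq_iff (by omega) (by omega)).1 hmx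
      have e1 := hm (j + 1) (by omega)
      have e2 := hm (j + 2) (by omega)
      have e3 := hz.f_eq_iff (i := j + 2) (j := j + 1) (by omega) (by omega)
      have e4 := hx.f_eq_iff (i := j + 2) (j := j + 1) (by omega) (by omega)
      have e5 := hx.f_ne (j + 2) (by omega)
      have e6 : j + 2 < x (j + 2) := by
        by_contra hcon
        have := hx.peak (j + 1) (by omega) (by show gx (j + 2) ≤ _; omega)
          (by show x (j + 2) ≤ _; omega)
        change (x (j + 2) = _ ∧ _) ∨ (gx (j + 2) = _ ∧ _) at this
        omega
      have e7 := hz.two_up (a := j + 1) (b := j + 2) (k := j + 2) (by omega) (by omega) le_rfl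
        (by omega) (by omega) (by omega)
      have e8 := g_mix hx hy hz hm (i := j + 2) (by omega)
      omega
    · refine Or.inr fun z gz hz hm ⟨h1, h2, h3⟩ => ?_
      have e1 := hm (j + 1) (by omega)
      have e2 := g_mix hx hy hz hm (i := j + 1) (by omega)
      have e3 := hm j (by omega)
      obtain ⟨_, ⟨d1, d2, d3⟩ | ⟨d1, d2, d3, d4⟩⟩ :=
        hz.valley (i := j + 1) (by omega) (by omega) (by omega) (by omega)
      · change gz (j + 2) < j + 1 at d3
        have e4 := hz.fg (j + 2) (by omega)
        have e5 : gz (j + 2) ≠ j := fun e => by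
          rw [e] at e4
          omega
        have e6 := hz.two_up (a := gz (j + 2)) (b := j) (k := j) (by omega) (by omega) le_rfl
          e5 (by omega) (by omega)
        have := hz.valley (by omega) hj0 e6.2.1 e6.2.2
        omega
      · omega
  · change gy (j + 2) = j + 1 at c2
    change y (j + 2) < j + 1 at c4
    -- In the second pattern `j` would be a valley, and the pattern excludes both kinds of step-back
    -- above it.
    by_cases hgj : j < gy j
    · refine Or.inr fun z gz hz hm ⟨h1, h2, h3⟩ => ?_
      have e2 := g_mix hx hy hz hm (i := j) (by omega)
      have e3 := hz.f_eq_iff (i := j + 1) (j := j) (by omega) (by omega)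
      have e1 := hm (j + 1) (by omega)
      have := hz.valley (i := j) (by omega) hj0 (by omega) (by omega)
      omega
    have hgj' : gy j < j := by
      have := hy.g_ne j (by omega)
      omega
    have hxj2 := hx.f_ne (j + 2) (by omega)
    -- The first pattern would go from `j + 1` to `j + 2` and down again, which is a peak but not a
    -- step-back peak.
    by_cases hx2 : x (j + 2) < j + 2
    · refine Or.inl fun z gz hz hm ⟨h1, h2, h3⟩ => ?_
      have e1 := hm (j + 1) (by omega)
      have e2 := hm (j + 2) (by omega)
      have e3 : gz (j + 2) = j + 1 := (hz.f_eq_iff (by omega) (by omega)).1 (by omega)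
      have e4 := hz.peak (j + 1) (by omega) (by show gz (j + 2) ≤ _; omega)
        (by show z (j + 2) ≤ _; omega)
      change (z (j + 2) = _ ∧ _) ∨ (gz (j + 2) = _ ∧ _) at e4
      have e5 := hz.f_eq_iff (i := j + 2) (j := j + 1) (by omega) (by omega)
      omega
    -- Both neighbours of `j` in `y` are now smaller, so `j` is a step-back peak of `y`, and the
    -- analysis moves down to `j - 1`.
    obtain ⟨k, rfl⟩ : ∃ k, j = k + 1 := ⟨j - 1, by omega⟩
    simp only [Nat.add_assoc, Nat.reduceAdd] at *
    -- the successor of `j + 1` in a tour of the second pattern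
    have hval : ∀ z gz, IsPSB n z gz → (∀ i < n, z i = x i ∨ z i = y i) →
        ¬ gz (k + 2) < k + 1 → z (k + 2) ≠ k + 1 → k + 2 < z (k + 1) →
        z (k + 2) = k + 3 ∧ z (k + 3) = y (k + 3) ∧ gz (k + 1) = gy (k + 1) := by
      intro z gz hz hm h1 h2 h3
      have e1 := hm (k + 2) (by omega)
      have e2 := g_mix hx hy hz hm (i := k + 2) (by omega)
      have e3 := hm (k + 3) (by omega)
      have e4 := hz.f_eq_iff (i := k + 2) (j := k + 1) (by omega) (by omega)
      have e5 := g_mix hx hy hz hm (i := k + 1) (by omega)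
      have e6 : gz (k + 2) = gy (k + 2) := by omega
      have := hz.valley (i := k + 2) (by omega) (by omega) (by omega) (by omega)
      simp only [Nat.add_assoc, Nat.reduceAdd] at this
      omega
    rcases hy.peak k (by omega) (by omega) (by omega) with ⟨p1, p2⟩ | ⟨p1, p2⟩
    -- According to the arc of `x` out of `k`, one of the patterns sends two arcs up across the
    -- level above `k + 1`, although `k + 1` is no valley of the mixed tour.
    · by_cases hxk : k + 1 < x k
      · refine Or.inr fun z gz hz hm ⟨h1, h2, h3⟩ => ?_
        obtain ⟨e1, e2, e3⟩ := hval z gz hz hm h1 h2 h3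
        have e4 := hm k (by omega)
        have := hz.two_up (a := k) (b := k + 1) (k := k + 1) (by omega) (by omega) le_rfl
          (by omega) (by omega) (by omega)
        omega
      · refine Or.inl fun z gz hz hm ⟨h1, h2, h3⟩ => ?_
        have e1 := hm (k + 1) (by omega)
        have e2 := hm k (by omega)
        have e3 := g_mix hx hy hz hm (i := k + 1) (by omega)
        have e4 := hz.f_eq_iff (i := k + 2) (j := k + 1) (by omega) (by omega)
        have e5 := hz.fg (k + 2) (by omega)
        have e6 : gz (k + 2) = gx (k + 2) := by
          have := g_mix hx hy hz hm (i := k + 2) (by omega)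
          omega
        have e7 : gz (k + 2) ≠ k := fun e => by
          have := hx.fg (k + 2) (by omega)
          rw [← e6, e] at this
          omega
        have e8 := hz.peak k (by omega) (by omega) (by omega)
        have e9 := hy.f_eq_iff (i := k) (j := k + 1) (by omega) (by omega)
        have := hz.two_up (a := gz (k + 2)) (b := k) (k := k + 1) (by omega) (by omega)
          (by omega) e7 (by omega) (by omega)
        omega
    · refine Or.inr fun z gz hz hm ⟨h1, h2, h3⟩ => ?_
      obtain ⟨e1, e2, e3⟩ := hval z gz hz hm h1 h2 h3
      have hk0 : k ≠ 0 := by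
        rintro rfl
        have := hy.f_eq_iff (i := 0) (j := 0 + 1) (by omega) (by omega)
        have := hy.f_eq_iff (i := 0 + 1) (j := 0) (by omega) (by omega)
        omega
      -- Two arcs of `y` down across the level above `k + 1` would make the peak `k + 1` of `y` a
      -- valley, so the arc out of `k + 3` is the one into `k`.
      have e4 : y (k + 3) = k := by
        by_contra hne
        have h4 := hy.gf (k + 3) (by omega)
        have := hy.two_down (a := y (k + 3)) (b := k) (k := k + 1) (by omega) (by omega)
          (by omega) hne (by rw [h4]; omega) (by omega)
        omega
      have e5 : gz k = k + 3 := (hz.f_eq_iff (by omega) (by omega)).1 (e2.trans e4)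
      have e6 : z k = k + 1 := (hz.f_eq_iff (by omega) (by omega)).2 (e3.trans p1)
      have := hz.valley (i := k) (by omega) hk0 (by omega) (by omega)
      omega

end IsPSB

end PyramidalTour

/-! ### Local constraints at a peak, and the sets of cities closed under them -/

namespace PyramidalTour

namespace IsPSB

variable {n : ℕ} {f g : ℕ → ℕ}

theorem not_two_cycle (h : IsPSB n f g) {j : ℕ} (hj : j + 2 < n) (hf : f (j + 1) = j)
    (hg : g (j + 1) = j) : False := by
  have := h.f_eq_iff (i := j) (j := j + 1) (by omega) (by omega)
  have := h.f_eq_iff (i := j + 1) (j := j) (by omega) (by omega)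
  have := h.peak j hj (by omega) (by omega)
  omega

theorem not_long_peak (h : IsPSB n f g) {j : ℕ} (hj : j + 2 < n) (hf : f (j + 1) < j)
    (hg : g (j + 1) < j) : False := by
  have := h.peak j hj (by omega) (by omega)
  omega

/-- The first two features make `j + 1` a peak, hence a step-back peak. In the other two cases `j`
is a valley, by two upward arcs across one level or directly, hence the bottom of a step-back, and
the given arcs decide its direction. -/
theorem step_back_third (h : IsPSB n f g) {j : ℕ} (hj0 : j ≠ 0) (hj : j + 2 < n) :
    (g (j + 1) < j → f (j + 1) = j → j + 1 < f j) ∧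
    (g (j + 1) < j → j + 1 < f j → f (j + 1) = j) ∧
    (f (j + 1) = j → j + 1 < f j → g (j + 1) < j) := by
  have e1 := h.fg (j + 1) (by omega)
  have e2 := h.f_eq_iff (i := j + 1) (j := j) (by omega) (by omega)
  refine ⟨fun h1 h2 => ?_, fun h1 h2 => ?_, fun h1 h2 => ?_⟩
  · have := h.peak j hj (by omega) (by omega)
    omega
  · have e3 := h.two_up (a := g (j + 1)) (b := j) (k := j) (by omega) (by omega) le_rfl
      (by omega) (by omega) (by omega)
    have := h.valley (by omega) hj0 e3.2.1 e3.2.2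
    omega
  · have := h.valley (i := j) (by omega) hj0 (by omega) (by omega)
    omega

end IsPSB

/-- The set `M` of cities is a union of components of the graph on the cities in which two cities
are joined if a tour composed of arcs of `x` and `y` whose complement is a tour as well cannot
leave one of them along an arc of `x` and the other one along an arc of `y`. -/
structure Saturated (n : ℕ) (x gx y gy : ℕ → ℕ) (M : ℕ → Prop) : Prop where
  alternate : ∀ v < n, (M (gy (x v)) ↔ M v)
  in_out : ∀ j, j + 2 < n →
    (¬ (gx (j + 1) < j ↔ gy (j + 1) < j) ∨ ¬ (gx (j + 1) = j ↔ gy (j + 1) = j)) →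
    (¬ (x (j + 1) < j ↔ y (j + 1) < j) ∨ ¬ (x (j + 1) = j ↔ y (j + 1) = j)) →
    (M (gx (j + 1)) ↔ M (j + 1))
  out_out : ∀ j, j + 2 < n → j ≠ 0 → ¬ (x (j + 1) = j ↔ y (j + 1) = j) →
    ¬ (j + 1 < x j ↔ j + 1 < y j) → (M (j + 1) ↔ M j)
  in_out_low : ∀ j, j + 2 < n → j ≠ 0 → ¬ (gx (j + 1) < j ↔ gy (j + 1) < j) →
    ¬ (j + 1 < x j ↔ j + 1 < y j) → (M (gx (j + 1)) ↔ M j)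
  in_in : ∀ j, j + 2 < n → j ≠ 0 → ¬ (gx (j + 1) = j ↔ gy (j + 1) = j) →
    ¬ (j + 1 < gx j ↔ j + 1 < gy j) → (M (gx (j + 1)) ↔ M (gx j))
  out_in_low : ∀ j, j + 2 < n → j ≠ 0 → ¬ (x (j + 1) < j ↔ y (j + 1) < j) →
    ¬ (j + 1 < gx j ↔ j + 1 < gy j) → (M (j + 1) ↔ M (gx j))

/-! ### Mixed tours -/

namespace Saturated

variable {n : ℕ} {x gx y gy : ℕ → ℕ} {M : ℕ → Prop}

/-- This supplies the second of two complementary mixed tours. -/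
theorem not (h : Saturated n x gx y gy M) : Saturated n x gx y gy (fun v => ¬ M v) where
  alternate v hv := not_congr (h.alternate v hv)
  in_out j h1 h2 h3 := not_congr (h.in_out j h1 h2 h3)
  out_out j h1 h2 h3 h4 := not_congr (h.out_out j h1 h2 h3 h4)
  in_out_low j h1 h2 h3 h4 := not_congr (h.in_out_low j h1 h2 h3 h4)
  in_in j h1 h2 h3 h4 := not_congr (h.in_in j h1 h2 h3 h4)
  out_in_low j h1 h2 h3 h4 := not_congr (h.out_in_low j h1 h2 h3 h4)

-- If two features of one peak condition separate `x` from `y`, saturation takes both arcs from the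
-- same tour; a feature that does not separate them may be read in either tour. So a violation in
-- the mixed tour would already occur in `x` or in `y`.
open Classical in
theorem isPSB_mix (h : Saturated n x gx y gy M) (hx : IsPSB n x gx) (hy : IsPSB n y gy) :
    IsPSB n (fun v => if M v then y v else x v) (fun v => if M (gx v) then gy v else gx v) := by
  -- The arcs of `x` and `y` into `w` start at cities that are both in `M` or both outside, so
  -- exactly one of the two arcs survives.
  have halt : ∀ w < n, (M (gy w) ↔ M (gx w)) := fun w hw => by
    simpa [hx.fg w hw] using h.alternate _ (hx.g_lt w hw)
  refine ⟨hx.two_le, fun i hi => ?_, fun i hi => ?_, fun i hi => ?_, fun i hi => ?_,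
    fun i hi => ?_, fun j hj hg hf => ?_⟩
  · split_ifs
    exacts [hy.f_lt i hi, hx.f_lt i hi]
  · split_ifs
    exacts [hy.g_lt i hi, hx.g_lt i hi]
  · by_cases hM : M i
    · rw [if_pos hM, if_pos, hy.gf i hi]
      rw [← halt _ (hy.f_lt i hi), hy.gf i hi]
      exact hM
    · rw [if_neg hM, if_neg, hx.gf i hi]
      rwa [hx.gf i hi]
  · by_cases hM : M (gx i)
    · rw [if_pos hM, if_pos ((halt i hi).2 hM), hy.fg i hi]
    · rw [if_neg hM, if_neg hM, hx.fg i hi]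
  · split_ifs
    exacts [hy.f_ne i hi, hx.f_ne i hi]
  · have e1 := fun hd : _ ∧ _ => h.in_out j hj hd.1 hd.2
    have l1 : ¬ ((if M (gx (j + 1)) then gy (j + 1) else gx (j + 1)) < j ∧
        (if M (j + 1) then y (j + 1) else x (j + 1)) < j) := by
      have px : ¬ (_ ∧ _) := fun hd => hx.not_long_peak hj hd.1 hd.2
      have py : ¬ (_ ∧ _) := fun hd => hy.not_long_peak hj hd.1 hd.2
      by_cases m1 : M (gx (j + 1)) <;> by_cases m2 : M (j + 1) <;>
        simp only [m1, m2, if_true, if_false, iff_true, iff_false, not_true, imp_false] at e1 ⊢ <;>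
        omega
    have l2 : ¬ ((if M (gx (j + 1)) then gy (j + 1) else gx (j + 1)) = j ∧
        (if M (j + 1) then y (j + 1) else x (j + 1)) = j) := by
      have tx : ¬ (_ ∧ _) := fun hd => hx.not_two_cycle hj hd.1 hd.2
      have ty : ¬ (_ ∧ _) := fun hd => hy.not_two_cycle hj hd.1 hd.2
      by_cases m1 : M (gx (j + 1)) <;> by_cases m2 : M (j + 1) <;>
        simp only [m1, m2, if_true, if_false, iff_true, iff_false, not_true, imp_false] at e1 ⊢ <;>
        omega
    have l3 : (if M (gx (j + 1)) then gy (j + 1) else gx (j + 1)) < j →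
        (if M (j + 1) then y (j + 1) else x (j + 1)) = j →
        j + 1 < (if M j then y j else x j) := by
      intro h1 h2
      have hj0 : j ≠ 0 := by omega
      have e2 := fun hd : _ ∧ _ => h.out_out j hj hj0 hd.1 hd.2
      have e3 := fun hd : _ ∧ _ => h.in_out_low j hj hj0 hd.1 hd.2
      have px := fun hd : _ ∧ _ => (hx.step_back_third hj0 hj).1 hd.1 hd.2
      have py := fun hd : _ ∧ _ => (hy.step_back_third hj0 hj).1 hd.1 hd.2
      by_cases m1 : M (gx (j + 1)) <;> by_cases m2 : M (j + 1) <;> by_cases m3 : M j <;>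
        simp only [m1, m2, m3, if_true, if_false, iff_true, iff_false, not_true, imp_false]
          at h1 h2 e1 e2 e3 ⊢ <;> omega
    have l4 : (if M (j + 1) then y (j + 1) else x (j + 1)) < j →
        (if M (gx (j + 1)) then gy (j + 1) else gx (j + 1)) = j →
        j + 1 < (if M (gx j) then gy j else gx j) := by
      intro h1 h2
      have hj0 : j ≠ 0 := by omega
      have e2 := fun hd : _ ∧ _ => h.in_in j hj hj0 hd.1 hd.2
      have e3 := fun hd : _ ∧ _ => h.out_in_low j hj hj0 hd.1 hd.2
      have px := fun hd : _ ∧ _ => (hx.swap.step_back_third hj0 hj).1 hd.1 hd.2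
      have py := fun hd : _ ∧ _ => (hy.swap.step_back_third hj0 hj).1 hd.1 hd.2
      by_cases m1 : M (gx (j + 1)) <;> by_cases m2 : M (j + 1) <;> by_cases m3 : M (gx j) <;>
        simp only [m1, m2, m3, if_true, if_false, iff_true, iff_false, not_true, imp_false]
          at h1 h2 e1 e2 e3 ⊢ <;> omega
    -- By `l1` and `l2`, at a peak one neighbour equals `j` and the other is below it; `l3` and `l4`
    -- treat the two orders.
    omega

end Saturated

/-! ### The tours in a face -/

/-- A property of the arc that leaves or enters some city. -/
def IsFeature (n : ℕ) (F : (ℕ → ℕ) → (ℕ → ℕ) → Prop) : Prop :=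
  ∃ i < n, ∃ A : ℕ → Prop, (F = fun f _ => A (f i)) ∨ F = fun _ g => A (g i)

/-- The properties that the support of a convex combination of tours has, if the combination is a
point of the segment between the tours `x` and `y`. -/
structure IsSupport (n : ℕ) (x gx y gy : ℕ → ℕ) (Z : (ℕ → ℕ) → (ℕ → ℕ) → Prop) : Prop where
  psb : ∀ z gz, Z z gz → IsPSB n z gz
  mix : ∀ z gz, Z z gz → ∀ i < n, z i = x i ∨ z i = y i
  tight : ∀ F G, IsFeature n F → IsFeature n G → (F x gx ↔ G x gx) → (F y gy ↔ G y gy) →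
    (∀ z gz, Z z gz → F z gz → G z gz) → ∀ z gz, Z z gz → G z gz → F z gz

theorem IsFeature.out {n i : ℕ} (hi : i < n) (A : ℕ → Prop) :
    IsFeature n (fun f _ => A (f i)) := ⟨i, hi, A, Or.inl rfl⟩

theorem IsFeature.in {n i : ℕ} (hi : i < n) (A : ℕ → Prop) :
    IsFeature n (fun _ g => A (g i)) := ⟨i, hi, A, Or.inr rfl⟩

theorem IsFeature.not {n : ℕ} {F : (ℕ → ℕ) → (ℕ → ℕ) → Prop} (hF : IsFeature n F) :
    IsFeature n (fun f g => ¬ F f g) := by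
  obtain ⟨i, hi, A, rfl | rfl⟩ := hF
  · exact .out hi fun v => ¬ A v
  · exact .in hi fun v => ¬ A v

theorem IsFeature.true {n : ℕ} (hn : 0 < n) : IsFeature n (fun _ _ => True) :=
  .out hn fun _ => True

theorem IsFeature.swap {n : ℕ} {F : (ℕ → ℕ) → (ℕ → ℕ) → Prop} (hF : IsFeature n F) :
    IsFeature n (fun f g => F g f) := by
  obtain ⟨i, hi, A, rfl | rfl⟩ := hF
  · exact .in hi A
  · exact .out hi A

namespace IsSupport

variable {n : ℕ} {x gx y gy : ℕ → ℕ} {Z : (ℕ → ℕ) → (ℕ → ℕ) → Prop}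
  {F G H : (ℕ → ℕ) → (ℕ → ℕ) → Prop}

theorem swap (h : IsSupport n x gx y gy Z) (hx : IsPSB n x gx) (hy : IsPSB n y gy) :
    IsSupport n gx x gy y (fun g f => Z f g) where
  psb _ _ hz := (h.psb _ _ hz).swap
  mix _ _ hz _ hi := IsPSB.g_mix hx hy (h.psb _ _ hz) (h.mix _ _ hz) hi
  tight _ _ hF hG h1 h2 h3 z gz hz :=
    h.tight _ _ hF.swap hG.swap h1 h2 (fun z gz hz => h3 gz z hz) gz z hz

theorem symm (h : IsSupport n x gx y gy Z) : IsSupport n y gy x gx Z where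
  psb := h.psb
  mix z gz hz i hi := (h.mix z gz hz i hi).symm
  tight F G hF hG h1 h2 := h.tight F G hF hG h2 h1

/-- In the tours of the support, the two features come from the same one of the tours `x`
and `y`. -/
def Linked (x gx : ℕ → ℕ) (Z : (ℕ → ℕ) → (ℕ → ℕ) → Prop) (F G : (ℕ → ℕ) → (ℕ → ℕ) → Prop) :
    Prop := ∀ z gz, Z z gz → ((F z gz ↔ F x gx) ↔ (G z gz ↔ G x gx))

/-- Since the features agree at both ends of the segment, `tight` turns the implication into an
equivalence on the support. -/
theorem linked_of_imp (h : IsSupport n x gx y gy Z) (hF : IsFeature n F) (hG : IsFeature n G)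
    (h1 : F x gx ↔ G x gx) (h2 : F y gy ↔ G y gy) (h3 : ∀ z gz, Z z gz → F z gz → G z gz) :
    Linked x gx Z F G := fun z gz hz => by
  have := h3 z gz hz
  have := h.tight F G hF hG h1 h2 h3 z gz hz
  grind

/-- Each feature holds in exactly one of `x` and `y`, and not in the same one; so `F` and `¬ G`
agree at both ends. -/
theorem linked_of_forbidden (h : IsSupport n x gx y gy Z) (hF : IsFeature n F)
    (hG : IsFeature n G) (hFd : ¬ (F x gx ↔ F y gy)) (hGd : ¬ (G x gx ↔ G y gy))
    (hx : ¬ (F x gx ∧ G x gx)) (hy : ¬ (F y gy ∧ G y gy))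
    (hz : ∀ z gz, Z z gz → ¬ (F z gz ∧ G z gz)) : Linked x gx Z F G := fun z gz hzZ => by
  have := h.linked_of_imp hF hG.not (by grind) (by grind)
    (fun z gz h1 h2 h3 => hz z gz h1 ⟨h2, h3⟩) z gz hzZ
  dsimp only at this
  grind

/-- Suppose that `F` and `G` hold at the same end. Then either `H` holds at both ends, hence on the
whole support, and `F` implies `G` there, or `H` separates the ends, which is the case `hard`. If
they hold at opposite ends, `H` fails at both, hence on the support, and `F` and `G` exclude each
other. -/
theorem linked_of_third (h : IsSupport n x gx y gy Z) (hn : 0 < n) (hF : IsFeature n F)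
    (hG : IsFeature n G) (hH : IsFeature n H) (hFd : ¬ (F x gx ↔ F y gy))
    (hGd : ¬ (G x gx ↔ G y gy)) {T : (ℕ → ℕ) → (ℕ → ℕ) → Prop}
    (hT : ∀ z gz, T z gz → (F z gz → G z gz → H z gz) ∧ (F z gz → H z gz → G z gz) ∧
      (G z gz → H z gz → F z gz)) (hx : T x gx) (hy : T y gy) (hz : ∀ z gz, Z z gz → T z gz)
    (hard : (F x gx ∧ G x gx ∧ H x gx ∧ ¬ F y gy ∧ ¬ G y gy ∧ ¬ H y gy) ∨
      (F y gy ∧ G y gy ∧ H y gy ∧ ¬ F x gx ∧ ¬ G x gx ∧ ¬ H x gx) → Linked x gx Z F G) :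
    Linked x gx Z F G := by
  have hTx := hT x gx hx
  have hTy := hT y gy hy
  by_cases hFG : F x gx ↔ G x gx
  · by_cases hHd : H x gx ↔ H y gy
    · have hH1 : H x gx := by grind
      have hHz : ∀ z gz, Z z gz → H z gz := fun z gz hzZ =>
        h.tight H _ hH (.true hn) (by grind) (by grind) (fun _ _ _ _ => trivial) z gz hzZ trivial
      refine h.linked_of_imp hF hG hFG (by grind) fun z gz hzZ hFz => ?_
      exact (hT z gz (hz z gz hzZ)).2.1 hFz (hHz z gz hzZ)
    · exact hard (by grind)
  · have hHz : ∀ z gz, Z z gz → ¬ H z gz := fun z gz hzZ hHz =>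
      h.tight _ H (IsFeature.true hn).not hH (by grind) (by grind)
        (fun _ _ _ hf => (hf trivial).elim) z gz hzZ hHz trivial
    refine h.linked_of_forbidden hF hG hFd hGd (by grind) (by grind) fun z gz hzZ hFz => ?_
    exact hHz z gz hzZ ((hT z gz (hz z gz hzZ)).1 hFz.1 hFz.2)

/-- The case where `x` has a step-back peak in ascending order at `j + 1`, and `y` differs from it
in all the three defining features. -/
theorem linked_of_step_back (h : IsSupport n x gx y gy Z) (hx : IsPSB n x gx) (hy : IsPSB n y gy)
    {j : ℕ} (hj0 : j ≠ 0) (hj : j + 2 < n)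
    (x1 : gx (j + 1) < j) (x2 : x (j + 1) = j) (x3 : j + 1 < x j) (y1 : ¬ gy (j + 1) < j)
    (y2 : y (j + 1) ≠ j) (y3 : ¬ j + 1 < y j) :
    ∀ z gz, Z z gz → (gz (j + 1) < j ↔ z (j + 1) = j) ∧ (gz (j + 1) < j ↔ j + 1 < z j) := by
  have hp := IsFeature.in (n := n) (i := j + 1) (by omega) (fun v => v < j)
  have hs := IsFeature.out (n := n) (i := j + 1) (by omega) (fun v => v = j)
  have hu := IsFeature.out (n := n) (i := j) (by omega) (fun v => j + 1 < v)
  have third := fun z gz hz => (h.psb z gz hz).step_back_third hj0 hj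
  -- Two features bring the third, so a support tour has all, none or exactly one. Excluding the
  -- tours with only the first, or with only the last, leaves an implication that `tight` can
  -- reverse.
  have key : (∀ z gz, Z z gz → gz (j + 1) < j → z (j + 1) = j) ∨
      (∀ z gz, Z z gz → j + 1 < z j → gz (j + 1) < j) := by
    rcases IsPSB.no_pattern hx hy hj0 hj x1 x2 x3 y1 y2 y3 with hno | hno
    · refine Or.inl fun z gz hz h1 => ?_
      have := hno z gz (h.psb z gz hz) (h.mix z gz hz)
      have := third z gz hz
      grind
    · refine Or.inr fun z gz hz h1 => ?_
      have := hno z gz (h.psb z gz hz) (h.mix z gz hz)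
      have := third z gz hz
      grind
  rcases key with key | key
  · have h1 : ∀ z gz, Z z gz → z (j + 1) = j → gz (j + 1) < j :=
      h.tight _ _ hp hs (by grind) (by grind) key
    have h2 : ∀ z gz, Z z gz → j + 1 < z j → gz (j + 1) < j :=
      h.tight _ _ hp hu (by grind) (by grind) fun z gz hz hpz =>
        (third z gz hz).1 hpz (key z gz hz hpz)
    intro z gz hz
    have := key z gz hz
    have := h1 z gz hz
    have := h2 z gz hz
    have := third z gz hz
    grind
  · have h2 : ∀ z gz, Z z gz → gz (j + 1) < j → j + 1 < z j :=
      h.tight _ _ hu hp (by grind) (by grind) key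
    have h1 : ∀ z gz, Z z gz → z (j + 1) = j → gz (j + 1) < j :=
      h.tight _ _ hp hs (by grind) (by grind) fun z gz hz hpz =>
        (third z gz hz).2.1 hpz (h2 z gz hz hpz)
    intro z gz hz
    have := key z gz hz
    have := h1 z gz hz
    have := h2 z gz hz
    have := third z gz hz
    grind

theorem linked_step_back (h : IsSupport n x gx y gy Z) (hx : IsPSB n x gx) (hy : IsPSB n y gy)
    {j : ℕ} (hj0 : j ≠ 0) (hj : j + 2 < n) (hd : 
      (gx (j + 1) < j ∧ x (j + 1) = j ∧ j + 1 < x j ∧ ¬ gy (j + 1) < j ∧ y (j + 1) ≠ j ∧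
        ¬ j + 1 < y j) ∨
      (gy (j + 1) < j ∧ y (j + 1) = j ∧ j + 1 < y j ∧ ¬ gx (j + 1) < j ∧ x (j + 1) ≠ j ∧
        ¬ j + 1 < x j)) :
    ∀ z gz, Z z gz → (gz (j + 1) < j ↔ z (j + 1) = j) ∧ (gz (j + 1) < j ↔ j + 1 < z j) := by
  rcases hd with ⟨h1, h2, h3, h4, h5, h6⟩ | ⟨h1, h2, h3, h4, h5, h6⟩
  · exact h.linked_of_step_back hx hy hj0 hj h1 h2 h3 h4 h5 h6
  · exact h.symm.linked_of_step_back hy hx hj0 hj h1 h2 h3 h4 h5 h6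

theorem linked_long (h : IsSupport n x gx y gy Z) (hx : IsPSB n x gx) (hy : IsPSB n y gy)
    {j : ℕ} (hj : j + 2 < n)
    (h1 : ¬ (gx (j + 1) < j ↔ gy (j + 1) < j))
    (h2 : ¬ (x (j + 1) < j ↔ y (j + 1) < j)) :
    Linked x gx Z (fun _ g => g (j + 1) < j) (fun f _ => f (j + 1) < j) :=
  h.linked_of_forbidden (.in (by omega) (fun v => v < j)) (.out (by omega) (fun v => v < j)) h1 h2
    (fun h => hx.not_long_peak hj h.2 h.1) (fun h => hy.not_long_peak hj h.2 h.1)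
    fun z gz hz h' => (h.psb z gz hz).not_long_peak hj h'.2 h'.1

theorem linked_short (h : IsSupport n x gx y gy Z) (hx : IsPSB n x gx) (hy : IsPSB n y gy)
    {j : ℕ} (hj : j + 2 < n)
    (h1 : ¬ (gx (j + 1) = j ↔ gy (j + 1) = j))
    (h2 : ¬ (x (j + 1) = j ↔ y (j + 1) = j)) :
    Linked x gx Z (fun _ g => g (j + 1) = j) (fun f _ => f (j + 1) = j) :=
  h.linked_of_forbidden (.in (by omega) (fun v => v = j)) (.out (by omega) (fun v => v = j)) h1 h2
    (fun h => hx.not_two_cycle hj h.2 h.1) (fun h => hy.not_two_cycle hj h.2 h.1)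
    fun z gz hz h' => (h.psb z gz hz).not_two_cycle hj h'.2 h'.1

/-- This lemma and the next two compare the three pairs of features of an ascending step-back peak;
the remaining feature plays the part of `H`. -/
theorem linked_long_short (h : IsSupport n x gx y gy Z) (hx : IsPSB n x gx) (hy : IsPSB n y gy)
    {j : ℕ} (hj0 : j ≠ 0) (hj : j + 2 < n)
    (h1 : ¬ (gx (j + 1) < j ↔ gy (j + 1) < j))
    (h2 : ¬ (x (j + 1) = j ↔ y (j + 1) = j)) :
    Linked x gx Z (fun _ g => g (j + 1) < j) (fun f _ => f (j + 1) = j) := by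
  refine h.linked_of_third (H := fun f _ => j + 1 < f j) (T := IsPSB n) (by omega)
    (.in (by omega) (fun v => v < j)) (.out (by omega) (fun v => v = j))
    (.out (by omega) (fun v => j + 1 < v)) h1 h2
    (fun z gz hz => hz.step_back_third hj0 hj) hx hy h.psb fun hd z gz hz => ?_
  have := h.linked_step_back hx hy hj0 hj (by grind) z gz hz
  grind

theorem linked_long_up (h : IsSupport n x gx y gy Z) (hx : IsPSB n x gx) (hy : IsPSB n y gy)
    {j : ℕ} (hj0 : j ≠ 0) (hj : j + 2 < n)
    (h1 : ¬ (gx (j + 1) < j ↔ gy (j + 1) < j))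
    (h2 : ¬ (j + 1 < x j ↔ j + 1 < y j)) :
    Linked x gx Z (fun _ g => g (j + 1) < j) (fun f _ => j + 1 < f j) := by
  refine h.linked_of_third (H := fun f _ => f (j + 1) = j) (T := IsPSB n) (by omega)
    (.in (by omega) (fun v => v < j)) (.out (by omega) (fun v => j + 1 < v))
    (.out (by omega) (fun v => v = j)) h1 h2
    (fun z gz hz => ?_) hx hy h.psb fun hd z gz hz => ?_
  · have := hz.step_back_third hj0 hj
    grind
  · have := h.linked_step_back hx hy hj0 hj (by grind) z gz hz
    grind

theorem linked_short_up (h : IsSupport n x gx y gy Z) (hx : IsPSB n x gx) (hy : IsPSB n y gy)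
    {j : ℕ} (hj0 : j ≠ 0) (hj : j + 2 < n)
    (h1 : ¬ (x (j + 1) = j ↔ y (j + 1) = j))
    (h2 : ¬ (j + 1 < x j ↔ j + 1 < y j)) :
    Linked x gx Z (fun f _ => f (j + 1) = j) (fun f _ => j + 1 < f j) := by
  refine h.linked_of_third (H := fun _ g => g (j + 1) < j) (T := IsPSB n) (by omega)
    (.out (by omega) (fun v => v = j)) (.out (by omega) (fun v => j + 1 < v))
    (.in (by omega) (fun v => v < j)) h1 h2
    (fun z gz hz => ?_) hx hy h.psb fun hd z gz hz => ?_
  · have := hz.step_back_third hj0 hj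
    grind
  · have := h.linked_step_back hx hy hj0 hj (by grind) z gz hz
    grind

end IsSupport

end PyramidalTour

/-! ### From the tours of a support to saturated sets -/

namespace PyramidalTour

namespace IsSupport

variable {n : ℕ} {x gx y gy : ℕ → ℕ} {Z : (ℕ → ℕ) → (ℕ → ℕ) → Prop}

/-- A property that separates the two candidates tells which one was taken. -/
theorem eq_iff_of_mem {a b c : ℕ} {A : ℕ → Prop} (h : c = a ∨ c = b) (hA : ¬ (A a ↔ A b)) :
    c = a ↔ (A c ↔ A a) := by
  refine ⟨fun e => by rw [e], fun hc => ?_⟩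
  rcases h with h | h
  · exact h
  · rw [h] at hc
    exact (hA hc.symm).elim

/-- Exactly one of the arcs into a city is chosen, which gives `alternate`. For the other
conditions, a separating feature reveals the origin of an arc, and linked features reveal the same
origin; descending step-backs are treated by reversing the tours. -/
theorem saturated (h : IsSupport n x gx y gy Z) (hx : IsPSB n x gx) (hy : IsPSB n y gy)
    {z gz : ℕ → ℕ} (hz : Z z gz) : Saturated n x gx y gy (fun v => z v = x v) := by
  have hp := h.psb z gz hz
  have hm := h.mix z gz hz
  have hmg : ∀ i < n, gz i = gx i ∨ gz i = gy i := fun i hi => IsPSB.g_mix hx hy hp hm hi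
  have hs := h.swap hx hy
  have hin : ∀ i < n, (z (gx i) = x (gx i) ↔ gz i = gx i) := fun i hi => by
    rw [hx.fg i hi, hp.f_eq_iff (hx.g_lt i hi) hi]
  have out : ∀ {i : ℕ} (A : ℕ → Prop), i < n → ¬ (A (x i) ↔ A (y i)) →
      (z i = x i ↔ (A (z i) ↔ A (x i))) := fun A hi hA => eq_iff_of_mem (hm _ hi) hA
  have inn : ∀ {i : ℕ} (A : ℕ → Prop), i < n → ¬ (A (gx i) ↔ A (gy i)) →
      (z (gx i) = x (gx i) ↔ (A (gz i) ↔ A (gx i))) := fun A hi hA => by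
    rw [hin _ hi]
    exact eq_iff_of_mem (hmg _ hi) hA
  refine ⟨fun v hv => ?_, fun j hj h1 h2 => ?_, fun j hj hj0 h1 h2 => ?_,
    fun j hj hj0 h1 h2 => ?_, fun j hj hj0 h1 h2 => ?_, fun j hj hj0 h1 h2 => ?_⟩
  · have hm' := hx.f_lt v hv
    have e1 := hy.fg (x v) hm'
    have hw := hy.g_lt (x v) hm'
    have e2 := hmg (x v) hm'
    rw [hx.gf v hv] at e2
    have e3 := hp.f_eq_iff hv hm'
    have e4 := hp.f_eq_iff hw hm'
    have e5 := hm _ hw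
    by_cases hwv : gy (x v) = v
    · rw [hwv]
    · have e6 : x (gy (x v)) ≠ x v := fun e => hwv (hx.f_inj hw hv e)
      rw [e1] at e5
      constructor
      · intro e
        rw [e] at e4 e5
        rw [e3]
        rcases e2 with e2 | e2
        · exact e2
        · exact (e6 (e4.2 e2)).elim
      · intro e
        refine e5.resolve_right fun e' => hwv ?_
        rw [← e4.1 e', e3.1 e]
  · have hj1 : j + 1 < n := by omega
    rcases h1 with h1 | h1 <;> rcases h2 with h2 | h2
    · rw [inn (fun v => v < j) hj1 h1, out (fun v => v < j) hj1 h2]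
      exact h.linked_long hx hy hj h1 h2 z gz hz
    · rw [inn (fun v => v < j) hj1 h1, out (fun v => v = j) hj1 h2]
      exact h.linked_long_short hx hy (by omega) hj h1 h2 z gz hz
    · rw [inn (fun v => v = j) hj1 h1, out (fun v => v < j) hj1 h2]
      exact (hs.linked_long_short hx.swap hy.swap (by omega) hj h2 h1 gz z hz).symm
    · rw [inn (fun v => v = j) hj1 h1, out (fun v => v = j) hj1 h2]
      exact h.linked_short hx hy hj h1 h2 z gz hz
  · rw [out (fun v => v = j) (by omega) h1, out (fun v => j + 1 < v) (by omega) h2]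
    exact h.linked_short_up hx hy hj0 hj h1 h2 z gz hz
  · rw [inn (fun v => v < j) (by omega) h1, out (fun v => j + 1 < v) (by omega) h2]
    exact h.linked_long_up hx hy hj0 hj h1 h2 z gz hz
  · rw [inn (fun v => v = j) (by omega) h1, inn (fun v => j + 1 < v) (by omega) h2]
    exact hs.linked_short_up hx.swap hy.swap hj0 hj h1 h2 gz z hz
  · rw [out (fun v => v < j) (by omega) h1, inn (fun v => j + 1 < v) (by omega) h2]
    exact hs.linked_long_up hx.swap hy.swap hj0 hj h1 h2 gz z hz

end IsSupport

/-! ### Permutations -/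

section Perm

variable {n : ℕ} {τ : Equiv.Perm (Fin n)}

theorem tourArray_of_lt (τ : Equiv.Perm (Fin n)) {i : ℕ} (hi : i < n) :
    tourArray τ i = τ ⟨i, hi⟩ := by simp [tourArray, hi]

theorem tourArray_val (τ : Equiv.Perm (Fin n)) (i : Fin n) : tourArray τ i = τ i := by
  simp [tourArray]

theorem tourArray_lt (τ : Equiv.Perm (Fin n)) {i : ℕ} (hi : i < n) : tourArray τ i < n := by
  rw [tourArray_of_lt τ hi]
  exact (τ _).2

theorem tourArray_symm_tourArray (τ : Equiv.Perm (Fin n)) {i : ℕ} (hi : i < n) :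
    tourArray τ.symm (tourArray τ i) = i := by
  rw [tourArray_of_lt τ hi, tourArray_val, Equiv.symm_apply_apply]

theorem isPeak_iff (i : Fin n) :
    IsPeak τ i ↔ tourArray τ.symm i < i ∧ tourArray τ i < i := by
  simp only [IsPeak, tourArray_val, Fin.lt_def]

theorem isAscStepBackPeak_iff (i : Fin n) :
    IsAscStepBackPeak τ i ↔ tourArray τ.symm i < i ∧ tourArray τ i + 1 = i ∧
      i < tourArray τ (tourArray τ i) := by
  simp only [IsAscStepBackPeak, tourArray_val, Fin.lt_def]

theorem isDescStepBackPeak_iff (i : Fin n) :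
    IsDescStepBackPeak τ i ↔ i < tourArray τ.symm (tourArray τ.symm i) ∧
      tourArray τ.symm i + 1 = i ∧ tourArray τ i < i := by
  simp only [IsDescStepBackPeak, tourArray_val, Fin.lt_def]

theorem IsPyramidalSB.isPSB (hn : 2 ≤ n) (h : IsPyramidalSB τ) :
    IsPSB n (tourArray τ) (tourArray τ.symm) := by
  have : Nontrivial (Fin n) := Fin.nontrivial_iff_two_le.2 hn
  refine ⟨hn, fun i hi => tourArray_lt τ hi, fun i hi => tourArray_lt _ hi,
    fun i hi => tourArray_symm_tourArray τ hi, fun i hi => tourArray_symm_tourArray τ.symm hi,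
    fun i hi => ?_, fun j hj hg hf => ?_⟩
  · rw [tourArray_of_lt τ hi]
    intro e
    exact h.1.apply_ne Set.nontrivial_univ (Set.mem_univ ⟨i, hi⟩) (Fin.ext e)
  · have hnp : ¬ IsProperPeak τ ⟨j + 1, by omega⟩ := fun hp => by
      have := (h.2 _).1 hp
      simp only at this
      omega
    rw [IsProperPeak, isPeak_iff, isAscStepBackPeak_iff, isDescStepBackPeak_iff] at hnp
    simp only [not_and, not_not] at hnp
    rcases hnp ⟨by omega, by omega⟩ with ⟨_, h2, h3⟩ | ⟨h1, h2, _⟩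
    · have : tourArray τ (j + 1) = j := by omega
      exact Or.inl ⟨this, by rwa [this] at h3⟩
    · have : tourArray τ.symm (j + 1) = j := by omega
      exact Or.inr ⟨this, by rwa [this] at h1⟩

namespace IsPSB

variable {f g : ℕ → ℕ}

/-- The permutation whose maps are `f` and `g`. -/
def toPerm (h : IsPSB n f g) : Equiv.Perm (Fin n) where
  toFun i := ⟨f i, h.f_lt i i.2⟩
  invFun i := ⟨g i, h.g_lt i i.2⟩
  left_inv i := Fin.ext (h.gf i i.2)
  right_inv i := Fin.ext (h.fg i i.2)

theorem tourArray_toPerm (h : IsPSB n f g) {i : ℕ} (hi : i < n) : tourArray h.toPerm i = f i := by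
  rw [tourArray_of_lt _ hi]
  rfl

theorem tourArray_toPerm_symm (h : IsPSB n f g) {i : ℕ} (hi : i < n) :
    tourArray h.toPerm.symm i = g i := by
  rw [tourArray_of_lt _ hi]
  rfl

theorem isProperPeak_toPerm (h : IsPSB n f g) (i : Fin n) :
    IsProperPeak h.toPerm i ↔ (i : ℕ) + 1 = n := by
  have hi := i.2
  rw [IsProperPeak, isPeak_iff, isAscStepBackPeak_iff, isDescStepBackPeak_iff,
    h.tourArray_toPerm hi, h.tourArray_toPerm_symm hi, h.tourArray_toPerm (h.f_lt i hi),
    h.tourArray_toPerm_symm (h.g_lt i hi)]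
  constructor
  · rintro ⟨⟨h1, h2⟩, h3⟩
    by_contra hne
    obtain ⟨j, hj⟩ : ∃ j, (i : ℕ) = j + 1 := ⟨i - 1, by omega⟩
    rw [hj] at h1 h2 h3
    apply h3
    rcases h.peak j (by omega) (by omega) (by omega) with ⟨h4, h5⟩ | ⟨h4, h5⟩
    · exact Or.inl ⟨h1, by omega, by rwa [h4]⟩
    · exact Or.inr ⟨by rwa [h4], by omega, h2⟩
  · intro hin
    have h1 := h.f_lt i hi
    have h2 := h.g_lt i hi
    have h3 := h.f_ne i hi
    have h4 := h.g_ne i hi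
    have h5 := h.f_lt _ h1
    have h6 := h.g_lt _ h2
    omega

/-- The greatest city of a cycle is a peak, but not a step-back peak, since a step-back peak has a
greater city two steps away on its cycle. So every cycle contains the last city, and there is only
one cycle. -/
theorem isPyramidalSB_toPerm (h : IsPSB n f g) : IsPyramidalSB h.toPerm := by
  classical
  have hn := h.two_le
  refine ⟨⟨Set.bijOn_univ.2 h.toPerm.bijective, ?_⟩, h.isProperPeak_toPerm⟩
  have key : ∀ i : Fin n, h.toPerm.SameCycle i ⟨n - 1, by omega⟩ := by
    intro i
    obtain ⟨m, hm, hmax⟩ := Finset.exists_max_image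
      (Finset.univ.filter fun j => h.toPerm.SameCycle i j) id
      ⟨i, by simpa using Equiv.Perm.SameCycle.refl _ i⟩
    simp only [Finset.mem_filter, Finset.mem_univ, true_and, id] at hm hmax
    have hinv : ∀ m, h.toPerm.SameCycle i m → h.toPerm.SameCycle i (h.toPerm.symm m) :=
      fun m hm => Equiv.Perm.sameCycle_symm_apply_right.2 hm
    have h1 : (f m : ℕ) ≤ m := hmax (h.toPerm m) (by simpa using hm)
    have h2 : (g m : ℕ) ≤ m := hmax (h.toPerm.symm m) (hinv m hm)
    have h3 : (f (f m) : ℕ) ≤ m := hmax (h.toPerm (h.toPerm m)) (by simpa using hm)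
    have h4 : (g (g m) : ℕ) ≤ m := hmax (h.toPerm.symm (h.toPerm.symm m)) 
      (hinv _ (hinv m hm))
    have h5 := h.f_ne m m.2
    have h6 := h.g_ne m m.2
    suffices (m : ℕ) = n - 1 by
      have : m = ⟨n - 1, by omega⟩ := Fin.ext this
      rwa [← this]
    by_contra hne
    obtain ⟨j, hj⟩ : ∃ j, (m : ℕ) = j + 1 := ⟨m - 1, by omega⟩
    rw [hj] at h1 h2 h3 h4 h5 h6
    rcases h.peak j (by omega) (by omega) (by omega) with ⟨h7, h8⟩ | ⟨h7, h8⟩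
    · rw [h7] at h3
      omega
    · rw [h7] at h4
      omega
  exact fun i _ j _ => (key i).trans (key j).symm

end IsPSB

/-- The city `i` belongs to the way up, according to its neighbours. -/
def LocallyAscending (n : ℕ) (f g : ℕ → ℕ) (i : ℕ) : Prop :=
  i + 1 < n ∧ ((i < f i ∧ (f i = i + 1 → i ≠ 0 → g i < i)) ∨
    (g i < i ∧ f i + 1 = i ∧ i < f (f i)))

/-- With its companion for `f`, this carries the local condition along the way up: backwards to the
first city, forwards until the last one. -/
theorem IsPSB.locallyAscending_g {f g : ℕ → ℕ} (h : IsPSB n f g) {i : ℕ} (h0 : i ≠ 0)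
    (hi : LocallyAscending n f g i) : LocallyAscending n f g (g i) := by
  obtain ⟨hin, hi⟩ := hi
  have e1 := h.fg i (by omega)
  have e2 := h.g_ne i (by omega)
  have e3 := h.g_lt i (by omega)
  have e4 : g i + 1 < n := by
    by_contra hcon
    have e5 := h.f_eq_iff (i := i + 1) (j := i) (by omega) (by omega)
    rcases hi with hi | hi
    · have e6 := h.valley (i := i) (by omega) h0 hi.1 (by omega)
      omega
    · omega
  refine ⟨e4, ?_⟩
  rcases Nat.lt_or_gt_of_ne e2 with e2 | e2
  · refine Or.inl ⟨by omega, fun e5 e6 => ?_⟩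
    have e7 := h.g_ne (g i) (by omega)
    by_contra hcon
    have e8 := h.valley (i := g i) (by omega) e6 (by omega) (by omega)
    have e9 : g i + 1 = i := by omega
    rw [e9] at e8
    rcases hi with hi | ⟨_, h2, h3⟩
    · omega
    · have : f i = g i := by omega
      rw [this, e1] at h3
      omega
  · rcases hi with hi | hi
    · obtain ⟨_, e5 | e5⟩ := h.valley (by omega) h0 hi.1 e2
      · have e6 : g i = i + 1 := (h.f_eq_iff (by omega) (by omega)).1 e5.1
        rw [e6]
        refine Or.inr ⟨by omega, by omega, ?_⟩
        rw [e5.1]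
        exact e5.2.1
      · have := hi.2 e5.1 h0
        omega
    · omega

theorem IsPSB.locallyAscending_f {f g : ℕ → ℕ} (h : IsPSB n f g) {i : ℕ}
    (hi : LocallyAscending n f g i) (hf : f i + 1 ≠ n) : LocallyAscending n f g (f i) := by
  obtain ⟨hin, hi⟩ := hi
  have e1 := h.gf i (by omega)
  have e2 := h.f_lt i (by omega)
  have e3 := h.f_ne (f i) e2
  refine ⟨by omega, ?_⟩
  rcases hi with ⟨h1, h2⟩ | ⟨h1, h2, h3⟩
  · rcases Nat.lt_or_gt_of_ne e3 with e3 | e3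
    · refine Or.inr ⟨by omega, ?_⟩
      obtain ⟨j, hj⟩ : ∃ j, f i = j + 1 := ⟨f i - 1, by omega⟩
      rw [hj] at e1 e2 e3 hf h1 ⊢
      rcases h.peak j (by omega) (by omega) (by omega) with ⟨h4, h5⟩ | ⟨h4, h5⟩
      · rw [h4]
        exact ⟨rfl, h5⟩
      · obtain rfl : i = j := by omega
        have e6 := h.f_eq_iff (i := i + 1) (j := 0) (by omega) (by omega)
        have e7 := h.gf (i + 1) (by omega)
        by_cases hi0 : i = 0
        · subst hi0
          have : f (0 + 1) = 0 := by omega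
          rw [this] at e7
          omega
        · have := h2 hj hi0
          omega
    · exact Or.inl ⟨by omega, by omega⟩
  · exact Or.inl ⟨by omega, by omega⟩

/-- Forwards, the local condition is carried along the tour from the first city. Backwards, strong
induction on the label works: the predecessor is smaller, except at the bottom of an ascending
step-back, where the city two steps back is smaller. -/
theorem isAscending_iff (hn : 2 ≤ n) (h : IsPyramidalSB τ) (i : Fin n) :
    IsAscending τ i ↔ LocallyAscending n (tourArray τ) (tourArray τ.symm) i := by
  have hp := h.isPSB hn
  have hz : LocallyAscending n (tourArray τ) (tourArray τ.symm) 0 := by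
    have := hp.f_ne 0 (by omega)
    exact ⟨by omega, Or.inl ⟨by omega, by omega⟩⟩
  constructor
  · rintro ⟨s, k, hs, hk, hm⟩
    suffices ∀ m ≤ k, LocallyAscending n (tourArray τ) (tourArray τ.symm) ((τ ^ m) s) by
      rw [← hk]
      exact this k le_rfl
    intro m
    induction m with
    | zero =>
      intro _
      simpa [hs] using hz
    | succ m ih =>
      intro hmk
      have := hm (m + 1) hmk
      rw [pow_succ', Equiv.Perm.mul_apply, ← tourArray_val] at this ⊢
      exact hp.locallyAscending_f (ih (by omega)) this
  · have key : ∀ i : Fin n, IsAscending τ (τ.symm i) → (i : ℕ) + 1 ≠ n → IsAscending τ i := by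
      rintro i ⟨s, k, hs, hk, hm⟩ hi
      refine ⟨s, k + 1, hs, by rw [pow_succ', Equiv.Perm.mul_apply, hk, Equiv.apply_symm_apply],
        fun m hmk => ?_⟩
      rcases Nat.lt_or_ge k m with hkm | hkm
      · obtain rfl : m = k + 1 := by omega
        rwa [pow_succ', Equiv.Perm.mul_apply, hk, Equiv.apply_symm_apply]
      · exact hm m hkm
    obtain ⟨i, hi⟩ := i
    simp only
    induction i using Nat.strong_induction_on with
    | _ i ih =>
      intro hA
      by_cases h0 : i = 0
      · subst h0
        exact ⟨⟨0, hi⟩, 0, rfl, rfl, fun m hm => by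
          obtain rfl : m = 0 := by omega
          simp
          omega⟩
      · have hg := hp.locallyAscending_g h0 hA
        have hin := hA.1
        refine key ⟨i, hi⟩ ?_ (by simp only; omega)
        have e0 := tourArray_of_lt τ.symm hi
        have e2 := hp.g_ne i hi
        rcases Nat.lt_or_gt_of_ne e2 with e2 | e2
        · have := ih _ e2 (hp.g_lt i hi) hg
          simpa [e0] using this
        · rcases hA.2 with hA' | hA'
          · obtain ⟨_, e5 | e5⟩ := hp.valley (by omega) h0 hA'.1 e2
            · have e6 : tourArray τ.symm i = i + 1 := (hp.f_eq_iff (by omega) (by omega)).1 e5.1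
              have e7 : τ.symm ⟨i, hi⟩ = ⟨i + 1, by omega⟩ := Fin.ext (by rw [← e0, e6])
              rw [e7]
              refine key _ ?_ (by simp only; omega)
              rw [e6] at hg
              have hg' := hp.locallyAscending_g (by omega) hg
              have := ih _ e5.2.2 (hp.g_lt (i + 1) (by omega)) hg'
              simpa [tourArray_of_lt τ.symm (show i + 1 < n by omega)] using this
            · have := hA'.2 e5.1 h0
              omega
          · omega

theorem encodingArray_asc_peak {j : ℕ} (hj : j + 2 < n)
    (h1 : tourArray τ.symm (j + 1) < j + 1) (h2 : tourArray τ (j + 1) = j)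
    (h3 : j + 1 < tourArray τ j) : encodingArray τ (j + 1) = 3 := by
  rw [encodingArray, dif_pos ⟨by omega, by omega⟩, encoding, if_pos]
  rw [isAscStepBackPeak_iff]
  simp only
  refine ⟨h1, by omega, by rwa [h2]⟩

theorem encodingArray_desc_peak (hn : 2 ≤ n) (h : IsPyramidalSB τ) {j : ℕ} (hj : j + 2 < n)
    (h1 : j + 1 < tourArray τ.symm j) (h2 : tourArray τ.symm (j + 1) = j)
    (h3 : tourArray τ (j + 1) < j + 1) : encodingArray τ (j + 1) = 2 := by
  have hp := h.isPSB hn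
  rw [encodingArray, dif_pos ⟨by omega, by omega⟩, encoding, if_neg, if_pos]
  · rw [isDescStepBackPeak_iff]
    simp only
    refine ⟨by rwa [h2], by omega, h3⟩
  · rw [isAscStepBackPeak_iff]
    simp only
    exact fun h' => hp.not_two_cycle hj (by omega) h2

-- The inner implication excludes the bottom of a descending step-back, which is left upwards but
-- lies on the way down.
open Classical in
theorem encodingArray_of_not_peak (hn : 2 ≤ n) (h : IsPyramidalSB τ) {i : ℕ} (h0 : 0 < i)
    (hi : i + 1 < n) (hpk : ¬ (tourArray τ.symm i < i ∧ tourArray τ i < i)) :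
    encodingArray τ i =
      if i < tourArray τ i ∧ (tourArray τ i = i + 1 → tourArray τ.symm i < i) then 1 else 0 := by
  rw [encodingArray, dif_pos ⟨h0, hi⟩, encoding, if_neg, if_neg]
  · simp only [isAscending_iff hn h, LocallyAscending]
    congr 1
    simp only [eq_iff_iff]
    constructor
    · rintro ⟨_, h1 | h1⟩
      · exact ⟨h1.1, fun e => h1.2 e (by omega)⟩
      · omega
    · exact fun h1 => ⟨hi, Or.inl ⟨h1.1, fun e _ => h1.2 e⟩⟩
  · rw [isDescStepBackPeak_iff]
    simp only
    omega
  · rw [isAscStepBackPeak_iff]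
    simp only
    omega

end Perm

end PyramidalTour

namespace PyramidalTour

variable {n : ℕ}

/-! ### Adjacency in the 1-skeleton -/

/-- Indexing the weights by all permutations lets two combinations be mixed term by term. -/
theorem exists_weights {p : Arc n → ℝ} (hp : p ∈ PSB n) :
    ∃ w : Equiv.Perm (Fin n) → ℝ, (∀ τ, 0 ≤ w τ) ∧ ∑ τ, w τ = 1 ∧
      (∀ τ, w τ ≠ 0 → IsPyramidalSB τ) ∧ ∑ τ, w τ • charVec τ = p := by
  classical
  refine convexHull_min (t := {p | ∃ w : Equiv.Perm (Fin n) → ℝ, (∀ τ, 0 ≤ w τ) ∧ ∑ τ, w τ = 1 ∧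
      (∀ τ, w τ ≠ 0 → IsPyramidalSB τ) ∧ ∑ τ, w τ • charVec τ = p}) ?_ ?_ hp
  · rintro _ ⟨τ, hτ, rfl⟩
    refine ⟨Pi.single τ 1, fun σ => ?_, by simp, fun σ hσ => ?_, ?_⟩
    · by_cases h : σ = τ
      · subst h
        simp
      · simp [h]
    · have : σ = τ := by
        by_contra h
        simp [h] at hσ
      rwa [this]
    · rw [Finset.sum_eq_single τ]
      · simp
      · intro σ _ h
        simp [h]
      · simp
  · rintro _ ⟨w₁, h₁, s₁, p₁, rfl⟩ _ ⟨w₂, h₂, s₂, p₂, rfl⟩ a b ha hb hab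
    refine ⟨fun τ => a * w₁ τ + b * w₂ τ, fun τ => ?_, ?_, fun τ hτ => ?_, ?_⟩
    · have := mul_nonneg ha (h₁ τ)
      have := mul_nonneg hb (h₂ τ)
      positivity
    · rw [Finset.sum_add_distrib, ← Finset.mul_sum, ← Finset.mul_sum, s₁, s₂]
      linarith
    · by_contra hcon
      have e₁ : w₁ τ = 0 := by
        by_contra h
        exact hcon (p₁ τ h)
      have e₂ : w₂ τ = 0 := by
        by_contra h
        exact hcon (p₂ τ h)
      simp [e₁, e₂] at hτ
    · simp only [add_smul, mul_smul, Finset.sum_add_distrib, Finset.smul_sum]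

theorem IsPyramidalSB.apply_ne (hn : 2 ≤ n) {τ : Equiv.Perm (Fin n)} (h : IsPyramidalSB τ)
    (i : Fin n) : τ i ≠ i := fun e =>
  (h.isPSB hn).f_ne i i.2 (by rw [tourArray_val, e])

theorem charVec_injOn (hn : 2 ≤ n) {x y : Equiv.Perm (Fin n)} (hx : IsPyramidalSB x)
    (h : charVec x = charVec y) : x = y := by
  ext i
  have := congrFun h ⟨(i, x i), (hx.apply_ne hn i).symm⟩
  simp only [charVec, if_true] at this
  split_ifs at this with h'
  · rw [h']
  · norm_num at this

open Classical in
/-- A feature is the restriction of a linear map. -/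
theorem IsFeature.exists_linearMap (hn : 2 ≤ n) {F : (ℕ → ℕ) → (ℕ → ℕ) → Prop}
    (hF : IsFeature n F) : ∃ L : (Arc n → ℝ) →ₗ[ℝ] ℝ, ∀ τ : Equiv.Perm (Fin n), IsPyramidalSB τ →
      L (charVec τ) = if F (tourArray τ) (tourArray τ.symm) then 1 else 0 := by
  have key : ∀ c : Arc n → ℝ, ∃ L : (Arc n → ℝ) →ₗ[ℝ] ℝ, ∀ v, L v = ∑ e, c e * v e := fun c =>
    ⟨{ toFun := fun v => ∑ e, c e * v e
       map_add' := fun v w => by simp [mul_add, Finset.sum_add_distrib]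
       map_smul' := fun a v => by
        simp only [Pi.smul_apply, smul_eq_mul, RingHom.id_apply, Finset.mul_sum]
        exact Finset.sum_congr rfl fun e _ => by ring }, fun v => rfl⟩
  obtain ⟨i, hi, A, rfl | rfl⟩ := hF
  · obtain ⟨L, hL⟩ := key fun e => if e.1.1 = ⟨i, hi⟩ ∧ A e.1.2 then 1 else 0
    refine ⟨L, fun τ hτ => ?_⟩
    -- A tour has a single arc out of `i`, so one term of the sum remains.
    rw [hL, Finset.sum_eq_single ⟨(⟨i, hi⟩, τ ⟨i, hi⟩), (hτ.apply_ne hn _).symm⟩]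
    · simp [charVec, tourArray_of_lt τ hi]
    · rintro ⟨⟨a, b⟩, hab⟩ _ hne
      by_cases ha : a = ⟨i, hi⟩
      · subst ha
        have : τ ⟨i, hi⟩ ≠ b := fun e => hne (by simp [e])
        simp [charVec, this]
      · simp [ha]
    · simp
  · obtain ⟨L, hL⟩ := key fun e => if e.1.2 = ⟨i, hi⟩ ∧ A e.1.1 then 1 else 0
    refine ⟨L, fun τ hτ => ?_⟩
    have hne' : τ.symm ⟨i, hi⟩ ≠ ⟨i, hi⟩ := fun e => hτ.apply_ne hn ⟨i, hi⟩ (by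
      conv_lhs => rw [← e]
      simp)
    rw [hL, Finset.sum_eq_single ⟨(τ.symm ⟨i, hi⟩, ⟨i, hi⟩), hne'⟩]
    · simp [charVec, tourArray_of_lt τ.symm hi]
    · rintro ⟨⟨a, b⟩, hab⟩ _ hne
      by_cases hb : b = ⟨i, hi⟩
      · subst hb
        have : τ a ≠ ⟨i, hi⟩ := fun e => hne (by simp [← e])
        simp [charVec, this]
      · simp [hb]
    · simp

/-- The difference of two indicator functionals vanishes at `x` and `y`, hence at the combination.
Being nonnegative at every tour of positive weight, it vanishes at each of them. -/
theorem isSupport_of_weights (hn : 2 ≤ n) {x y : Equiv.Perm (Fin n)} (hx : IsPyramidalSB x)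
    (hy : IsPyramidalSB y) {μ : Equiv.Perm (Fin n) → ℝ} (hμ : ∀ τ, 0 ≤ μ τ)
    (hp : ∀ τ, μ τ ≠ 0 → IsPyramidalSB τ) {a b : ℝ}
    (hs : ∑ τ, μ τ • charVec τ = a • charVec x + b • charVec y) :
    IsSupport n (tourArray x) (tourArray x.symm) (tourArray y) (tourArray y.symm)
      (fun z gz => ∃ τ, μ τ ≠ 0 ∧ z = tourArray τ ∧ gz = tourArray τ.symm) := by
  classical
  have tight : ∀ F G, IsFeature n F → IsFeature n G →
      (F (tourArray x) (tourArray x.symm) ↔ G (tourArray x) (tourArray x.symm)) →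
      (F (tourArray y) (tourArray y.symm) ↔ G (tourArray y) (tourArray y.symm)) →
      (∀ τ, μ τ ≠ 0 → F (tourArray τ) (tourArray τ.symm) → G (tourArray τ) (tourArray τ.symm)) →
      ∀ τ, μ τ ≠ 0 → G (tourArray τ) (tourArray τ.symm) → F (tourArray τ) (tourArray τ.symm) := by
    intro F G hF hG h1 h2 h3 τ hτ hGτ
    obtain ⟨L, hL⟩ := hF.exists_linearMap hn
    obtain ⟨L', hL'⟩ := hG.exists_linearMap hn
    have e := congrArg (L' - L) hs
    simp only [map_sum, map_add, map_smul, LinearMap.sub_apply, hL x hx, hL y hy, hL' x hx,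
      hL' y hy, h1, h2, sub_self, smul_zero, add_zero] at e
    have hnn : ∀ σ ∈ Finset.univ, 0 ≤ μ σ • (L' (charVec σ) - L (charVec σ)) := by
      intro σ _
      by_cases hσ : μ σ = 0
      · simp [hσ]
      · refine smul_nonneg (hμ σ) ?_
        rw [hL σ (hp σ hσ), hL' σ (hp σ hσ)]
        have := h3 σ hσ
        split_ifs <;> first | tauto | norm_num
    have := (Finset.sum_eq_zero_iff_of_nonneg hnn).1 e τ (Finset.mem_univ τ)
    rw [hL τ (hp τ hτ), hL' τ (hp τ hτ), if_pos hGτ, smul_eq_mul] at this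
    by_contra hFτ
    rw [if_neg hFτ] at this
    simp at this
    exact hτ this
  refine ⟨?_, ?_, ?_⟩
  · rintro _ _ ⟨τ, hτ, rfl, rfl⟩
    exact (hp τ hτ).isPSB hn
  · rintro _ _ ⟨τ, hτ, rfl, rfl⟩ i hi
    by_contra hcon
    rw [not_or] at hcon
    -- The feature of leaving `i` along an arc of neither tour is false at both ends, so tightness
    -- against the impossible feature excludes it.
    exact tight _ _ (IsFeature.true (by omega)).not
      (.out hi fun v => v ≠ tourArray x i ∧ v ≠ tourArray y i) (by simp) (by simp) (by simp) τ hτ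
      hcon trivial
  · rintro F G hF hG h1 h2 h3 _ _ ⟨τ, hτ, rfl, rfl⟩
    exact tight F G hF hG h1 h2 (fun σ hσ => h3 _ _ ⟨σ, hσ, rfl, rfl⟩) τ hτ

theorem perm_eq_of_tourArray {x y : Equiv.Perm (Fin n)}
    (h : ∀ i < n, tourArray x i = tourArray y i) :
    x = y := by
  ext i
  rw [← tourArray_val, ← tourArray_val, h i i.2]

/-- A tour of positive weight in `p` has positive weight in every point strictly between `p` and
`q`. If such a point lies in the segment, the tour is `x` or `y`, so `p` lies in the segment too. -/
theorem adj_of_support {x y : Equiv.Perm (Fin n)} (hn : 2 ≤ n) (hx : IsPyramidalSB x)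
    (hy : IsPyramidalSB y) {v w : (PSB n).extremePoints ℝ} (hv : charVec x = v)
    (hw : charVec y = w) (hxy : x ≠ y)
    (h : ∀ Z, IsSupport n (tourArray x) (tourArray x.symm) (tourArray y) (tourArray y.symm) Z →
      ∀ z gz, Z z gz → (∀ i < n, z i = tourArray x i) ∨ (∀ i < n, z i = tourArray y i)) :
    (oneSkeleton (PSB n)).Adj v w := by
  classical
  refine ⟨fun e => hxy (charVec_injOn hn hx (by rw [hv, hw, e])), ?_, ?_⟩
  · exact (convex_convexHull ℝ _).segment_subset v.2.1 w.2.1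
  · rintro p hp q hq m ⟨a, b, ha, hb, hab, rfl⟩ ⟨c, d, hc, hd, hcd, hm⟩
    obtain ⟨w₁, hw₁, s₁, p₁, rfl⟩ := exists_weights hp
    obtain ⟨w₂, hw₂, s₂, p₂, rfl⟩ := exists_weights hq
    have hsup := isSupport_of_weights hn hx hy (μ := fun τ => c * w₁ τ + d * w₂ τ) (a := a) (b := b)
      (fun τ => by
        have := mul_nonneg hc.le (hw₁ τ)
        have := mul_nonneg hd.le (hw₂ τ)
        positivity)
      (fun τ hτ => by
        by_contra hcon
        have e₁ : w₁ τ = 0 := by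
          by_contra h
          exact hcon (p₁ τ h)
        have e₂ : w₂ τ = 0 := by
          by_contra h
          exact hcon (p₂ τ h)
        simp [e₁, e₂] at hτ)
      (by
        rw [hv, hw, ← hm]
        simp only [add_smul, mul_smul, Finset.sum_add_distrib, Finset.smul_sum])
    have hmem : ∀ τ, w₁ τ ≠ 0 → charVec τ ∈ segment ℝ (v : Arc n → ℝ) w := by
      intro τ hτ
      have hpos : c * w₁ τ + d * w₂ τ ≠ 0 := by
        have := mul_pos hc (lt_of_le_of_ne (hw₁ τ) (Ne.symm hτ))
        have := mul_nonneg hd.le (hw₂ τ)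
        positivity
      rcases h _ hsup _ _ ⟨τ, hpos, rfl, rfl⟩ with h' | h'
      · rw [perm_eq_of_tourArray h', hv]
        exact left_mem_segment ℝ _ _
      · rw [perm_eq_of_tourArray h', hw]
        exact right_mem_segment ℝ _ _
    have e : ∑ τ, w₁ τ • charVec τ = ∑ τ ∈ Finset.univ.filter (fun τ => w₁ τ ≠ 0),
        w₁ τ • charVec τ := by
      rw [Finset.sum_filter]
      refine Finset.sum_congr rfl fun τ _ => ?_
      by_cases hτ : w₁ τ = 0 <;> simp [hτ]
    rw [e]
    refine (convex_segment _ _).sum_mem (fun τ _ => hw₁ τ) ?_ fun τ hτ =>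
      hmem τ (Finset.mem_filter.1 hτ).2
    rw [Finset.sum_filter_ne_zero, s₁]

/-- Where `z` departs from `x`, the coordinate of the arc of `x` forces `a ≤ 0`; where it departs
from `y`, likewise `b ≤ 0`. Both cannot happen with `a + b = 1`. -/
theorem charVec_eq_of_mem_segment (hn : 2 ≤ n) {x y z : Equiv.Perm (Fin n)} (hx : IsPyramidalSB x)
    (hy : IsPyramidalSB y) (h : charVec z ∈ segment ℝ (charVec x) (charVec y)) : z = x ∨ z = y := by
  by_contra hcon
  rw [not_or] at hcon
  obtain ⟨a, b, ha, hb, hab, e⟩ := h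
  have key : ∀ i, (if z i = x i then (1 : ℝ) else 0) = a + b * (if y i = x i then 1 else 0) ∧
      (if z i = y i then (1 : ℝ) else 0) = a * (if x i = y i then 1 else 0) + b := by
    intro i
    have e₁ := congrFun e ⟨(i, x i), (hx.apply_ne hn i).symm⟩
    have e₂ := congrFun e ⟨(i, y i), (hy.apply_ne hn i).symm⟩
    simp only [charVec, Pi.add_apply, Pi.smul_apply, smul_eq_mul, if_true, mul_one] at e₁ e₂
    exact ⟨e₁.symm, e₂.symm⟩
  obtain ⟨i, hi⟩ : ∃ i, z i ≠ x i := by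
    by_contra h
    push Not at h
    exact hcon.1 (Equiv.ext h)
  obtain ⟨j, hj⟩ : ∃ j, z j ≠ y j := by
    by_contra h
    push Not at h
    exact hcon.2 (Equiv.ext h)
  have k₁ := (key i).1
  have k₂ := (key j).2
  rw [if_neg hi] at k₁
  rw [if_neg hj] at k₂
  have : 0 ≤ b * (if y i = x i then (1 : ℝ) else 0) := by positivity
  have : 0 ≤ a * (if x j = y j then (1 : ℝ) else 0) := by positivity
  linarith

/-- The midpoint of `x` and `y` is the midpoint of `z` and `t`, so a face containing it contains
`z`. -/
theorem not_adj_of_complementary (hn : 2 ≤ n) {x y z t : Equiv.Perm (Fin n)}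
    (hx : IsPyramidalSB x) (hy : IsPyramidalSB y) (hz : IsPyramidalSB z) (ht : IsPyramidalSB t)
    {v w : (PSB n).extremePoints ℝ} (hv : charVec x = v) (hw : charVec y = w)
    (hzt : ∀ i, (z i = x i ∧ t i = y i) ∨ (z i = y i ∧ t i = x i)) (hzx : z ≠ x) (hzy : z ≠ y) :
    ¬ (oneSkeleton (PSB n)).Adj v w := by
  rintro ⟨-, h⟩
  rw [← hv, ← hw] at h
  have hsum : charVec x + charVec y = charVec z + charVec t := by
    funext e
    simp only [Pi.add_apply, charVec]
    rcases hzt e.1.1 with ⟨h₁, h₂⟩ | ⟨h₁, h₂⟩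
    · rw [h₁, h₂]
    · rw [h₁, h₂, add_comm]
  have := h.2 (subset_convexHull ℝ _ ⟨z, hz, rfl⟩) (subset_convexHull ℝ _ ⟨t, ht, rfl⟩)
    (x := charVec z) (y := charVec t) (z := (2⁻¹ : ℝ) • (charVec x + charVec y))
    ⟨2⁻¹, 2⁻¹, by norm_num, by norm_num, by norm_num, by rw [smul_add]⟩
    ⟨2⁻¹, 2⁻¹, by norm_num, by norm_num, by norm_num, by rw [hsum, smul_add]⟩
  rcases charVec_eq_of_mem_segment hn hx hy this with h | h
  · exact hzx h
  · exact hzy h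

/-- The adjacency criterion: `M` is the component of a city in which `x` and `y` differ. -/
theorem adj_iff_of_component (hn : 2 ≤ n) {x y : Equiv.Perm (Fin n)}
    (hx : IsPyramidalSB x) (hy : IsPyramidalSB y)
    {v w : (PSB n).extremePoints ℝ} (hv : charVec x = v) (hw : charVec y = w) {M : ℕ → Prop} {r : ℕ}
    (hr : r < n) (hrD : tourArray x r ≠ tourArray y r) (hrM : M r)
    (hM : Saturated n (tourArray x) (tourArray x.symm) (tourArray y) (tourArray y.symm) M)
    (hmin : ∀ N, Saturated n (tourArray x) (tourArray x.symm) (tourArray y) (tourArray y.symm) N →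
      N r → ∀ i < n, M i → N i) :
    (oneSkeleton (PSB n)).Adj v w ↔ ∀ i < n, tourArray x i ≠ tourArray y i → M i := by
  classical
  have hxp := hx.isPSB hn
  have hyp := hy.isPSB hn
  constructor
  · intro hadj i hi hiD
    by_contra hiM
    -- The exchange on `M` differs from `x` at `r` and from `y` at `i`; the exchange on the
    -- complement of `M` is its complementary tour.
    have hz := hM.isPSB_mix hxp hyp
    have ht := hM.not.isPSB_mix hxp hyp
    have hzv : ∀ j (hj : j < n), tourArray hz.toPerm j =
        if M j then tourArray y j else tourArray x j := fun j hj => hz.tourArray_toPerm hj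
    have htv : ∀ j (hj : j < n), tourArray ht.toPerm j =
        if ¬ M j then tourArray y j else tourArray x j := fun j hj =>
      (ht.tourArray_toPerm hj).trans (by congr)
    refine not_adj_of_complementary hn hx hy hz.isPyramidalSB_toPerm ht.isPyramidalSB_toPerm hv hw
      (fun j => ?_) (fun e => ?_) (fun e => ?_) hadj
    · have e₁ := hzv j j.2
      have e₂ := htv j j.2
      simp only [tourArray_val] at e₁ e₂
      by_cases hj : M j
      · simp only [hj, if_true, not_true, if_false] at e₁ e₂
        exact Or.inr ⟨Fin.ext e₁, Fin.ext e₂⟩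
      · simp only [hj, if_false, not_false_iff, if_true] at e₁ e₂
        exact Or.inl ⟨Fin.ext e₁, Fin.ext e₂⟩
    · have := hzv r hr
      rw [e, if_pos hrM] at this
      exact hrD this
    · have := hzv i hi
      rw [e, if_neg hiM] at this
      exact hiD this.symm
  · intro hD
    refine adj_of_support hn hx hy hv hw (fun e => hrD (by rw [e])) fun Z hZ z gz hz => ?_
    have hs := hZ.saturated hxp hyp hz
    have hm := hZ.mix z gz hz
    -- Minimality of `M` is applied to the set where `z` agrees with `x`, or to its complement,
    -- whichever contains `r`.
    by_cases hzr : z r = tourArray x r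
    · refine Or.inl fun i hi => ?_
      by_cases hiD : tourArray x i = tourArray y i
      · rcases hm i hi with e | e
        · exact e
        · rw [e, hiD]
      · exact hmin _ hs hzr i hi (hD i hi hiD)
    · refine Or.inr fun i hi => ?_
      rcases hm i hi with e | e
      · by_cases hiD : tourArray x i = tourArray y i
        · rw [e, hiD]
        · exact (hmin _ hs.not hzr i hi (hD i hi hiD) e).elim
      · exact e

end PyramidalTour

namespace PyramidalTour

/-! ### The program for the adjacency test -/

/-- The expression with the value `e + 1`, if `e` is less than the register `0`. -/
def Expr.succ (e : Expr) : Expr := .sub (.reg 0) (.sub (.sub (.reg 0) (.const 1)) e)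

section Conditions

variable (a b : ℕ) (i : Expr)

/-- Exactly one of the arrays has an entry less than `i - 1` at `i`. -/
def longCond : Cond :=
  .xor (.lt (.load a i) (.sub i (.const 1))) (.lt (.load b i) (.sub i (.const 1)))

/-- Exactly one of the arrays has the entry `i - 1` at `i`. -/
def shortCond : Cond :=
  .xor (.eq (.load a i) (.sub i (.const 1))) (.eq (.load b i) (.sub i (.const 1)))

/-- Exactly one of the arrays has an entry greater than `i` at `i - 1`. -/
def upCond : Cond :=
  .xor (.lt i (.load a (.sub i (.const 1)))) (.lt i (.load b (.sub i (.const 1))))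

/-- The condition of `Saturated.in_out`. -/
def inOutCond : Cond :=
  .and (.and (.lt (.const 0) i) (.lt i (.sub (.reg 0) (.const 1))))
    (.and (.or (longCond 2 3 i) (shortCond 2 3 i)) (.or (longCond a b i) (shortCond a b i)))

/-- The condition of `Saturated.out_out`. -/
def outOutCond : Cond :=
  .and (.and (.lt (.const 1) i) (.lt i (.sub (.reg 0) (.const 1))))
    (.and (shortCond a b i) (upCond a b i))

/-- The condition of `Saturated.in_out_low`. -/
def inOutLowCond : Cond :=
  .and (.and (.lt (.const 1) i) (.lt i (.sub (.reg 0) (.const 1))))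
    (.and (longCond 2 3 i) (upCond a b i))

/-- The condition of `Saturated.in_in`. -/
def inInCond : Cond :=
  .and (.and (.lt (.const 1) i) (.lt i (.sub (.reg 0) (.const 1))))
    (.and (shortCond 2 3 i) (upCond 2 3 i))

/-- The condition of `Saturated.out_in_low`. -/
def outInLowCond : Cond :=
  .and (.and (.lt (.const 1) i) (.lt i (.sub (.reg 0) (.const 1))))
    (.and (longCond a b i) (upCond 2 3 i))

end Conditions

/-- The neighbours of the city in register `6` in the graph of `Saturated`, if the arrays `a` and
`b` hold the successor maps and the arrays `2` and `3` the predecessor maps of two tours. -/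
def neighbours (a b : ℕ) : List Expr :=
  let u : Expr := .reg 6
  let x : Expr := .load a u
  [.load 3 x, .load 2 (.load b u),
    (inOutCond a b x).ite x u,
    (inOutCond a b u).ite (.load 2 u) u,
    (outOutCond a b u).ite (.sub u (.const 1)) u,
    (outOutCond a b u.succ).ite u.succ u,
    (inOutLowCond a b x).ite (.sub x (.const 1)) u,
    (inOutLowCond a b u.succ).ite (.load 2 u.succ) u,
    (inInCond x).ite (.load 2 (.sub x (.const 1))) u,
    (inInCond x.succ).ite (.load 2 x.succ) u,
    (outInLowCond a b u).ite (.load 2 (.sub u (.const 1))) u,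
    (outInLowCond a b x.succ).ite x.succ u]

theorem neighbours_wf (a b : ℕ) : ∀ e ∈ neighbours a b, e.wf = true := by
  intro e he
  simp only [neighbours, List.mem_cons, List.not_mem_nil, or_false] at he
  rcases he with rfl | rfl | rfl | rfl | rfl | rfl | rfl | rfl | rfl | rfl | rfl | rfl <;> rfl

/-- The expression reads only the registers `0` and `6` and the arrays `a`, `b`, `2` and `3`. -/
def Expr.Reads (a b : ℕ) : Expr → Prop
  | reg r => r = 0 ∨ r = 6
  | const _ => True
  | sub c d => c.Reads a b ∧ d.Reads a b
  | load c e => (c = a ∨ c = b ∨ c = 2 ∨ c = 3) ∧ e.Reads a b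
  | ifLe c d e f => c.Reads a b ∧ d.Reads a b ∧ e.Reads a b ∧ f.Reads a b

theorem Expr.Reads.eval_congr {a b : ℕ} {e : Expr} (he : e.Reads a b) {s s' : Mem}
    (h0 : s.reg 0 = s'.reg 0) (h6 : s.reg 6 = s'.reg 6) (ha : s.arr a = s'.arr a)
    (hb : s.arr b = s'.arr b) (h2 : s.arr 2 = s'.arr 2) (h3 : s.arr 3 = s'.arr 3) :
    e.eval s = e.eval s' := by
  induction e with
  | reg r => rcases he with rfl | rfl <;> assumption
  | const k => rfl
  | sub c d ihc ihd => simp only [eval, ihc he.1, ihd he.2]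
  | load c e ih =>
    simp only [eval, ih he.2]
    rcases he.1 with rfl | rfl | rfl | rfl
    exacts [by rw [ha], by rw [hb], by rw [h2], by rw [h3]]
  | ifLe c d e f ihc ihd ihe ihf =>
    simp only [eval, ihc he.1, ihd he.2.1, ihe he.2.2.1, ihf he.2.2.2]

/-- While a city is processed, the search changes neither these registers nor any array except `6`
and `7`, so its neighbours stay fixed. -/
theorem neighbours_reads (a b : ℕ) : ∀ e ∈ neighbours a b, e.Reads a b := by
  intro e he
  simp only [neighbours, List.mem_cons, List.not_mem_nil, or_false] at he
  rcases he with rfl | rfl | rfl | rfl | rfl | rfl | rfl | rfl | rfl | rfl | rfl | rfl <;>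
    simp [Expr.Reads, Cond.ite, inOutCond, outOutCond, inOutLowCond, inInCond, outInLowCond,
      longCond, shortCond, upCond, Expr.succ]

/-- The memory that the neighbours are computed from. -/
def graphMem (n : ℕ) (arr : ℕ → ℕ → ℕ) (u : ℕ) : Mem where
  reg r := if r = 0 then n else u
  arr := arr

/-! ### The graph on the cities and its neighbour lists -/

section Graph

variable {n : ℕ} {arr : ℕ → ℕ → ℕ} {a b : ℕ}

/-- Expressions have no addition, so the increment is `n - ((n - 1) - e)`. It is exact only below
`n`, but it never exceeds `n`. -/
theorem eval_succ (s : Mem) (e : Expr) (h : e.eval s < s.reg 0) :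
    e.succ.eval s = e.eval s + 1 := by
  simp only [Expr.succ, Expr.eval]
  omega

/-- The neighbours of the city `u`. -/
def IsNeighbour (n : ℕ) (arr : ℕ → ℕ → ℕ) (a b u v : ℕ) : Prop :=
  ∃ e ∈ neighbours a b, e.eval (graphMem n arr u) = v

open Classical in
theorem isNeighbour_iff (hx : IsPSB n (arr a) (arr 2)) {u v : ℕ} (hu : u < n) :
    IsNeighbour n arr a b u v ↔
      arr 3 (arr a u) = v ∨ arr 2 (arr b u) = v ∨
      (if (inOutCond a b (.const (arr a u))).Holds (graphMem n arr u) then arr a u else u) = v ∨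
      (if (inOutCond a b (.const u)).Holds (graphMem n arr u) then arr 2 u else u) = v ∨
      (if (outOutCond a b (.const u)).Holds (graphMem n arr u) then u - 1 else u) = v ∨
      (if (outOutCond a b (.const (u + 1))).Holds (graphMem n arr u) then u + 1 else u) = v ∨
      (if (inOutLowCond a b (.const (arr a u))).Holds (graphMem n arr u) then arr a u - 1
        else u) = v ∨
      (if (inOutLowCond a b (.const (u + 1))).Holds (graphMem n arr u) then arr 2 (u + 1)
        else u) = v ∨
      (if (inInCond (.const (arr a u))).Holds (graphMem n arr u) then arr 2 (arr a u - 1)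
        else u) = v ∨
      (if (inInCond (.const (arr a u + 1))).Holds (graphMem n arr u) then arr 2 (arr a u + 1)
        else u) = v ∨
      (if (outInLowCond a b (.const u)).Holds (graphMem n arr u) then arr 2 (u - 1) else u) = v ∨
      (if (outInLowCond a b (.const (arr a u + 1))).Holds (graphMem n arr u) then arr a u + 1
        else u) = v := by
  have h1 : (Expr.succ (.reg 6)).eval (graphMem n arr u) = u + 1 :=
    eval_succ _ _ hu
  have h2 : (Expr.succ (.load a (.reg 6))).eval (graphMem n arr u) = arr a u + 1 :=
    eval_succ _ _ (hx.f_lt u hu)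
  -- A condition depends on its argument only through the value, so the value may be put in as a
  -- constant.
  have h3 : ∀ e : Expr, (outOutCond a b e).Holds (graphMem n arr u) ↔
      (outOutCond a b (.const (e.eval (graphMem n arr u)))).Holds (graphMem n arr u) :=
    fun e => Iff.rfl
  have h4 : ∀ e : Expr, (inOutLowCond a b e).Holds (graphMem n arr u) ↔
      (inOutLowCond a b (.const (e.eval (graphMem n arr u)))).Holds (graphMem n arr u) :=
    fun e => Iff.rfl
  have h5 : ∀ e : Expr, (inInCond e).Holds (graphMem n arr u) ↔
      (inInCond (.const (e.eval (graphMem n arr u)))).Holds (graphMem n arr u) :=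
    fun e => Iff.rfl
  have h6 : ∀ e : Expr, (outInLowCond a b e).Holds (graphMem n arr u) ↔
      (outInLowCond a b (.const (e.eval (graphMem n arr u)))).Holds (graphMem n arr u) :=
    fun e => Iff.rfl
  have e1 := h3 (Expr.succ (.reg 6))
  have e2 := h4 (Expr.succ (.reg 6))
  have e3 := h5 (Expr.succ (.load a (.reg 6)))
  have e4 := h6 (Expr.succ (.load a (.reg 6)))
  rw [h1] at e1 e2
  rw [h2] at e3 e4
  simp only [IsNeighbour, neighbours, List.mem_cons, List.not_mem_nil, or_false,
    exists_eq_or_imp, exists_eq_left, Cond.eval_ite, e1, e2, e3, e4]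
  simp only [Expr.eval, h1, h2]
  rfl

open Classical in
theorem inOutCond_holds {i u : ℕ} :
    (inOutCond a b (.const i)).Holds (graphMem n arr u) ↔ ∃ j, i = j + 1 ∧ j + 2 < n ∧
      (¬ (arr 2 (j + 1) < j ↔ arr 3 (j + 1) < j) ∨ ¬ (arr 2 (j + 1) = j ↔ arr 3 (j + 1) = j)) ∧
      (¬ (arr a (j + 1) < j ↔ arr b (j + 1) < j) ∨ ¬ (arr a (j + 1) = j ↔ arr b (j + 1) = j)) := by
  rcases i with _ | j
  · simp [inOutCond, Cond.Holds, Expr.eval]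
  · simp [inOutCond, longCond, shortCond, Cond.Holds, Expr.eval, graphMem, Nat.lt_sub_iff_add_lt]

theorem outOutCond_holds {i u : ℕ} :
    (outOutCond a b (.const i)).Holds (graphMem n arr u) ↔ ∃ j, i = j + 1 ∧ j + 2 < n ∧ j ≠ 0 ∧
      ¬ (arr a (j + 1) = j ↔ arr b (j + 1) = j) ∧ ¬ (j + 1 < arr a j ↔ j + 1 < arr b j) := by
  rcases i with _ | j
  · simp [outOutCond, Cond.Holds, Expr.eval]
  · simp [outOutCond, upCond, shortCond, Cond.Holds, Expr.eval, graphMem, Nat.lt_sub_iff_add_lt,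
      Nat.pos_iff_ne_zero, and_comm, and_assoc, and_left_comm]

theorem inOutLowCond_holds {i u : ℕ} :
    (inOutLowCond a b (.const i)).Holds (graphMem n arr u) ↔ ∃ j, i = j + 1 ∧ j + 2 < n ∧ j ≠ 0 ∧
      ¬ (arr 2 (j + 1) < j ↔ arr 3 (j + 1) < j) ∧ ¬ (j + 1 < arr a j ↔ j + 1 < arr b j) := by
  rcases i with _ | j
  · simp [inOutLowCond, Cond.Holds, Expr.eval]
  · simp [inOutLowCond, upCond, longCond, Cond.Holds, Expr.eval, graphMem, Nat.lt_sub_iff_add_lt,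
      Nat.pos_iff_ne_zero, and_assoc, and_left_comm]

theorem inInCond_holds {i u : ℕ} :
    (inInCond (.const i)).Holds (graphMem n arr u) ↔ ∃ j, i = j + 1 ∧ j + 2 < n ∧ j ≠ 0 ∧
      ¬ (arr 2 (j + 1) = j ↔ arr 3 (j + 1) = j) ∧ ¬ (j + 1 < arr 2 j ↔ j + 1 < arr 3 j) := by
  rcases i with _ | j
  · simp [inInCond, Cond.Holds, Expr.eval]
  · simp [inInCond, upCond, shortCond, Cond.Holds, Expr.eval, graphMem, Nat.lt_sub_iff_add_lt,
      Nat.pos_iff_ne_zero, and_assoc, and_left_comm]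

theorem outInLowCond_holds {i u : ℕ} :
    (outInLowCond a b (.const i)).Holds (graphMem n arr u) ↔ ∃ j, i = j + 1 ∧ j + 2 < n ∧ j ≠ 0 ∧
      ¬ (arr a (j + 1) < j ↔ arr b (j + 1) < j) ∧ ¬ (j + 1 < arr 2 j ↔ j + 1 < arr 3 j) := by
  rcases i with _ | j
  · simp [outInLowCond, Cond.Holds, Expr.eval]
  · simp [outInLowCond, upCond, longCond, Cond.Holds, Expr.eval, graphMem, Nat.lt_sub_iff_add_lt,
      Nat.pos_iff_ne_zero, and_assoc, and_left_comm]

/-- Each entry of the list is the other end of an edge, or `u` itself if the condition for the edge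
fails. -/
theorem Saturated.of_isNeighbour {M : ℕ → Prop} (hM : Saturated n (arr a) (arr 2) (arr b) (arr 3) M)
    (hx : IsPSB n (arr a) (arr 2)) (hy : IsPSB n (arr b) (arr 3)) {u v : ℕ} (hu : u < n)
    (huv : IsNeighbour n arr a b u v) : v < n ∧ (M u → M v) := by
  have hxu := hx.f_lt u hu
  have hyu := hy.f_lt u hu
  rw [isNeighbour_iff hx hu, inOutCond_holds, inOutCond_holds, outOutCond_holds, outOutCond_holds,
    inOutLowCond_holds, inOutLowCond_holds, inInCond_holds, inInCond_holds, outInLowCond_holds,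
    outInLowCond_holds] at huv
  have hgu := hx.gf u hu
  rcases huv with huv | huv | huv | huv | huv | huv | huv | huv | huv | huv | huv | huv
  · subst huv
    exact ⟨hy.g_lt _ hxu, (hM.alternate u hu).2⟩
  · subst huv
    have := hM.alternate _ (hx.g_lt _ hyu)
    rw [hx.fg _ hyu, hy.gf u hu] at this
    exact ⟨hx.g_lt _ hyu, this.1⟩
  all_goals
    split_ifs at huv with hc
    swap
    · subst huv
      exact ⟨hu, id⟩
    obtain ⟨j, hj, hjn, hc⟩ := hc
    try rw [hj] at huv hxu hgu
    subst huv
  · have := hM.in_out j hjn hc.1 hc.2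
    rw [hgu] at this
    exact ⟨hxu, this.1⟩
  · rw [hj]
    exact ⟨hx.g_lt _ (by omega), (hM.in_out j hjn hc.1 hc.2).2⟩
  · rw [hj]
    exact ⟨by omega, (hM.out_out j hjn hc.1 hc.2.1 hc.2.2).1⟩
  · obtain rfl : u = j := by omega
    exact ⟨by omega, (hM.out_out u hjn hc.1 hc.2.1 hc.2.2).2⟩
  · have := hM.in_out_low j hjn hc.1 hc.2.1 hc.2.2
    rw [hgu] at this
    exact ⟨by omega, this.1⟩
  · obtain rfl : u = j := by omega
    exact ⟨hx.g_lt _ (by omega), (hM.in_out_low u hjn hc.1 hc.2.1 hc.2.2).2⟩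
  · have := hM.in_in j hjn hc.1 hc.2.1 hc.2.2
    rw [hgu] at this
    exact ⟨hx.g_lt _ (by omega), this.1⟩
  · have hj' : arr a u = j := by omega
    have := hM.in_in j hjn hc.1 hc.2.1 hc.2.2
    rw [← hj', hgu] at this
    exact ⟨hx.g_lt _ (by omega), this.2⟩
  · rw [hj]
    exact ⟨hx.g_lt _ (by omega), (hM.out_in_low j hjn hc.1 hc.2.1 hc.2.2).1⟩
  · have hj' : arr a u = j := by omega
    have := hM.out_in_low j hjn hc.1 hc.2.1 hc.2.2
    rw [← hj', hgu] at this
    exact ⟨by omega, this.2⟩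

/-- Every edge is listed at both of its ends, which gives the two directions of each equivalence. -/
theorem saturated_of_closed {M : ℕ → Prop} (hx : IsPSB n (arr a) (arr 2))
    (hy : IsPSB n (arr b) (arr 3))
    (hM : ∀ u < n, M u → ∀ v, IsNeighbour n arr a b u v → M v) :
    Saturated n (arr a) (arr 2) (arr b) (arr 3) M := by
  have key := fun u (hu : u < n) (hMu : M u) v h =>
    hM u hu hMu v ((isNeighbour_iff hx hu).2 h)
  refine ⟨fun v hv => ⟨fun h => ?_, fun h => ?_⟩, fun j hj h1 h2 => ⟨fun h => ?_, fun h => ?_⟩,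
    fun j hj h0 h1 h2 => ⟨fun h => ?_, fun h => ?_⟩,
    fun j hj h0 h1 h2 => ⟨fun h => ?_, fun h => ?_⟩,
    fun j hj h0 h1 h2 => ⟨fun h => ?_, fun h => ?_⟩,
    fun j hj h0 h1 h2 => ⟨fun h => ?_, fun h => ?_⟩⟩
  · refine key _ (hy.g_lt _ (hx.f_lt v hv)) h v (Or.inr (Or.inl ?_))
    rw [hy.fg _ (hx.f_lt v hv), hx.gf v hv]
  · exact key _ hv h _ (Or.inl rfl)
  · refine key _ (hx.g_lt _ (by omega)) h _ (Or.inr (Or.inr (Or.inl ?_)))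
    rw [hx.fg _ (by omega), if_pos (inOutCond_holds.2 ⟨j, rfl, hj, h1, h2⟩)]
  · refine key _ (by omega) h _ (Or.inr (Or.inr (Or.inr (Or.inl ?_))))
    rw [if_pos (inOutCond_holds.2 ⟨j, rfl, hj, h1, h2⟩)]
  · refine key _ (by omega) h _ (Or.inr (Or.inr (Or.inr (Or.inr (Or.inl ?_)))))
    rw [if_pos (outOutCond_holds.2 ⟨j, rfl, hj, h0, h1, h2⟩),
      Nat.add_sub_cancel]
  · refine key _ (by omega) h _ (Or.inr (Or.inr (Or.inr (Or.inr (Or.inr (Or.inl ?_))))))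
    rw [if_pos (outOutCond_holds.2 ⟨j, rfl, hj, h0, h1, h2⟩)]
  · refine key _ (hx.g_lt _ (by omega)) h _
      (Or.inr (Or.inr (Or.inr (Or.inr (Or.inr (Or.inr (Or.inl ?_)))))))
    rw [hx.fg _ (by omega), if_pos (inOutLowCond_holds.2 ⟨j, rfl, hj, h0, h1, h2⟩),
      Nat.add_sub_cancel]
  · refine key _ (by omega) h _
      (Or.inr (Or.inr (Or.inr (Or.inr (Or.inr (Or.inr (Or.inr (Or.inl ?_))))))))
    rw [if_pos (inOutLowCond_holds.2 ⟨j, rfl, hj, h0, h1, h2⟩)]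
  · refine key _ (hx.g_lt _ (by omega)) h _
      (Or.inr (Or.inr (Or.inr (Or.inr (Or.inr (Or.inr (Or.inr (Or.inr (Or.inl ?_)))))))))
    rw [hx.fg _ (by omega), if_pos (inInCond_holds.2 ⟨j, rfl, hj, h0, h1, h2⟩),
      Nat.add_sub_cancel]
  · refine key _ (hx.g_lt _ (by omega)) h _
      (Or.inr (Or.inr (Or.inr (Or.inr (Or.inr (Or.inr (Or.inr (Or.inr (Or.inr (Or.inl ?_))))))))))
    rw [hx.fg _ (by omega), if_pos (inInCond_holds.2 ⟨j, rfl, hj, h0, h1, h2⟩)]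
  · refine key _ (by omega) h _
      (Or.inr (Or.inr (Or.inr (Or.inr (Or.inr (Or.inr (Or.inr (Or.inr (Or.inr (Or.inr
        (Or.inl ?_)))))))))))
    rw [if_pos (outInLowCond_holds.2 ⟨j, rfl, hj, h0, h1, h2⟩),
      Nat.add_sub_cancel]
  · refine key _ (hx.g_lt _ (by omega)) h _
      (Or.inr (Or.inr (Or.inr (Or.inr (Or.inr (Or.inr (Or.inr (Or.inr (Or.inr (Or.inr
        (Or.inr ?_)))))))))))
    rw [hx.fg _ (by omega), if_pos (outInLowCond_holds.2 ⟨j, rfl, hj, h0, h1, h2⟩)]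

end Graph

end PyramidalTour

/-! ### Breadth-first search of a component -/

namespace PyramidalTour

/-- Visit the city with the value of the expression `e`: unless it is marked in the array `6`,
mark it and append it to the queue in the array `7`, which ends at the register `5`. -/
def visit (e : Expr) : Stmt :=
  .seq (.set 7 e)
    (.ifLe (.load 6 (.reg 7)) (.const 0)
      (.seq (.store 6 (.reg 7) (.const 1))
        (.seq (.store 7 (.reg 5) (.reg 7)) (.set 5 (Expr.succ (.reg 5)))))
      .skip)

/-- Visit the cities in a list one after another. -/
def visitAll : List Expr → Stmt
  | [] => .skip
  | e :: l => .seq (visit e) (visitAll l)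

theorem visitAll_wf {l : List Expr} (h : ∀ e ∈ l, e.wf = true) : (visitAll l).wf = true := by
  induction l with
  | nil => rfl
  | cons e l ih =>
    have h1 := h e (by simp)
    have h2 := ih fun e he => h e (by simp [he])
    simp [visitAll, visit, Stmt.wf, Expr.wf, Expr.succ, h1, h2]

/-- Take the city at the head of the queue and visit its neighbours. -/
def searchStep (a b : ℕ) : Stmt :=
  .seq (.set 6 (.load 7 (.reg 4)))
    (.seq (.set 4 (Expr.succ (.reg 4))) (visitAll (neighbours a b)))

theorem searchStep_wf (a b : ℕ) : (searchStep a b).wf = true := by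
  simp [searchStep, Stmt.wf, Expr.wf, Expr.succ, visitAll_wf (neighbours_wf a b)]

/-- The memory during the search of the component of `r`; the arrays other than the marks and the
queue are those of `A`. -/
structure Search (n : ℕ) (A : ℕ → ℕ → ℕ) (a b r q : ℕ) (s : Mem) : Prop where
  reg_zero : s.reg 0 = n
  reg_three : s.reg 3 = q
  arr_eq : ∀ c, c ≠ 6 → c ≠ 7 → s.arr c = A c
  queue : ∀ k < s.reg 5, s.arr 7 k < n ∧ s.arr 6 (s.arr 7 k) = 1
  queue_inj : ∀ k < s.reg 5, ∀ l < s.reg 5, s.arr 7 k = s.arr 7 l → k = l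
  marked : ∀ v < n, s.arr 6 v ≠ 0 → ∃ k < s.reg 5, s.arr 7 k = v
  root : s.arr 6 r = 1
  minimal : ∀ N : ℕ → Prop, (∀ u < n, N u → ∀ v, IsNeighbour n A a b u v → N v) → N r →
    ∀ v < n, s.arr 6 v = 1 → N v

/-- The search went on from `s` to `s'` without a change of the current city. -/
structure SearchLe (s s' : Mem) : Prop where
  reg_four : s'.reg 4 = s.reg 4
  reg_six : s'.reg 6 = s.reg 6
  reg_five : s.reg 5 ≤ s'.reg 5
  queue : ∀ k < s.reg 5, s'.arr 7 k = s.arr 7 k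
  marked : ∀ v, s.arr 6 v = 1 → s'.arr 6 v = 1

namespace Search

variable {n a b r q : ℕ} {A : ℕ → ℕ → ℕ} {s : Mem}

theorem tail_le (h : Search n A a b r q s) : s.reg 5 ≤ n := by
  have := Finset.card_le_card_of_injOn (s := Finset.range (s.reg 5)) (t := Finset.range n)
    (s.arr 7) (fun k hk => by simpa using (h.queue k (by simpa using hk)).1)
    (fun k hk l hl hkl => h.queue_inj k (by simpa using hk) l (by simpa using hl) hkl)
  simpa using this

/-- Cities in the queue are marked and distinct, so an unmarked city leaves room. This also keeps
the increment of the end of the queue exact. -/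
theorem tail_lt (h : Search n A a b r q s) {v : ℕ} (hv : v < n) (hm : s.arr 6 v = 0) :
    s.reg 5 < n := by
  refine lt_of_le_of_ne h.tail_le fun he => ?_
  have := Finset.surj_on_of_inj_on_of_card_le (s := Finset.range (s.reg 5)) (t := Finset.range n)
    (fun k _ => s.arr 7 k) (fun k hk => by simpa using (h.queue k (by simpa using hk)).1)
    (fun k l hk hl hkl => h.queue_inj k (by simpa using hk) l (by simpa using hl) hkl)
    (by simp [he]) v (by simpa using hv)
  obtain ⟨k, hk, rfl⟩ := this
  have := (h.queue k (by simpa using hk)).2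
  omega

theorem eval_eq (h : Search n A a b r q s) (ha : a ≠ 6 ∧ a ≠ 7) (hb : b ≠ 6 ∧ b ≠ 7) {e : Expr}
    (he : e ∈ neighbours a b) : e.eval s = e.eval (graphMem n A (s.reg 6)) :=
  (neighbours_reads a b e he).eval_congr h.reg_zero rfl (h.arr_eq a ha.1 ha.2)
    (h.arr_eq b hb.1 hb.2) (h.arr_eq 2 (by decide) (by decide)) (h.arr_eq 3 (by decide) (by decide))

theorem visit (h : Search n A a b r q s) (ha : a ≠ 6 ∧ a ≠ 7) (hb : b ≠ 6 ∧ b ≠ 7) {e : Expr}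
    (he : e ∈ neighbours a b) (hu : s.reg 6 < n) (hm : s.arr 6 (s.reg 6) = 1)
    (hv : e.eval s < n) :
    Search n A a b r q ((visit e).den s) ∧ SearchLe s ((PyramidalTour.visit e).den s) ∧
      ((PyramidalTour.visit e).den s).arr 6 (e.eval s) = 1 := by
  have hev : IsNeighbour n A a b (s.reg 6) (e.eval s) := ⟨e, he, (h.eval_eq ha hb he).symm⟩
  set v := e.eval s with hv'
  by_cases h0 : s.arr 6 v = 0
  · have htl := h.tail_lt hv h0
    set s' := (PyramidalTour.visit e).den s with hs'
    have hden : s' = (((s.setReg 7 v).setArr 6 v 1).setArr 7 (s.reg 5) v).setReg 5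
        (s.reg 5 + 1) := by
      rw [hs']
      simp only [PyramidalTour.visit, Stmt.den, ← hv']
      rw [if_pos (by simpa [Expr.eval, Mem.setReg] using h0)]
      rw [eval_succ _ _ (by simpa [Expr.eval, Mem.setReg, Mem.setArr, h.reg_zero] using htl)]
      simp [Expr.eval, Mem.setReg, Mem.setArr]
    clear_value s'
    have hr : ∀ i, i ≠ 5 → i ≠ 7 → s'.reg i = s.reg i := fun i h5 h7 => by
      simp [hden, Mem.setReg, Mem.setArr, h5, h7]
    have h5 : s'.reg 5 = s.reg 5 + 1 := by simp [hden, Mem.setReg, Mem.setArr]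
    have h6 : ∀ i, s'.arr 6 i = if i = v then 1 else s.arr 6 i := fun i => by
      simp [hden, Mem.setReg, Mem.setArr, Function.update_apply]
    have h7 : ∀ i, s'.arr 7 i = if i = s.reg 5 then v else s.arr 7 i := fun i => by
      simp [hden, Mem.setReg, Mem.setArr, Function.update_apply]
    have h7' : ∀ k < s.reg 5, s'.arr 7 k = s.arr 7 k := fun k hk => by rw [h7, if_neg hk.ne]
    have h6' : ∀ i, s.arr 6 i = 1 → s'.arr 6 i = 1 := fun i hi => by
      rw [h6]; split_ifs <;> simp [hi]
    have hnew : ∀ k < s.reg 5, s.arr 7 k ≠ v := fun k hk he => by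
      have := (h.queue k hk).2
      rw [he] at this
      omega
    refine ⟨⟨(hr 0 (by decide) (by decide)).trans h.reg_zero,
      (hr 3 (by decide) (by decide)).trans h.reg_three, fun c hc6 hc7 => ?_, fun k hk => ?_,
      fun k hk l hl hkl => ?_, fun i hi hmi => ?_, h6' r h.root, fun N hN hNr i hi hmi => ?_⟩,
      ⟨hr 4 (by decide) (by decide), hr 6 (by decide) (by decide), by omega, h7', h6'⟩, ?_⟩
    · rw [← h.arr_eq c hc6 hc7]
      simp [hden, Mem.setReg, Mem.setArr, hc6, hc7]
    · rcases Nat.lt_succ_iff_lt_or_eq.1 (h5 ▸ hk) with hk | rfl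
      · rw [h7' k hk]
        exact ⟨(h.queue k hk).1, h6' _ (h.queue k hk).2⟩
      · rw [h7, if_pos rfl, h6, if_pos rfl]
        exact ⟨hv, rfl⟩
    · rcases Nat.lt_succ_iff_lt_or_eq.1 (h5 ▸ hk) with hk | rfl <;>
        rcases Nat.lt_succ_iff_lt_or_eq.1 (h5 ▸ hl) with hl | rfl
      · rw [h7' k hk, h7' l hl] at hkl
        exact h.queue_inj k hk l hl hkl
      · rw [h7' k hk, h7, if_pos rfl] at hkl
        exact absurd hkl (hnew k hk)
      · rw [h7' l hl, h7, if_pos rfl] at hkl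
        exact absurd hkl.symm (hnew l hl)
      · rfl
    · by_cases hiv : i = v
      · exact ⟨s.reg 5, by omega, by rw [h7, if_pos rfl, hiv]⟩
      · rw [h6, if_neg hiv] at hmi
        obtain ⟨k, hk, rfl⟩ := h.marked i hi hmi
        exact ⟨k, by omega, h7' k hk⟩
    · by_cases hiv : i = v
      · exact hiv ▸ hN _ hu (h.minimal N hN hNr _ hu hm) v hev
      · rw [h6, if_neg hiv] at hmi
        exact h.minimal N hN hNr i hi hmi
    · rw [h6, if_pos rfl]
  · set s' := (PyramidalTour.visit e).den s with hs'
    have hden : s' = s.setReg 7 v := by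
      rw [hs']
      simp only [PyramidalTour.visit, Stmt.den, ← hv']
      rw [if_neg (by simpa [Expr.eval, Mem.setReg] using h0)]
    clear_value s'
    have hr : ∀ i, i ≠ 7 → s'.reg i = s.reg i := fun i h7 => by simp [hden, Mem.setReg, h7]
    have hA : s'.arr = s.arr := by simp [hden, Mem.setReg]
    obtain ⟨k, hk, hkv⟩ := h.marked v hv h0
    have h1 : s.arr 6 v = 1 := hkv ▸ (h.queue k hk).2
    refine ⟨⟨?_, ?_, ?_, ?_, ?_, ?_, ?_, ?_⟩, ⟨hr 4 (by decide), hr 6 (by decide),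
      (hr 5 (by decide)).ge, ?_, ?_⟩, ?_⟩
    · exact (hr 0 (by decide)).trans h.reg_zero
    · exact (hr 3 (by decide)).trans h.reg_three
    · exact hA ▸ h.arr_eq
    · rw [hA, hr 5 (by decide)]; exact h.queue
    · rw [hA, hr 5 (by decide)]; exact h.queue_inj
    · rw [hA, hr 5 (by decide)]; exact h.marked
    · rw [hA]; exact h.root
    · rw [hA]; exact h.minimal
    · rw [hA]; exact fun _ _ => rfl
    · rw [hA]; exact fun _ => id
    · rw [hA]; exact h1

end Search

theorem SearchLe.refl (s : Mem) : SearchLe s s :=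
  ⟨rfl, rfl, le_rfl, fun _ _ => rfl, fun _ => id⟩

theorem SearchLe.trans {s s' s'' : Mem} (h : SearchLe s s') (h' : SearchLe s' s'') :
    SearchLe s s'' :=
  ⟨h'.reg_four.trans h.reg_four, h'.reg_six.trans h.reg_six, h.reg_five.trans h'.reg_five,
    fun k hk => (h'.queue k (hk.trans_le h.reg_five)).trans (h.queue k hk),
    fun v hv => h'.marked v (h.marked v hv)⟩

namespace Search

variable {n a b r q : ℕ} {A : ℕ → ℕ → ℕ} {s : Mem}

theorem visitAll (h : Search n A a b r q s) (ha : a ≠ 6 ∧ a ≠ 7) (hb : b ≠ 6 ∧ b ≠ 7)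
    (hu : s.reg 6 < n) (hm : s.arr 6 (s.reg 6) = 1)
    (hlt : ∀ u < n, ∀ v, IsNeighbour n A a b u v → v < n) {l : List Expr}
    (hl : ∀ e ∈ l, e ∈ neighbours a b) :
    Search n A a b r q ((visitAll l).den s) ∧ SearchLe s ((PyramidalTour.visitAll l).den s) ∧
      ∀ e ∈ l, ((PyramidalTour.visitAll l).den s).arr 6 (e.eval (graphMem n A (s.reg 6))) = 1 := by
  induction l generalizing s with
  | nil => exact ⟨h, .refl s, by simp⟩
  | cons e l ih =>
    have he := hl e (by simp)
    have hev := h.eval_eq ha hb he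
    obtain ⟨h1, h2, h3⟩ := h.visit ha hb he hu hm (hlt _ hu _ ⟨e, he, hev.symm⟩)
    obtain ⟨h4, h5, h6⟩ := ih h1 (by rw [h2.reg_six]; exact hu)
      (by rw [h2.reg_six]; exact h2.marked _ hm) (fun e he => hl e (by simp [he]))
    refine ⟨h4, h2.trans h5, fun e' he' => ?_⟩
    rcases List.mem_cons.1 he' with rfl | he'
    · rw [← hev]
      exact h5.marked _ h3
    · rw [← h2.reg_six]
      exact h6 e' he'

/-- The cities in front of the head of the queue have all their neighbours marked. -/
def Explored (n : ℕ) (A : ℕ → ℕ → ℕ) (a b : ℕ) (s : Mem) : Prop :=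
  s.reg 4 ≤ s.reg 5 ∧ ∀ k < s.reg 4, ∀ v, IsNeighbour n A a b (s.arr 7 k) v → s.arr 6 v = 1

theorem searchStep (h : Search n A a b r q s) (ha : a ≠ 6 ∧ a ≠ 7) (hb : b ≠ 6 ∧ b ≠ 7)
    (hlt : ∀ u < n, ∀ v, IsNeighbour n A a b u v → v < n) (hs : Explored n A a b s)
    (h45 : s.reg 4 < s.reg 5) :
    Search n A a b r q ((searchStep a b).den s) ∧
      Explored n A a b ((PyramidalTour.searchStep a b).den s) ∧
      ((PyramidalTour.searchStep a b).den s).reg 4 = s.reg 4 + 1 := by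
  set s₁ := (s.setReg 6 (s.arr 7 (s.reg 4))).setReg 4 (s.reg 4 + 1) with hs₁
  have hden : (PyramidalTour.searchStep a b).den s
      = (PyramidalTour.visitAll (neighbours a b)).den s₁ := by
    simp only [PyramidalTour.searchStep, Stmt.den]
    rw [eval_succ _ _ (by simpa [Expr.eval, Mem.setReg, h.reg_zero] using h45.trans_le h.tail_le)]
    simp [Expr.eval, Mem.setReg, hs₁]
  have hA : s₁.arr = s.arr := rfl
  have hr : ∀ i, i ≠ 4 → i ≠ 6 → s₁.reg i = s.reg i := fun i h4 h6 => by
    simp [hs₁, Mem.setReg, h4, h6]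
  have h4 : s₁.reg 4 = s.reg 4 + 1 := by simp [hs₁, Mem.setReg]
  have h6 : s₁.reg 6 = s.arr 7 (s.reg 4) := by simp [hs₁, Mem.setReg]
  have h5 : s₁.reg 5 = s.reg 5 := hr 5 (by decide) (by decide)
  clear_value s₁
  have h₁ : Search n A a b r q s₁ := by
    refine ⟨(hr 0 (by decide) (by decide)).trans h.reg_zero,
      (hr 3 (by decide) (by decide)).trans h.reg_three, ?_, ?_, ?_, ?_, ?_, ?_⟩
    · exact hA ▸ h.arr_eq
    · rw [hA, h5]; exact h.queue
    · rw [hA, h5]; exact h.queue_inj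
    · rw [hA, h5]; exact h.marked
    · rw [hA]; exact h.root
    · rw [hA]; exact h.minimal
  have hq := h.queue _ h45
  obtain ⟨h₂, hle, hall⟩ := h₁.visitAll ha hb (by rw [h6]; exact hq.1) (by rw [h6, hA]; exact hq.2)
    hlt (l := neighbours a b) (fun _ => id)
  rw [hden]
  refine ⟨h₂, ⟨?_, fun k hk v hv => ?_⟩, by rw [hle.reg_four, h4]⟩
  · have := hle.reg_five
    rw [hle.reg_four]
    omega
  · rw [hle.reg_four, h4] at hk
    rw [hle.queue k (by omega), hA] at hv
    rcases Nat.lt_succ_iff_lt_or_eq.1 hk with hk | rfl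
    · exact hle.marked v (hA ▸ hs.2 k hk v hv)
    · obtain ⟨e, he, hev⟩ := hv
      rw [← hev, ← h6]
      exact hall e he

end Search

end PyramidalTour

/-! ### Inversion of the maps, final comparison and correctness of the adjacency program -/

namespace PyramidalTour

/-- Invert the maps in the arrays `a` and `b` into the arrays `2` and `3` at the entry in register
`1`, clear its mark, and compare the two maps there. -/
def invertStep (a b : ℕ) : Stmt :=
  .seq (.store 2 (.load a (.reg 1)) (.reg 1))
    (.seq (.store 3 (.load b (.reg 1)) (.reg 1))
      (.seq (.store 6 (.reg 1) (.const 0))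
        (.seq (.set 2 ((Cond.eq (.load a (.reg 1)) (.load b (.reg 1))).ite (.reg 2) (.reg 1)))
          (.seq (.set 3 ((Cond.eq (.load a (.reg 1)) (.load b (.reg 1))).ite (.reg 3) (.const 1)))
            (.set 1 (Expr.succ (.reg 1)))))))

/-- The memory after `k` passes of `invertStep`. -/
structure Inverted (n : ℕ) (A : ℕ → ℕ → ℕ) (a b k : ℕ) (s : Mem) : Prop where
  reg_zero : s.reg 0 = n
  reg_one : s.reg 1 = k
  arr_eq : ∀ c, c ≠ 2 → c ≠ 3 → c ≠ 6 → c ≠ 7 → s.arr c = A c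
  arr_two : ∀ j < k, s.arr 2 (A a j) = j
  arr_three : ∀ j < k, s.arr 3 (A b j) = j
  arr_six : ∀ j < k, s.arr 6 j = 0
  found : (s.reg 3 = 0 ∧ s.reg 2 = 0 ∧ ∀ j < k, A a j = A b j) ∨
    (s.reg 3 = 1 ∧ s.reg 2 < k ∧ A a (s.reg 2) ≠ A b (s.reg 2))

/-- Injectivity of the maps prevents a later pass from overwriting an entry of an inverse array with
another city. -/
theorem Inverted.step {n a b k : ℕ} {A : ℕ → ℕ → ℕ} {s : Mem} (h : Inverted n A a b k s)
    (ha : a ≠ 2 ∧ a ≠ 3 ∧ a ≠ 6 ∧ a ≠ 7) (hb : b ≠ 2 ∧ b ≠ 3 ∧ b ≠ 6 ∧ b ≠ 7)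
    (hAa : ∀ i < n, ∀ j < n, A a i = A a j → i = j)
    (hAb : ∀ i < n, ∀ j < n, A b i = A b j → i = j) (hk : k < n) :
    Inverted n A a b (k + 1) ((invertStep a b).den s) := by
  have ha' := h.arr_eq a ha.1 ha.2.1 ha.2.2.1 ha.2.2.2
  have hb' := h.arr_eq b hb.1 hb.2.1 hb.2.2.1 hb.2.2.2
  obtain ⟨ha2, ha3, ha6, ha7⟩ := ha
  obtain ⟨hb2, hb3, hb6, hb7⟩ := hb
  set s' := (invertStep a b).den s with hs'
  have hden : s' = (((((s.setArr 2 (A a k) k).setArr 3 (A b k) k).setArr 6 k 0).setReg 2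
      (if A a k = A b k then s.reg 2 else k)).setReg 3
      (if A a k = A b k then s.reg 3 else 1)).setReg 1 (k + 1) := by
    rw [hs']
    simp only [invertStep, Stmt.den]
    rw [eval_succ _ _ (by simpa [Expr.eval, Mem.setReg, Mem.setArr, h.reg_zero, h.reg_one])]
    simp [Expr.eval, Cond.eval_ite, Cond.Holds, Mem.setReg, Mem.setArr, h.reg_one, ha2, ha3, ha6,
      hb2, hb3, hb6, ha', hb']
  clear_value s'
  have h2 : s'.reg 2 = if A a k = A b k then s.reg 2 else k := by
    simp [hden, Mem.setReg, Mem.setArr]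
  have h3 : s'.reg 3 = if A a k = A b k then s.reg 3 else 1 := by
    simp [hden, Mem.setReg, Mem.setArr]
  refine ⟨by simp [hden, Mem.setReg, Mem.setArr, h.reg_zero], by simp [hden, Mem.setReg],
    fun c h2 h3 h6 h7 => ?_, fun j hj => ?_, fun j hj => ?_, fun j hj => ?_, ?_⟩
  · rw [← h.arr_eq c h2 h3 h6 h7]
    simp [hden, Mem.setReg, Mem.setArr, h2, h3, h6]
  · have : s'.arr 2 (A a j) = if A a j = A a k then k else s.arr 2 (A a j) := by
      simp [hden, Mem.setReg, Mem.setArr, Function.update_apply]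
    rw [this]
    split_ifs with he
    · exact (hAa j (by omega) k hk he).symm
    · exact h.arr_two j (lt_of_le_of_ne (by omega) fun hjk => he (hjk ▸ rfl))
  · have : s'.arr 3 (A b j) = if A b j = A b k then k else s.arr 3 (A b j) := by
      simp [hden, Mem.setReg, Mem.setArr, Function.update_apply]
    rw [this]
    split_ifs with he
    · exact (hAb j (by omega) k hk he).symm
    · exact h.arr_three j (lt_of_le_of_ne (by omega) fun hjk => he (hjk ▸ rfl))
  · have : s'.arr 6 j = if j = k then 0 else s.arr 6 j := by
      simp [hden, Mem.setReg, Mem.setArr, Function.update_apply]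
    rw [this]
    split_ifs with he
    · rfl
    · exact h.arr_six j (by omega)
  · by_cases hk : A a k = A b k
    · rw [h2, h3, if_pos hk, if_pos hk]
      rcases h.found with ⟨h1, h2, h3⟩ | ⟨h1, h2, h3⟩
      · refine Or.inl ⟨h1, h2, fun j hj => ?_⟩
        rcases Nat.lt_succ_iff_lt_or_eq.1 hj with hj | rfl
        exacts [h3 j hj, hk]
      · exact Or.inr ⟨h1, by omega, h3⟩
    · rw [h2, h3, if_neg hk, if_neg hk]
      exact Or.inr ⟨rfl, by omega, hk⟩

/-- Set the register `8` to `0` if the maps in the arrays `a` and `b` differ at an entry without a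
mark. -/
def compareStep (a b : ℕ) : Stmt :=
  .seq (.set 8 ((Cond.eq (.load a (.reg 1)) (.load b (.reg 1))).ite (.reg 8)
      ((Cond.lt (.load 6 (.reg 1)) (.const 1)).ite (.const 0) (.reg 8))))
    (.set 1 (Expr.succ (.reg 1)))

/-- The memory after `k` passes of `compareStep`. -/
structure Compared (n : ℕ) (A : ℕ → ℕ → ℕ) (a b q k : ℕ) (s : Mem) : Prop where
  reg_zero : s.reg 0 = n
  reg_one : s.reg 1 = k
  arr_eq : s.arr = A
  result : s.reg 8 = 0 ∧ (q = 0 ∨ ∃ j < k, A a j ≠ A b j ∧ A 6 j = 0) ∨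
    s.reg 8 = q ∧ ∀ j < k, A a j ≠ A b j → A 6 j ≠ 0

theorem Compared.step {n a b q k : ℕ} {A : ℕ → ℕ → ℕ} {s : Mem} (h : Compared n A a b q k s)
    (hk : k < n) : Compared n A a b q (k + 1) ((compareStep a b).den s) := by
  set s' := (compareStep a b).den s with hs'
  have hden : s' = (s.setReg 8 (if A a k = A b k then s.reg 8 else if A 6 k = 0 then 0 else
      s.reg 8)).setReg 1 (k + 1) := by
    rw [hs']
    simp only [compareStep, Stmt.den]
    rw [eval_succ _ _ (by simpa [Expr.eval, Mem.setReg, Mem.setArr, h.reg_zero, h.reg_one])]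
    simp [Expr.eval, Cond.eval_ite, Cond.Holds, Mem.setReg, h.reg_one, h.arr_eq]
  clear_value s'
  have h8 : s'.reg 8 = if A a k = A b k then s.reg 8 else if A 6 k = 0 then 0 else s.reg 8 := by
    simp [hden, Mem.setReg]
  refine ⟨by simp [hden, Mem.setReg, h.reg_zero], by simp [hden, Mem.setReg],
    by simp [hden, Mem.setReg, h.arr_eq], ?_⟩
  rw [h8]
  rcases h.result with ⟨h1, h2⟩ | ⟨h1, h2⟩
  · refine Or.inl ⟨by simp [h1], h2.imp_right ?_⟩
    rintro ⟨j, hj, hj'⟩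
    exact ⟨j, by omega, hj'⟩
  · by_cases hc : A a k = A b k ∨ A 6 k ≠ 0
    · refine Or.inr ⟨by rw [h1]; grind, fun j hj hjk => ?_⟩
      rcases Nat.lt_succ_iff_lt_or_eq.1 hj with hj | rfl
      · exact h2 j hj hjk
      · exact hc.resolve_left hjk
    · push Not at hc
      exact Or.inl ⟨by simp [hc], Or.inr ⟨k, by omega, hc⟩⟩

/-- The statement before the loop over the entries of the maps. -/
def invertStart : Stmt := .seq (.set 1 (.const 0)) (.seq (.set 2 (.const 0)) (.set 3 (.const 0)))

/-- The statement before the search. -/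
def searchStart : Stmt :=
  .seq (.store 6 (.reg 2) (.const 1))
    (.seq (.store 7 (.const 0) (.reg 2)) (.seq (.set 4 (.const 0)) (.set 5 (.const 1))))

/-- The statement before the final comparison. -/
def compareStart : Stmt := .seq (.set 1 (.const 0)) (.set 8 (.reg 3))

/-- The program that decides the adjacency of the tours in the arrays `a` and `b`. -/
def adjacency (a b : ℕ) : Prog :=
  .seq invertStart.compile (.seq (loop 1 0 (invertStep a b))
    (.seq searchStart.compile (.seq (loop 4 5 (searchStep a b))
      (.seq compareStart.compile (.seq (loop 1 0 (compareStep a b))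
        (Stmt.set 0 (.reg 8)).compile)))))

/-- The factor in the bound for the number of steps of `adjacency`. -/
def adjacencyCost (a b : ℕ) : ℕ :=
  (invertStep a b).cost + (searchStep a b).cost + (compareStep a b).cost + invertStart.cost +
    searchStart.cost + compareStart.cost + 10

/-- The arrays of the machine agree with the maps only below `n`. -/
theorem IsPSB.congr {n : ℕ} {f g f' g' : ℕ → ℕ} (h : IsPSB n f g) (hf : ∀ i < n, f' i = f i)
    (hg : ∀ i < n, g' i = g i) : IsPSB n f' g' where
  two_le := h.two_le
  f_lt i hi := by rw [hf i hi]; exact h.f_lt i hi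
  g_lt i hi := by rw [hg i hi]; exact h.g_lt i hi
  gf i hi := by rw [hf i hi, hg _ (h.f_lt i hi)]; exact h.gf i hi
  fg i hi := by rw [hg i hi, hf _ (h.g_lt i hi)]; exact h.fg i hi
  f_ne i hi := by rw [hf i hi]; exact h.f_ne i hi
  peak j hj := by
    rw [hf _ (by omega), hg _ (by omega), hf j (by omega), hg j (by omega)]
    exact h.peak j hj

theorem Saturated.congr {n : ℕ} {x gx y gy x' gx' y' gy' : ℕ → ℕ} {M : ℕ → Prop}
    (h : Saturated n x gx y gy M) (hxl : ∀ i < n, x i < n) (hx : ∀ i < n, x' i = x i)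
    (hgx : ∀ i < n, gx' i = gx i) (hy : ∀ i < n, y' i = y i) (hgy : ∀ i < n, gy' i = gy i) :
    Saturated n x' gx' y' gy' M where
  alternate v hv := by rw [hx v hv, hgy _ (hxl v hv)]; exact h.alternate v hv
  in_out j hj := by
    rw [hx _ (by omega), hgx _ (by omega), hy _ (by omega), hgy _ (by omega)]
    exact h.in_out j hj
  out_out j hj := by
    rw [hx _ (by omega), hy _ (by omega), hx j (by omega), hy j (by omega)]
    exact h.out_out j hj
  in_out_low j hj := by
    rw [hgx _ (by omega), hgy _ (by omega), hx j (by omega), hy j (by omega)]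
    exact h.in_out_low j hj
  in_in j hj := by
    rw [hgx _ (by omega), hgy _ (by omega), hgx j (by omega), hgy j (by omega)]
    exact h.in_in j hj
  out_in_low j hj := by
    rw [hx _ (by omega), hy _ (by omega), hgx j (by omega), hgy j (by omega)]
    exact h.out_in_low j hj

/-- The program `adjacency` computes the comparison of the tours with the component of an arc in
which they differ. -/
theorem exists_runs_adjacency {n W a b : ℕ} (hW : 3 ≤ W)
    (ha : a ≠ 2 ∧ a ≠ 3 ∧ a ≠ 6 ∧ a ≠ 7) (hb : b ≠ 2 ∧ b ≠ 3 ∧ b ≠ 6 ∧ b ≠ 7)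
    {gx gy : ℕ → ℕ} {s : Mem} (hs : s.reg 0 = n) (hx : IsPSB n (s.arr a) gx)
    (hy : IsPSB n (s.arr b) gy) :
    ∃ s', Runs W (adjacencyCost a b * n) (adjacency a b) s s' ∧
      ((∀ i < n, s.arr a i = s.arr b i) ∧ s'.reg 0 = 0 ∨
        ∃ (r : ℕ) (M : ℕ → Prop), r < n ∧ s.arr a r ≠ s.arr b r ∧ M r ∧
          Saturated n (s.arr a) gx (s.arr b) gy M ∧
          (∀ N, Saturated n (s.arr a) gx (s.arr b) gy N → N r → ∀ i < n, M i → N i) ∧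
          ((∀ i < n, s.arr a i ≠ s.arr b i → M i) ∧ s'.reg 0 = 1 ∨
            ¬ (∀ i < n, s.arr a i ≠ s.arr b i → M i) ∧ s'.reg 0 = 0)) := by
  have hn := hx.two_le
  set A := s.arr with hA
  have r1 := invertStart.runs hW rfl s
  obtain ⟨s₂, h₂, r2⟩ := exists_runs_loop (W := W) (m := n) (a := 1) (b := 0) hW (by decide)
    (by decide) (p := invertStep a b) rfl (I := Inverted n A a b) (s := invertStart.den s)
    ⟨hs, rfl, fun _ _ _ _ _ => rfl, by simp, by simp, by simp, Or.inl ⟨rfl, rfl, by simp⟩⟩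
    (fun k t hk ht => ⟨by rw [ht.reg_zero, ht.reg_one]; exact hk,
      ht.step ha hb (fun i hi j hj => hx.f_inj hi hj) (fun i hi j hj => hy.f_inj hi hj) hk⟩)
    (fun t ht => by rw [ht.reg_zero, ht.reg_one]; exact lt_irrefl n)
  have r3 := searchStart.runs hW rfl s₂
  -- If the tours are equal, `q = 0` and the search starts at city `0` to no purpose; the comparison
  -- then starts from `0` and keeps it.
  obtain ⟨q, hq⟩ : ∃ q, s₂.reg 3 = q := ⟨_, rfl⟩
  obtain ⟨r, hr⟩ : ∃ r, s₂.reg 2 = r := ⟨_, rfl⟩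
  set s₃ := searchStart.den s₂ with hs₃
  have hrn : r < n := by
    rcases h₂.found with h | h
    · omega
    · omega
  have hsa : s₂.arr a = A a := h₂.arr_eq a ha.1 ha.2.1 ha.2.2.1 ha.2.2.2
  have hsb : s₂.arr b = A b := h₂.arr_eq b hb.1 hb.2.1 hb.2.2.1 hb.2.2.2
  have hgx : ∀ i < n, s₂.arr 2 i = gx i := fun i hi => by
    conv_lhs => rw [← hx.fg i hi]
    exact h₂.arr_two _ (hx.g_lt i hi)
  have hgy : ∀ i < n, s₂.arr 3 i = gy i := fun i hi => by
    conv_lhs => rw [← hy.fg i hi]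
    exact h₂.arr_three _ (hy.g_lt i hi)
  have hx₂ : IsPSB n (s₂.arr a) (s₂.arr 2) := hx.congr (fun i _ => by rw [hsa]) hgx
  have hy₂ : IsPSB n (s₂.arr b) (s₂.arr 3) := hy.congr (fun i _ => by rw [hsb]) hgy
  have h₃6 : ∀ v, s₃.arr 6 v = if v = r then 1 else s₂.arr 6 v := fun v => by
    simp [hs₃, searchStart, Stmt.den, Expr.eval, Mem.setReg, Mem.setArr, Function.update_apply, hr]
  have h₃7 : s₃.arr 7 0 = r := by
    simp [hs₃, searchStart, Stmt.den, Expr.eval, Mem.setReg, Mem.setArr, hr]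
  have h₃4 : s₃.reg 4 = 0 := by simp [hs₃, searchStart, Stmt.den, Expr.eval, Mem.setReg]
  have h₃5 : s₃.reg 5 = 1 := by simp [hs₃, searchStart, Stmt.den, Expr.eval, Mem.setReg]
  have h₃ : Search n s₂.arr a b r q s₃ := by
    refine ⟨?_, ?_, fun c h6 h7 => ?_, fun k hk => ?_, fun k hk l hl _ => by omega,
      fun v hv hm => ⟨0, by omega, ?_⟩, by simp [h₃6], fun N _ hNr v hv hm => ?_⟩
    · simp [hs₃, searchStart, Stmt.den, Expr.eval, Mem.setReg, Mem.setArr, h₂.reg_zero]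
    · simp [hs₃, searchStart, Stmt.den, Expr.eval, Mem.setReg, Mem.setArr, hq]
    · simp [hs₃, searchStart, Stmt.den, Expr.eval, Mem.setReg, Mem.setArr, h6, h7]
    · obtain rfl : k = 0 := by omega
      simp [h₃7, h₃6, hrn]
    · by_contra hne
      rw [h₃7] at hne
      rw [h₃6, if_neg (Ne.symm hne), h₂.arr_six v hv] at hm
      exact hm rfl
    · by_cases hvr : v = r
      · exact hvr ▸ hNr
      · rw [h₃6, if_neg hvr, h₂.arr_six v hv] at hm
        omega
  have hlt : ∀ u < n, ∀ v, IsNeighbour n s₂.arr a b u v → v < n := fun u hu v huv =>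
    -- The set of all cities is trivially saturated; only the bound on `v` is wanted.
    (Saturated.of_isNeighbour (M := fun _ => True) (by constructor <;> simp) hx₂ hy₂ hu huv).1
  obtain ⟨s₄, ⟨h₄, hex⟩, h45, r4⟩ := exists_runs_loop_of_measure (W := W) (m := n) (a := 4) (b := 5)
    hW (by decide) (by decide) (p := searchStep a b) (searchStep_wf a b)
    (I := fun t => Search n s₂.arr a b r q t ∧ Search.Explored n s₂.arr a b t)
    -- The head of the queue advances in each pass and cannot overtake the tail, which is at most
    -- `n`.
    (μ := fun t => n - t.reg 4) (s := s₃) ⟨h₃, by omega, fun k hk => by omega⟩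
    (Nat.sub_le _ _) (fun t ht h45 => by
      obtain ⟨h1, h2, h3⟩ := ht.1.searchStep ⟨ha.2.2.1, ha.2.2.2⟩ ⟨hb.2.2.1, hb.2.2.2⟩ hlt ht.2 h45
      refine ⟨⟨h1, h2⟩, ?_⟩
      rw [h3]
      have := ht.1.tail_le
      omega)
  have r5 := compareStart.runs hW rfl s₄
  obtain ⟨s₆, h₆, r6⟩ := exists_runs_loop (W := W) (m := n) (a := 1) (b := 0) hW (by decide)
    (by decide) (p := compareStep a b) rfl (I := Compared n s₄.arr a b q)
    (s := compareStart.den s₄)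
    ⟨h₄.reg_zero, rfl, rfl, Or.inr ⟨h₄.reg_three, by simp⟩⟩
    (fun k t hk ht => ⟨by rw [ht.reg_zero, ht.reg_one]; exact hk, ht.step hk⟩)
    (fun t ht => by rw [ht.reg_zero, ht.reg_one]; exact lt_irrefl n)
  have r7 := (Stmt.set 0 (.reg 8)).runs hW rfl s₆
  refine ⟨_, (r1.seq (r2.seq (r3.seq (r4.seq (r5.seq (r6.seq r7)))))).mono ?_, ?_⟩
  -- The tests of the three loops and the last statement cost `3 * n + 7`, which the summand `10` of
  -- the factor covers.
  · have hc : (Stmt.set 0 (.reg 8)).cost = 4 := rfl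
    rw [hc]
    unfold adjacencyCost
    generalize (invertStep a b).cost = c1
    generalize (searchStep a b).cost = c2
    generalize (compareStep a b).cost = c3
    generalize invertStart.cost = c4
    generalize searchStart.cost = c5
    generalize compareStart.cost = c6
    obtain ⟨m, rfl⟩ : ∃ m, n = m + 1 := ⟨n - 1, by omega⟩
    have : 1 ≤ m := by omega
    nlinarith [Nat.zero_le (c4 * m), Nat.zero_le (c5 * m), Nat.zero_le (c6 * m)]
  · have h0 : ((Stmt.set 0 (.reg 8)).den s₆).reg 0 = s₆.reg 8 := by
      simp [Stmt.den, Expr.eval, Mem.setReg]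
    rw [h0]
    have hsa₄ : s₄.arr a = A a := (h₄.arr_eq a ha.2.2.1 ha.2.2.2).trans hsa
    have hsb₄ : s₄.arr b = A b := (h₄.arr_eq b hb.2.2.1 hb.2.2.2).trans hsb
    have hres := h₆.result
    rw [hsa₄, hsb₄] at hres
    rcases h₂.found with ⟨hq0, _, heq⟩ | ⟨hq1, _, hne⟩
    · refine Or.inl ⟨heq, ?_⟩
      rcases hres with h | h
      · exact h.1
      · omega
    · rw [hr] at hne
      have hmark : ∀ v < n, s₄.arr 6 v ≠ 0 → s₄.arr 6 v = 1 := fun v hv hm => by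
        obtain ⟨k, hk, rfl⟩ := h₄.marked v hv hm
        exact (h₄.queue k hk).2
      refine Or.inr ⟨r, fun v => s₄.arr 6 v = 1, hrn, hne, h₄.root, ?_, fun N hN hNr => ?_, ?_⟩
      · refine (saturated_of_closed hx₂ hy₂ fun u hu hmu v huv => ?_).congr hx₂.f_lt
          (fun i _ => by rw [hsa]) (fun i hi => (hgx i hi).symm) (fun i _ => by rw [hsb])
          (fun i hi => (hgy i hi).symm)
        -- At the end the head has reached the tail, so every marked city has been explored.
        obtain ⟨k, hk, rfl⟩ := h₄.marked u hu (by omega)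
        exact hex.2 k (by omega) v huv
      · have hN₂ : Saturated n (s₂.arr a) (s₂.arr 2) (s₂.arr b) (s₂.arr 3) N :=
          hN.congr hx.f_lt (fun i _ => by rw [hsa]) hgx (fun i _ => by rw [hsb]) hgy
        exact h₄.minimal N (fun u hu hNu v huv => (hN₂.of_isNeighbour hx₂ hy₂ hu huv).2 hNu) hNr
      · rcases hres with ⟨h8, hq0 | ⟨j, hj, hjne, hj6⟩⟩ | ⟨h8, hall⟩
        · omega
        · exact Or.inr ⟨fun hM => by have := hM j hj hjne; omega, h8⟩
        · exact Or.inl ⟨fun i hi hne => hmark i hi (hall i hi hne), by omega⟩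

end PyramidalTour

namespace PyramidalTour

/-! ### Decoding -/

/-- The array `E` holds the pyramidal encoding of the tour with the successor map `f` and the
predecessor map `g`. -/
structure IsEncoding (n : ℕ) (f g E : ℕ → ℕ) : Prop where
  asc_peak : ∀ j, j + 2 < n → g (j + 1) < j + 1 → f (j + 1) = j → j + 1 < f j → E (j + 1) = 3
  desc_peak : ∀ j, j + 2 < n → j + 1 < g j → g (j + 1) = j → f (j + 1) < j + 1 → E (j + 1) = 2
  asc : ∀ i, 0 < i → i + 1 < n → i < f i → (f i = i + 1 → g i < i) → E i = 1
  desc : ∀ i, 0 < i → i + 1 < n → i < g i → (i < f i → f i = i + 1) → E i = 0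
  last : E (n - 1) = 0

theorem IsPyramidalSB.isEncoding {n : ℕ} (hn : 2 ≤ n) {τ : Equiv.Perm (Fin n)}
    (h : IsPyramidalSB τ) :
    IsEncoding n (tourArray τ) (tourArray τ.symm) (encodingArray τ) where
  asc_peak _ hj h1 h2 h3 := encodingArray_asc_peak hj h1 h2 h3
  desc_peak _ hj h1 h2 h3 := encodingArray_desc_peak hn h hj h1 h2 h3
  asc i h0 hi h1 h2 := by
    rw [encodingArray_of_not_peak hn h h0 hi (by omega), if_pos ⟨h1, h2⟩]
  desc i h0 hi h1 h2 := by
    rw [encodingArray_of_not_peak hn h h0 hi (by omega), if_neg]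
    rintro ⟨h3, h4⟩
    have := h4 (h2 h3)
    omega
  -- The default `0` matters: from the last city but one, the decoder looks ahead to this entry.
  last := by rw [encodingArray, dif_neg (by omega)]

/-- Insert the city in the register `1` into the tour in the array `b`, if it is not the first city
of a step-back; the array `a` holds the encoding, and the registers `2` and `3` hold the ends of
the two paths of the tour through the cities that were inserted. -/
def decodeStep (a b : ℕ) : Stmt :=
  let i : Expr := .reg 1
  .seq (.ifLe (.const 3) (.load a i)
      (.seq (.store b (.reg 2) i) (.seq (.store b i (.sub i (.const 1)))
        (.set 2 (.sub i (.const 1)))))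
      (.ifLe (.const 2) (.load a i)
        (.seq (.store b i (.reg 3)) (.seq (.store b (.sub i (.const 1)) i)
          (.set 3 (.sub i (.const 1)))))
        (.ifLe (.const 1) (.load a i)
          (.ifLe (.const 3) (.load a i.succ) .skip (.seq (.store b (.reg 2) i) (.set 2 i)))
          (.ifLe (.const 2) (.load a i.succ) .skip (.seq (.store b i (.reg 3)) (.set 3 i))))))
    (.set 1 i.succ)

/-- The memory after `k` passes of `decodeStep`. -/
structure Decoded (n : ℕ) (A : ℕ → ℕ → ℕ) (b : ℕ) (f g : ℕ → ℕ) (k : ℕ) (s : Mem) : Prop where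
  reg_zero : s.reg 0 = n
  reg_one : s.reg 1 = k + 1
  reg_four : s.reg 4 = n - 1
  arr_eq : ∀ c, c ≠ b → s.arr c = A c
  paths : (Frontier f g (k + 1) (s.reg 2) (s.reg 3) ∧
      ∀ j < k + 1, j ≠ s.reg 2 → s.arr b j = f j) ∨
    (k ≠ 0 ∧ k < f k ∧ k < g k ∧ Frontier f g k (s.reg 2) (s.reg 3) ∧
      ∀ j < k, j ≠ s.reg 2 → s.arr b j = f j)

theorem decodeStep_den {a b : ℕ} {s : Mem} (h : s.reg 1 < s.reg 0) :
    (decodeStep a b).den s = Mem.setReg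
      (if 3 ≤ s.arr a (s.reg 1) then
        ((s.setArr b (s.reg 2) (s.reg 1)).setArr b (s.reg 1) (s.reg 1 - 1)).setReg 2 (s.reg 1 - 1)
      else if 2 ≤ s.arr a (s.reg 1) then
        ((s.setArr b (s.reg 1) (s.reg 3)).setArr b (s.reg 1 - 1) (s.reg 1)).setReg 3 (s.reg 1 - 1)
      else if 1 ≤ s.arr a (s.reg 1) then
        if 3 ≤ s.arr a (s.reg 1 + 1) then s
        else (s.setArr b (s.reg 2) (s.reg 1)).setReg 2 (s.reg 1)
      else if 2 ≤ s.arr a (s.reg 1 + 1) then s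
        else (s.setArr b (s.reg 1) (s.reg 3)).setReg 3 (s.reg 1)) 1 (s.reg 1 + 1) := by
  have h1 : (Expr.succ (.reg 1)).eval s = s.reg 1 + 1 := eval_succ _ _ h
  simp only [decodeStep, Stmt.den]
  rw [eval_succ]
  · simp only [Expr.eval, h1]
    split_ifs <;> rfl
  · split_ifs <;> exact h

theorem Decoded.setReg_one {n b k : ℕ} {A : ℕ → ℕ → ℕ} {f g : ℕ → ℕ} {s : Mem}
    (h0 : s.reg 0 = n) (h4 : s.reg 4 = n - 1) (hA : ∀ c, c ≠ b → s.arr c = A c)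
    (hp : (Frontier f g (k + 1) (s.reg 2) (s.reg 3) ∧
      ∀ j < k + 1, j ≠ s.reg 2 → s.arr b j = f j) ∨
    (k ≠ 0 ∧ k < f k ∧ k < g k ∧ Frontier f g k (s.reg 2) (s.reg 3) ∧
      ∀ j < k, j ≠ s.reg 2 → s.arr b j = f j)) :
    Decoded n A b f g k (s.setReg 1 (k + 1)) where
  reg_zero := by simpa [Mem.setReg] using h0
  reg_one := by simp [Mem.setReg]
  reg_four := by simpa [Mem.setReg] using h4
  arr_eq := hA
  paths := by simpa [Mem.setReg] using hp

/-- The bottom of a step-back has the symbol of an ordinary city of its direction and is recognised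
only by the next symbol. It is passed over and inserted together with its peak. -/
theorem Decoded.step {n a b k : ℕ} {A : ℕ → ℕ → ℕ} {f g : ℕ → ℕ} {s : Mem}
    (D : Decoded n A b f g k s) (hab : a ≠ b) (h : IsPSB n f g) (hE : IsEncoding n f g (A a))
    (hk : k + 2 < n) : Decoded n A b f g (k + 1) ((decodeStep a b).den s) := by
  have hden := decodeStep_den (a := a) (b := b) (s := s) (by rw [D.reg_zero, D.reg_one]; omega)
  rw [D.arr_eq a hab, D.reg_one, Nat.add_sub_cancel] at hden
  have hgf := h.gf (k + 1) (by omega)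
  have hfg := h.fg (k + 1) (by omega)
  obtain ⟨D0, _, D4, DA, Dp⟩ := D
  rcases Dp with ⟨F, hb⟩ | ⟨h0, hf, hg, F, hb⟩
  · have h1 := h.f_ne (k + 1) (by omega)
    have h2 := h.g_ne (k + 1) (by omega)
    rcases Nat.lt_or_gt_of_ne h1 with h1 | h1 <;> rcases Nat.lt_or_gt_of_ne h2 with h2 | h2
    · exact (F.not_peak h (by omega) h1 h2).elim
    · have e1 : A a (k + 1) = 0 := hE.desc _ (by omega) (by omega) h2 (by omega)
      -- A step-back peak as the next city would make `k + 1` a valley.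
      have e2 : A a (k + 1 + 1) < 2 := by
        by_cases hk3 : k + 3 < n
        · have hgf' := h.gf (k + 1 + 1) (by omega)
          have hfg' := h.fg (k + 1 + 1) (by omega)
          have hne := h.f_ne (k + 1 + 1) (by omega)
          have hne' := h.g_ne (k + 1 + 1) (by omega)
          by_cases hpk : g (k + 1 + 1) < k + 1 + 1 ∧ f (k + 1 + 1) < k + 1 + 1
          · rcases h.peak (k + 1) hk3 (by omega) (by omega) with ⟨_, h4⟩ | ⟨h4, _⟩
            · omega
            · rw [h4] at hfg'
              omega
          · by_cases hup : k + 1 + 1 < f (k + 1 + 1) ∧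
                (f (k + 1 + 1) = k + 1 + 1 + 1 → g (k + 1 + 1) < k + 1 + 1)
            · rw [hE.asc _ (by omega) (by omega) hup.1 hup.2]
              decide
            · rw [hE.desc _ (by omega) (by omega) (by omega) (by omega)]
              decide
        · have := hE.last
          rw [show n - 1 = k + 1 + 1 by omega] at this
          omega
      rw [if_neg (by omega), if_neg (by omega), if_neg (by omega), if_neg (by omega)] at hden
      rw [hden]
      have hd := F.f_eq h le_rfl (by omega) h1
      refine Decoded.setReg_one (by simpa [Mem.setReg, Mem.setArr] using D0)
        (by simpa [Mem.setReg, Mem.setArr] using D4)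
        (fun c hc => by simp [Mem.setReg, Mem.setArr, hc, DA c hc]) (Or.inl ?_)
      simp only [Mem.setReg, Mem.setArr, Function.update_self, ne_eq,
        Nat.reduceEqDiff, not_false_eq_true, Function.update_of_ne]
      refine ⟨F.desc h (by omega) h1 h2, fun j hj hja => ?_⟩
      rcases Nat.lt_succ_iff_lt_or_eq.1 hj with hj | rfl
      · rw [Function.update_of_ne (by omega)]
        exact hb j hj hja
      · rw [Function.update_self, hd]
    · have e1 : A a (k + 1) = 1 := hE.asc _ (by omega) (by omega) h1 (fun _ => h2)
      have e2 : A a (k + 1 + 1) < 3 := by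
        by_cases hk3 : k + 3 < n
        · have hgf' := h.gf (k + 1 + 1) (by omega)
          have hfg' := h.fg (k + 1 + 1) (by omega)
          have hne := h.f_ne (k + 1 + 1) (by omega)
          have hne' := h.g_ne (k + 1 + 1) (by omega)
          by_cases hpk : g (k + 1 + 1) < k + 1 + 1 ∧ f (k + 1 + 1) < k + 1 + 1
          · rcases h.peak (k + 1) hk3 (by omega) (by omega) with ⟨h4, _⟩ | ⟨h4, h5⟩
            · rw [h4] at hgf'
              omega
            · rw [hE.desc_peak _ hk3 h5 h4 hpk.2]
              decide
          · by_cases hup : k + 1 + 1 < f (k + 1 + 1) ∧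
                (f (k + 1 + 1) = k + 1 + 1 + 1 → g (k + 1 + 1) < k + 1 + 1)
            · rw [hE.asc _ (by omega) (by omega) hup.1 hup.2]
              decide
            · rw [hE.desc _ (by omega) (by omega) (by omega) (by omega)]
              decide
        · have := hE.last
          rw [show n - 1 = k + 1 + 1 by omega] at this
          omega
      rw [if_neg (by omega), if_neg (by omega), if_pos (by omega), if_neg (by omega)] at hden
      rw [hden]
      have ha := F.g_eq h le_rfl (by omega) h2
      refine Decoded.setReg_one (by simpa [Mem.setReg, Mem.setArr] using D0)
        (by simpa [Mem.setReg, Mem.setArr] using D4)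
        (fun c hc => by simp [Mem.setReg, Mem.setArr, hc, DA c hc]) (Or.inl ?_)
      simp only [Mem.setReg, Mem.setArr, Function.update_self, ne_eq,
        Nat.reduceEqDiff, not_false_eq_true, Function.update_of_ne]
      refine ⟨F.asc h (by omega) h2 h1, fun j hj hja => ?_⟩
      by_cases hj' : j = s.reg 2
      · rw [hj', Function.update_self, ← ha, hfg]
      · rw [Function.update_of_ne hj']
        exact hb j (by omega) hj'
    · obtain ⟨hk3, ⟨h3, h4, h5⟩ | ⟨h3, h4, h5, h6⟩⟩ := h.valley (by omega) (by omega) h1 h2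
      · have e1 : A a (k + 1) = 1 := hE.asc _ (by omega) (by omega) h1 (fun _ => by omega)
        have e2 : A a (k + 1 + 1) = 3 := hE.asc_peak _ hk3 (by omega) h3 h4
        rw [if_neg (by omega), if_neg (by omega), if_pos (by omega), if_pos (by omega)] at hden
        rw [hden]
        exact Decoded.setReg_one D0 D4 DA (Or.inr ⟨by omega, h1, h2, F, hb⟩)
      · have e1 : A a (k + 1) = 0 := hE.desc _ (by omega) (by omega) h2 (fun _ => h3)
        have e2 : A a (k + 1 + 1) = 2 := hE.desc_peak _ hk3 h5 h4 (by omega)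
        rw [if_neg (by omega), if_neg (by omega), if_neg (by omega), if_pos (by omega)] at hden
        rw [hden]
        exact Decoded.setReg_one D0 D4 DA (Or.inr ⟨by omega, h1, h2, F, hb⟩)
  -- The bottom `k` was passed over before and is now inserted with its peak `k + 1`.
  · have hFa := F.a_lt
    obtain ⟨hk3, ⟨h3, h4, h5⟩ | ⟨h3, h4, h5, h6⟩⟩ := h.valley (by omega) h0 hf hg
    · have e1 : A a (k + 1) = 3 := hE.asc_peak _ hk (by omega) h3 h4
      rw [if_pos (by omega)] at hden
      rw [hden]
      have ha := F.g_eq h (Nat.le_succ k) (by omega) h5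
      refine Decoded.setReg_one (by simpa [Mem.setReg, Mem.setArr] using D0)
        (by simpa [Mem.setReg, Mem.setArr] using D4)
        (fun c hc => by simp [Mem.setReg, Mem.setArr, hc, DA c hc]) (Or.inl ?_)
      simp only [Mem.setReg, Mem.setArr, Function.update_self, ne_eq,
        Nat.reduceEqDiff, not_false_eq_true, Function.update_of_ne]
      refine ⟨F.ascStep h (by omega) h3 h4 h5, fun j hj hja => ?_⟩
      by_cases hjk : j = k + 1
      · rw [hjk, Function.update_self, h3]
      · rw [Function.update_of_ne hjk]
        by_cases hj' : j = s.reg 2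
        · rw [hj', Function.update_self, ← ha, hfg]
        · rw [Function.update_of_ne hj']
          exact hb j (by omega) hj'
    · have e1 : A a (k + 1) = 2 := hE.desc_peak _ hk h5 h4 (by omega)
      rw [if_neg (by omega), if_pos (by omega)] at hden
      rw [hden]
      have hd := F.f_eq h (Nat.le_succ k) (by omega) h6
      refine Decoded.setReg_one (by simpa [Mem.setReg, Mem.setArr] using D0)
        (by simpa [Mem.setReg, Mem.setArr] using D4)
        (fun c hc => by simp [Mem.setReg, Mem.setArr, hc, DA c hc]) (Or.inl ?_)
      simp only [Mem.setReg, Mem.setArr, Function.update_self, ne_eq,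
        Nat.reduceEqDiff, not_false_eq_true, Function.update_of_ne]
      refine ⟨F.descStep h (by omega) h4 h5 h6, fun j hj hja => ?_⟩
      by_cases hjk : j = k
      · rw [hjk, Function.update_self, h3]
      · rw [Function.update_of_ne hjk]
        by_cases hj' : j = k + 1
        · rw [hj', Function.update_self, hd]
        · rw [Function.update_of_ne hj']
          exact hb j (by omega) hja

/-- The statement before the loop of the decoding. -/
def decodeStart : Stmt :=
  .seq (.set 1 (.const 1)) (.seq (.set 2 (.const 0)) (.seq (.set 3 (.const 0))
    (.set 4 (.sub (.reg 0) (.const 1)))))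

/-- The statement that inserts the last city. -/
def decodeEnd (b : ℕ) : Stmt :=
  .seq (.store b (.reg 2) (.reg 4)) (.store b (.reg 4) (.reg 3))

/-- The program that decodes the encoding in the array `a` into the array `b`. -/
def decode (a b : ℕ) : Prog :=
  .seq decodeStart.compile (.seq (loop 1 4 (decodeStep a b)) (decodeEnd b).compile)

/-- The factor in the bound for the number of steps of `decode`. -/
def decodeCost (a b : ℕ) : ℕ :=
  (decodeStep a b).cost + decodeStart.cost + (decodeEnd b).cost + 2

theorem exists_runs_decode {n W a b : ℕ} (hW : 3 ≤ W) (hab : a ≠ b) {f g : ℕ → ℕ} {s : Mem}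
    (hs : s.reg 0 = n) (h : IsPSB n f g) (hE : IsEncoding n f g (s.arr a)) :
    ∃ s', Runs W (decodeCost a b * n) (decode a b) s s' ∧ s'.reg 0 = n ∧
      (∀ c, c ≠ b → s'.arr c = s.arr c) ∧ ∀ i < n, s'.arr b i = f i := by
  have hn := h.two_le
  have r1 := decodeStart.runs hW rfl s
  obtain ⟨s₂, h₂, r2⟩ := exists_runs_loop (W := W) (m := n - 2) (a := 1) (b := 4) hW (by decide)
    (by decide) (p := decodeStep a b) rfl (I := Decoded n s.arr b f g) (s := decodeStart.den s)
    ⟨hs, rfl, by simp [decodeStart, Stmt.den, Expr.eval, Mem.setReg, hs], fun _ _ => rfl,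
      Or.inl ⟨Frontier.one h, fun j hj hj' => (hj' (Nat.lt_one_iff.1 hj)).elim⟩⟩
    (fun k t hk D => ⟨by rw [D.reg_one, D.reg_four]; omega, D.step hab h hE (by omega)⟩)
    (fun t D => by rw [D.reg_one, D.reg_four]; omega)
  have r3 := (decodeEnd b).runs hW rfl s₂
  refine ⟨_, (r1.seq (r2.seq r3)).mono ?_, ?_, fun c hc => ?_, fun i hi => ?_⟩
  · unfold decodeCost
    generalize (decodeStep a b).cost = c1
    generalize decodeStart.cost = c2
    generalize (decodeEnd b).cost = c3
    obtain ⟨m, rfl⟩ : ∃ m, n = m + 2 := ⟨n - 2, by omega⟩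
    rw [Nat.add_sub_cancel]
    nlinarith [Nat.zero_le (c2 * m), Nat.zero_le (c3 * m)]
  · simpa [decodeEnd, Stmt.den, Mem.setArr] using h₂.reg_zero
  · rw [← h₂.arr_eq c hc]
    simp [decodeEnd, Stmt.den, Mem.setArr, hc]
  · have e : ((decodeEnd b).den s₂).arr b i =
        if i = n - 1 then s₂.reg 3 else if i = s₂.reg 2 then n - 1 else s₂.arr b i := by
      simp [decodeEnd, Stmt.den, Expr.eval, Mem.setArr, Function.update_apply, h₂.reg_four]
    rw [e]
    rcases h₂.paths with ⟨F, hb⟩ | ⟨h0, hf, hg, _⟩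
    · rw [show n - 2 + 1 = n - 1 by omega] at F hb
      split_ifs with h1 h2
      · have := h.f_lt i hi
        have := h.f_ne i hi
        exact (F.f_eq h (by omega) hi (by omega)).symm
      · have := (F.up i (by omega)).2 h2
        have := h.f_lt i hi
        omega
      · exact hb i (by omega) h2
    -- No bottom is left over: its peak would be the last city.
    · have := (h.valley (by omega) h0 hf hg).1
      omega

end PyramidalTour

/-! ### The two decision programs -/

namespace PyramidalTour

theorem Runs.decides {W T : ℕ} {p : Prog} {s s' : Mem} {A : Prop} (h : Runs W T p s s')
    (hs : s.Bounded W) (hA : A ∧ s'.reg 0 = 1 ∨ ¬ A ∧ s'.reg 0 = 0) : Decides W T p s A := by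
  obtain ⟨t, s₁, ht, h₁, h₂⟩ := h s (.refl s) hs
  exact ⟨t, s₁, ht, h₁, by rwa [h₂.1 0 (by decide)]⟩

theorem inputMem_bounded {n W : ℕ} {u w : ℕ → ℕ} (hn : n ≤ W) (hu : ∀ i, u i ≤ W)
    (hw : ∀ i, w i ≤ W) : (inputMem n u w).Bounded W := by
  refine ⟨fun r => ?_, fun a i => ?_⟩
  · simp only [inputMem]
    split_ifs <;> omega
  · simp only [inputMem]
    split_ifs
    exacts [hu i, hw i, Nat.zero_le W]

theorem tourArray_le {n : ℕ} (τ : Equiv.Perm (Fin n)) (i : ℕ) : tourArray τ i ≤ n := by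
  unfold tourArray
  split_ifs with h
  exacts [(τ ⟨i, h⟩).2.le, Nat.zero_le n]

theorem encodingArray_le {n : ℕ} (τ : Equiv.Perm (Fin n)) (i : ℕ) : encodingArray τ i ≤ 3 := by
  unfold encodingArray encoding
  split_ifs <;> decide

/-- The program `adjacency` decides the adjacency of two tours that are held in the arrays `a` and
`b`. -/
theorem exists_runs_adjacency_of_tours {n W a b : ℕ} (hn : 2 ≤ n) (hW : 3 ≤ W)
    (ha : a ≠ 2 ∧ a ≠ 3 ∧ a ≠ 6 ∧ a ≠ 7) (hb : b ≠ 2 ∧ b ≠ 3 ∧ b ≠ 6 ∧ b ≠ 7)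
    {x y : Equiv.Perm (Fin n)} (hx : IsPyramidalSB x) (hy : IsPyramidalSB y)
    {v w : (PSB n).extremePoints ℝ} (hv : charVec x = v) (hw : charVec y = w) {s : Mem}
    (hs : s.reg 0 = n) (hsx : ∀ i < n, s.arr a i = tourArray x i)
    (hsy : ∀ i < n, s.arr b i = tourArray y i) :
    ∃ s', Runs W (adjacencyCost a b * n) (adjacency a b) s s' ∧
      ((oneSkeleton (PSB n)).Adj v w ∧ s'.reg 0 = 1 ∨
        ¬ (oneSkeleton (PSB n)).Adj v w ∧ s'.reg 0 = 0) := by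
  have hxp := (hx.isPSB hn).congr hsx (fun _ _ => rfl)
  have hyp := (hy.isPSB hn).congr hsy (fun _ _ => rfl)
  obtain ⟨s', hr, h⟩ := exists_runs_adjacency hW ha hb hs hxp hyp
  refine ⟨s', hr, ?_⟩
  rcases h with ⟨heq, h0⟩ | ⟨r, M, hrn, hne, hMr, hM, hmin, h⟩
  · refine Or.inr ⟨fun hadj => hadj.ne (Subtype.ext ?_), h0⟩
    rw [← hv, ← hw, perm_eq_of_tourArray (x := x) (y := y) fun i hi =>
      by rw [← hsx i hi, ← hsy i hi, heq i hi]]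
  · have key := adj_iff_of_component hn hx hy hv hw hrn (by rwa [← hsx r hrn, ← hsy r hrn]) hMr
      (hM.congr hxp.f_lt (fun i hi => (hsx i hi).symm) (fun _ _ => rfl)
        (fun i hi => (hsy i hi).symm) (fun _ _ => rfl))
      (fun N hN hNr => hmin N (hN.congr (hx.isPSB hn).f_lt hsx (fun _ _ => rfl) hsy
        (fun _ _ => rfl)) hNr)
    have key' : (∀ i < n, s.arr a i ≠ s.arr b i → M i) ↔
        ∀ i < n, tourArray x i ≠ tourArray y i → M i :=
      forall₂_congr fun i hi => by rw [hsx i hi, hsy i hi]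
    rwa [key, ← key']

end PyramidalTour

/-- Vertex adjacency in the 1-skeleton of `PSB(n)` can be decided in linear time, on words of
`O(log n)` bits: both when the two tours are given by their pyramidal encodings (program `P`) and
when they are given by their successor maps (program `Q`). -/
theorem theorem2 :
    ∃ (C : ℕ) (P Q : PyramidalTour.Prog), ∀ n : ℕ, 2 ≤ n →
      ∀ x y : Equiv.Perm (Fin n),
        PyramidalTour.IsPyramidalSB x → PyramidalTour.IsPyramidalSB y →
      ∀ v w : (PyramidalTour.PSB n).extremePoints ℝ,
        PyramidalTour.charVec x = v → PyramidalTour.charVec y = w →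
        PyramidalTour.Decides (C * n) (C * n) P
          (PyramidalTour.inputMem n (PyramidalTour.encodingArray x)
            (PyramidalTour.encodingArray y))
          ((PyramidalTour.oneSkeleton (PyramidalTour.PSB n)).Adj v w) ∧
        PyramidalTour.Decides (C * n) (C * n) Q
          (PyramidalTour.inputMem n (PyramidalTour.tourArray x) (PyramidalTour.tourArray y))
          ((PyramidalTour.oneSkeleton (PyramidalTour.PSB n)).Adj v w) := by
  refine ⟨PyramidalTour.adjacencyCost 4 5 + PyramidalTour.adjacencyCost 0 1 +
    PyramidalTour.decodeCost 0 4 + PyramidalTour.decodeCost 1 5,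
    -- The arrays `4` and `5` are clear of the work arrays `2`, `3`, `6` and `7` of the adjacency
    -- test.
    .seq (PyramidalTour.decode 0 4) (.seq (PyramidalTour.decode 1 5) (PyramidalTour.adjacency 4 5)),
    PyramidalTour.adjacency 0 1, fun n hn x y hx hy v w hv hw => ?_⟩
  set C := PyramidalTour.adjacencyCost 4 5 + PyramidalTour.adjacencyCost 0 1 +
    PyramidalTour.decodeCost 0 4 + PyramidalTour.decodeCost 1 5 with hC
  have hC10 : 10 ≤ C := by
    rw [hC]
    simp only [PyramidalTour.adjacencyCost]
    omega
  have hW : 10 * n ≤ C * n := Nat.mul_le_mul_right n hC10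
  have hsplit : C * n = PyramidalTour.adjacencyCost 4 5 * n +
      PyramidalTour.adjacencyCost 0 1 * n + PyramidalTour.decodeCost 0 4 * n +
      PyramidalTour.decodeCost 1 5 * n := by
    rw [hC]
    ring
  constructor
  · set s := PyramidalTour.inputMem n (PyramidalTour.encodingArray x)
      (PyramidalTour.encodingArray y) with hs
    obtain ⟨s₁, r₁, h₁, h₁', hx₁⟩ := PyramidalTour.exists_runs_decode (W := C * n) (a := 0) (b := 4)
      (n := n) (s := s) (by omega) (by decide) rfl (hx.isPSB hn)
      (hx.isEncoding hn)
    obtain ⟨s₂, r₂, h₂, h₂', hy₂⟩ := PyramidalTour.exists_runs_decode (W := C * n) (a := 1) (b := 5)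
      (n := n) (s := s₁) (by omega) (by decide) h₁ (hy.isPSB hn)
      (by rw [h₁' 1 (by decide)]; exact hy.isEncoding hn)
    obtain ⟨s₃, r₃, h₃⟩ := PyramidalTour.exists_runs_adjacency_of_tours (W := C * n) (a := 4)
      (b := 5) hn (by omega) (by decide) (by decide) hx hy hv hw h₂
      (by rw [h₂' 4 (by decide)]; exact hx₁) hy₂
    refine ((r₁.seq (r₂.seq r₃)).mono (by omega)).decides ?_ h₃
    exact PyramidalTour.inputMem_bounded (by omega)
      (fun i => (PyramidalTour.encodingArray_le x i).trans (by omega))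
      (fun i => (PyramidalTour.encodingArray_le y i).trans (by omega))
  · obtain ⟨s₁, r₁, h₁⟩ := PyramidalTour.exists_runs_adjacency_of_tours (W := C * n) (a := 0)
      (b := 1) (s := PyramidalTour.inputMem n (PyramidalTour.tourArray x)
        (PyramidalTour.tourArray y)) hn (by omega) (by decide) (by decide) hx hy hv hw rfl
      (fun _ _ => rfl) (fun _ _ => rfl)
    refine (r₁.mono (by omega)).decides ?_ h₁
    exact PyramidalTour.inputMem_bounded (by omega)
      (fun i => (PyramidalTour.tourArray_le x i).trans (by omega))
      (fun i => (PyramidalTour.tourArray_le y i).trans (by omega))
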